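/- Let $n,k\ge 1$, let $\mathcal N$ be a smooth (Hausdorff, second countable) manifold of dimension $n+k$, and let $\omega$ be a smooth closed nowhere vanishing $n$-form on $\mathcal N$. For $q\in\mathcal N$ let $D^n_q\mathcal N\subset\Lambda^nT_q\mathcal N$ be the set of decomposable $n$-vectors and $D^\omega_q\mathcal N=\{z\in D^n_q\mathcal N:\omega_q(z)=1\}$, which is identified with the set of oriented $n$-planes of $T_q\mathcal N$ on which $\omega_q>0$; let $L$ be a smooth real function on $D^\omega\mathcal N=\bigcup_qD^\omega_q\mathcal N$. Put $W(q,z,p)=\langle z,p\rangle-L(q,z)$ for $z\in D^\omega_q\mathcal N$, $p\in\Lambda^nT_q^*\mathcal N$, and let $Z_q(p)$ be the set of all $z\in D^\omega_q\mathcal N$ at which the differential of $W(q,\cdot,p)$ on $D^\omega_q\mathcal N$ vanishes. Let $\mathcal M$ be an open subset of $\Lambda^nT^*\mathcal N$, with projection $\Pi:\mathcal M\to\mathcal N$, such that for every $(q,p)\in\mathcal M$ the set $Z_q(p)$ consists of exactly one point $Z(q,p)$ (for open $\mathcal M$ this is the Legendre correspondence hypothesis), and let $\mathcal H(q,p)=W(q,Z(q,p),p)$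 be the Hamiltonian function on $\mathcal M$ obtained in this way; it is supposed to be smooth. Let $$L^{\mathcal H}_{(q,p)}=\left(T_{Z(q,p)}D^n_q\mathcal N\right)^\perp=\{\pi\in\Lambda^nT_q^*\mathcal N:\ \langle\zeta,\pi\rangle=0\ \ \forall\zeta\in T_{Z(q,p)}D^n_q\mathcal N\},$$ regarded as a space of vertical tangent vectors of $\mathcal M$ at $(q,p)$. Let $\theta_{(q,p)}(X_1,\dots,X_n)=p(\Pi_*X_1,\dots,\Pi_*X_n)$ be the Poincaré–Cartan form. A Hamiltonian $n$-curve is an embedded $n$-dimensional submanifold $\Gamma\subset\mathcal M$ on whose tangent spaces $\Pi^*\omega$ does not vanish, oriented so that $\Pi^*\omega|_\Gamma>0$, which is contained in a level set $\{\mathcal H=h\}$ for some constant $h$ and is a critical point of $\mathcal I[\Gamma]=\int_\Gamma(\theta-\mathcal H\,\Pi^*\omega)$: for every smooth family of maps $\Phi_s$ with $\Phi_0=\mathrm{id}$ and $\Phi_s=\mathrm{id}$ outside a compact set $K\subset\mathcal M$ such that $\Gamma\cap K$ is compact, the derivative at $s=0$ of $\int_{\Gamma\cap K}\Phi_s^*(\theta-\mathcal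 H\,\Pi^*\omega)$ is $0$. Then: 1. for all $(q,p)\in\mathcal M$ and all $\xi\in L^{\mathcal H}_{(q,p)}$, $d\mathcal H_{(q,p)}(\xi)=0$; 2. if $\Gamma$ is a Hamiltonian $n$-curve and $\xi$ is a smooth vector field on $\mathcal M$ with $\xi_m\in L^{\mathcal H}_m$ for all $m\in\mathcal M$, then there is $\varepsilon>0$ such that for all $s\in\mathbb R$ with $|s|<\varepsilon$ the image $e^{s\xi}(\Gamma)$ of $\Gamma$ under the flow of $\xi$ is a Hamiltonian $n$-curve. (If $\xi$ is not complete, $e^{s\xi}(\Gamma)$ is the set of the values at time $s$ of those integral curves in $\mathcal M$ that start in $\Gamma$ and exist up to time $s$.) -/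

import Mathlib

open scoped Manifold ContDiff Topology
open Bundle Set
noncomputable section
namespace LepageDedecker

section Bundle

/-- Pulling back alternating forms is a smooth operation on linear maps. -/
theorem contDiff_compContinuousLinearMapCLM {E F : Type*} [NormedAddCommGroup E] [NormedSpace ℝ E]
    [NormedAddCommGroup F] [NormedSpace ℝ F] (n : ℕ) :
    ContDiff ℝ ∞ (ContinuousAlternatingMap.compContinuousLinearMapCLM :
      (E →L[ℝ] F) → (F [⋀^Fin n]→L[ℝ] ℝ) →L[ℝ] (E [⋀^Fin n]→L[ℝ] ℝ)) := by
  let lin : ContinuousMultilinearMap ℝ (fun _ : Fin n => E) ℝ →ₗ[ℝ] (E [⋀^Fin n]→L[ℝ] ℝ) :=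
    { toFun := fun f => ContinuousMultilinearMap.alternatization f
      map_add' := fun f g => map_add _ f g
      map_smul' := fun c f => by
        ext v
        simp [ContinuousMultilinearMap.alternatization_apply_apply, Finset.mul_sum,
          mul_smul_comm] }
  have hbd : ∀ f, ‖lin f‖ ≤ (n.factorial : ℝ) * ‖f‖ := by
    intro f
    refine ContinuousAlternatingMap.opNorm_le_bound (f := lin f) (by positivity) fun v => ?_
    change ‖ContinuousMultilinearMap.alternatization f v‖ ≤ _
    rw [ContinuousMultilinearMap.alternatization_apply_apply]
    calc ‖∑ σ : Equiv.Perm (Fin n), Equiv.Perm.sign σ • f (v ∘ σ)‖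
        ≤ ∑ _σ : Equiv.Perm (Fin n), ‖f‖ * ∏ i, ‖v i‖ := by
          refine norm_sum_le_of_le _ fun σ _ => ?_
          have h1 : ‖Equiv.Perm.sign σ • f (v ∘ σ)‖ = ‖f (v ∘ σ)‖ := by
            rcases Int.units_eq_one_or (Equiv.Perm.sign σ) with h | h <;> simp [h]
          rw [h1]
          refine (f.le_opNorm _).trans (le_of_eq ?_)
          congr 1
          exact Equiv.prod_comp σ fun i => ‖v i‖
      _ = _ := by simp [Fintype.card_perm, mul_assoc]
  let A := lin.mkContinuous _ hbd
  have hA : ∀ q : E [⋀^Fin n]→L[ℝ] ℝ,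
      ((n.factorial : ℝ)⁻¹) • A q.toContinuousMultilinearMap = q := by
    intro q
    ext v
    change (n.factorial : ℝ)⁻¹ * ContinuousMultilinearMap.alternatization
      q.toContinuousMultilinearMap v = q v
    rw [ContinuousMultilinearMap.alternatization_apply_apply]
    have : ∀ σ : Equiv.Perm (Fin n), Equiv.Perm.sign σ • q.toContinuousMultilinearMap (v ∘ σ)
        = q v := by
      intro σ
      have := q.toAlternatingMap.map_perm v σ
      change q (v ∘ σ) = Equiv.Perm.sign σ • q v at this
      change Equiv.Perm.sign σ • q (v ∘ σ) = _
      rw [this, smul_smul]; simp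
    rw [Finset.sum_congr rfl fun σ _ => this σ]
    have : (n.factorial : ℝ) ≠ 0 := by positivity
    simp [Fintype.card_perm, this]
  let B : ContinuousMultilinearMap ℝ (fun _ : Fin n => E) ℝ →L[ℝ] (E [⋀^Fin n]→L[ℝ] ℝ) :=
    ((n.factorial : ℝ)⁻¹) • A
  let C : (F [⋀^Fin n]→L[ℝ] ℝ) →L[ℝ] ContinuousMultilinearMap ℝ (fun _ : Fin n => F) ℝ :=
    ContinuousAlternatingMap.toContinuousMultilinearMapCLM ℝ
  have key : (ContinuousAlternatingMap.compContinuousLinearMapCLM :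
      (E →L[ℝ] F) → (F [⋀^Fin n]→L[ℝ] ℝ) →L[ℝ] (E [⋀^Fin n]→L[ℝ] ℝ)) =
      fun g => B ∘L (ContinuousMultilinearMap.compContinuousLinearMapContinuousMultilinear ℝ
        (fun _ : Fin n ↦ E) (fun _ ↦ F) ℝ (fun _ => g)) ∘L C := by
    funext g
    ext1 q
    exact (hA (q.compContinuousLinearMap g)).symm
  rw [key]
  refine contDiff_const.clm_comp (ContDiff.clm_comp ?_ contDiff_const)
  exact (ContinuousMultilinearMap.contDiff _).comp (contDiff_pi.2 fun _ => contDiff_id)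

theorem contDiff_smul_id (V : Type*) [NormedAddCommGroup V] [NormedSpace ℝ V] :
    ContDiff ℝ ∞ (fun g : ℝ →L[ℝ] ℝ => g 1 • ContinuousLinearMap.id ℝ V) :=
  ContDiff.smul (ContinuousLinearMap.apply ℝ ℝ (1 : ℝ)).contDiff contDiff_const

variable {E : Type*} [NormedAddCommGroup E] [NormedSpace ℝ E]
  {N : Type*} [TopologicalSpace N] [ChartedSpace E N] [IsManifold 𝓘(ℝ, E) ∞ N]

/-- The bundle `Λⁿ T*N` is a smooth vector bundle. -/
instance contMDiffVectorBundle_form (n : ℕ) : ContMDiffVectorBundle ∞ (E [⋀^Fin n]→L[ℝ] ℝ)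
    (fun q : N => TangentSpace 𝓘(ℝ, E) q [⋀^Fin n]→L[ℝ] Bundle.Trivial N ℝ q) 𝓘(ℝ, E) := by
  have : (Bundle.ContinuousAlternatingMap.vectorPrebundle ℝ (Fin n) E
      (TangentSpace 𝓘(ℝ, E) : N → Type _) ℝ (Bundle.Trivial N ℝ)).IsContMDiff 𝓘(ℝ, E) ∞ := by
    refine ⟨?_⟩
    rintro _ ⟨e₁, e₂, he₁, he₂, rfl⟩ _ ⟨e₁', e₂', he₁', he₂', rfl⟩
    refine ⟨Pretrivialization.continuousAlternatingMapCoordChange ℝ (Fin n) e₁ e₁' e₂ e₂', ?_,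
      Pretrivialization.continuousAlternatingMapCoordChange_apply⟩
    have h₁ := contMDiffOn_coordChangeL (IB := 𝓘(ℝ, E)) e₁' e₁ (n := ∞)
    have h₂ := contMDiffOn_coordChangeL (IB := 𝓘(ℝ, E)) e₂ e₂' (n := ∞)
    simp +unfoldPartialApp only [Pretrivialization.continuousAlternatingMapCoordChange,
      ContinuousLinearEquiv.coe_continuousAlternatingMapCongr, ContinuousLinearEquiv.symm_symm]
    change ContMDiffOn _ _ _ _ (e₁.baseSet ∩ e₂.baseSet ∩ (e₁'.baseSet ∩ e₂'.baseSet))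
    have h₃ : ContDiff ℝ ∞ (fun g : ℝ →L[ℝ] ℝ =>
        ContinuousLinearMap.compContinuousAlternatingMapCLM (ι := Fin n) ℝ E ℝ ℝ g) := by
      have h₄ : (fun g : ℝ →L[ℝ] ℝ =>
          ContinuousLinearMap.compContinuousAlternatingMapCLM (ι := Fin n) ℝ E ℝ ℝ g) =
          fun g => g 1 • ContinuousLinearMap.id ℝ (E [⋀^Fin n]→L[ℝ] ℝ) := by
        funext g
        ext p v
        have h₅ : g (p v) = p v * g 1 := by simpa using g.map_smul (p v) 1
        simp [h₅, mul_comm]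
      rw [h₄]
      exact contDiff_smul_id (E [⋀^Fin n]→L[ℝ] ℝ)
    refine ContMDiffOn.clm_comp ?_ ?_
    · exact h₃.contMDiff.comp_contMDiffOn (h₂.mono (by mfld_set_tac))
    · exact (contDiff_compContinuousLinearMapCLM n).contMDiff.comp_contMDiffOn
        (h₁.mono (by mfld_set_tac))
  exact (Bundle.ContinuousAlternatingMap.vectorPrebundle ℝ (Fin n) E
      (TangentSpace 𝓘(ℝ, E) : N → Type _) ℝ (Bundle.Trivial N ℝ)).contMDiffVectorBundle 𝓘(ℝ, E)

end Bundle

variable {n : ℕ} {E : Type*} [NormedAddCommGroup E] [NormedSpace ℝ E]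
  {N : Type*} [TopologicalSpace N] [ChartedSpace E N] [IsManifold 𝓘(ℝ, E) ∞ N]

/-! ### Forms and multivectors -/

variable (n E) in
/-- The fibre `Λⁿ T*_q N`: alternating `n`-forms on `T_q N`. -/
abbrev Form (q : N) : Type _ :=
  TangentSpace 𝓘(ℝ, E) q [⋀^Fin n]→L[ℝ] Bundle.Trivial N ℝ q

variable (n E N) in
/-- The manifold `Λⁿ T*N`; a point is a pair `(q, p)`, `p ∈ Λⁿ T*_q N`. -/
abbrev FormBundle : Type _ := TotalSpace (E [⋀^Fin n]→L[ℝ] ℝ) (fun q : N => Form n E q)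

variable (n E) in
/-- The model with corners of the manifold `Λⁿ T*N`. -/
abbrev formModel : ModelWithCorners ℝ (E × (E [⋀^Fin n]→L[ℝ] ℝ))
    (ModelProd E (E [⋀^Fin n]→L[ℝ] ℝ)) :=
  𝓘(ℝ, E).prod 𝓘(ℝ, E [⋀^Fin n]→L[ℝ] ℝ)

variable (n E) in
/-- The fibre `Λⁿ T_q N`, realized as the dual of `Λⁿ T*_q N`
(the two are canonically isomorphic, as `T_q N` is finite dimensional). -/
abbrev MultiVec (q : N) : Type _ := Form n E q →L[ℝ] Bundle.Trivial N ℝ q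

variable (n E N) in
/-- The manifold `Λⁿ TN`. -/
abbrev MultiVecBundle : Type _ :=
  TotalSpace ((E [⋀^Fin n]→L[ℝ] ℝ) →L[ℝ] ℝ) (fun q : N => MultiVec n E q)

/-- The duality pairing `⟨z, p⟩`. -/
def pairing {q : N} (z : MultiVec n E q) (p : Form n E q) : ℝ := z p

/-- `z₁ ∧ ⋯ ∧ zₙ`, i.e. the functional `p ↦ p(z₁, …, zₙ)`. -/
def wedge {q : N} (v : Fin n → TangentSpace 𝓘(ℝ, E) q) : MultiVec n E q :=
  ContinuousAlternatingMap.apply ℝ (TangentSpace 𝓘(ℝ, E) q) (Bundle.Trivial N ℝ q) v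

variable (n E) in
/-- `Dⁿ_q N`, the decomposable `n`-vectors. -/
def decomposable (q : N) : Set (MultiVec n E q) := range wedge

/-- `D^ω_q N = {z ∈ Dⁿ_q N : ω_q(z) = 1}`, identified with `Gr^ω_q N`. The space-time volume form
`ω` is called `vol` in the code. -/
def unitDecomposable (vol : ∀ q : N, Form n E q) (q : N) : Set (MultiVec n E q) :=
  {z | z ∈ decomposable n E q ∧ pairing z (vol q) = 1}

/-- Smooth curves in the finite dimensional vector space `Λⁿ T_q N`: all the linear coordinates
are smooth. -/
def IsSmoothCurve {q : N} (c : ℝ → MultiVec n E q) : Prop :=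
  ∀ p : Form n E q, ContDiff ℝ ∞ fun t => pairing (c t) p

/-- `T_z Dⁿ_q N` for `z ≠ 0`: the velocities at `z` of the smooth curves of `Λⁿ T_q N` that run in
`Dⁿ_q N` (away from `0`, this set is a submanifold of `Λⁿ T_q N`). -/
def tangentDecomposable {q : N} (z : MultiVec n E q) : Set (MultiVec n E q) :=
  {ζ | ∃ c : ℝ → MultiVec n E q, IsSmoothCurve c ∧ (∀ t, c t ∈ decomposable n E q) ∧ c 0 = z ∧
    ∀ p, HasDerivAt (fun t => pairing (c t) p) (pairing ζ p) 0}

/-- `(T_z Dⁿ_q N)^⊥ ⊆ Λⁿ T*_q N`. -/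
def conormal {q : N} (z : MultiVec n E q) : Set (Form n E q) :=
  {η | ∀ ζ ∈ tangentDecomposable z, pairing ζ η = 0}

/-! ### Space-time volume, Lagrangian, Legendre correspondence -/

/-- Smooth `n`-forms on `N`. -/
def IsSmoothForm (vol : ∀ q : N, Form n E q) : Prop :=
  ContMDiff 𝓘(ℝ, E) (formModel n E) ∞ (fun q : N => (⟨q, vol q⟩ : FormBundle n E N))

/-- `dω = 0`, in the charts of `N`. -/
def IsClosedForm (vol : ∀ q : N, Form n E q) : Prop :=
  ∀ q₀ : N, ∀ y ∈ (extChartAt 𝓘(ℝ, E) q₀).target,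
    extDeriv (𝕜 := ℝ) (E := E) (F := ℝ) (fun y' : E =>
      (vol ((extChartAt 𝓘(ℝ, E) q₀).symm y')).compContinuousLinearMap
        (mfderiv 𝓘(ℝ, E) 𝓘(ℝ, E) (extChartAt 𝓘(ℝ, E) q₀).symm y')) y = 0

/-- Smooth Lagrangian densities on `Gr^ω N ≃ D^ω N`: the function `L` is smooth on the submanifold
`D^ω N` of `Λⁿ TN`. Its values off `D^ω N` are irrelevant. -/
def IsSmoothLagrangian (vol : ∀ q : N, Form n E q) (L : ∀ q : N, MultiVec n E q → ℝ) : Prop :=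
  ContMDiffOn (𝓘(ℝ, E).prod 𝓘(ℝ, (E [⋀^Fin n]→L[ℝ] ℝ) →L[ℝ] ℝ)) 𝓘(ℝ, ℝ) ∞
    (fun x : MultiVecBundle n E N => L x.proj x.snd) {x | x.snd ∈ unitDecomposable vol x.proj}

/-- `W(q, z, p) = ⟨z, p⟩ - L(q, z)`. -/
def legendreW (L : ∀ q : N, MultiVec n E q → ℝ) (q : N) (z : MultiVec n E q)
    (p : Form n E q) : ℝ :=
  pairing z p - L q z

/-- The set `Z_q(p)` of all `z ∈ D^ω_q N` with `∂W/∂z (q, z, p) = 0`, that is, the differential at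
`z` of `W(q, ·, p)` vanishes on `T_z D^ω_q N`. -/
def legendreZ (vol : ∀ q : N, Form n E q) (L : ∀ q : N, MultiVec n E q → ℝ) (q : N)
    (p : Form n E q) : Set (MultiVec n E q) :=
  {z | z ∈ unitDecomposable vol q ∧
    ∀ c : ℝ → MultiVec n E q, IsSmoothCurve c → (∀ t, c t ∈ unitDecomposable vol q) → c 0 = z →
      HasDerivAt (fun t => legendreW L q (c t) p) 0 0}

/-- `𝓗` is a Legendre image Hamiltonian function on the open set `M ⊆ Λⁿ T*N`. Since `M` is open,
the Legendre correspondence hypothesis says that `Z_q(p)` is a single point for `(q, p) ∈ M`. -/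
structure IsLegendreImage (vol : ∀ q : N, Form n E q) (L : ∀ q : N, MultiVec n E q → ℝ)
    (M : Set (FormBundle n E N)) (𝓗 : FormBundle n E N → ℝ) : Prop where
  existsUnique : ∀ m ∈ M, ∃! z, z ∈ legendreZ vol L m.proj m.snd
  eq_W : ∀ m ∈ M, ∀ z ∈ legendreZ vol L m.proj m.snd, 𝓗 m = legendreW L m.proj z m.snd
  smooth : ContMDiffOn (formModel n E) 𝓘(ℝ, ℝ) ∞ 𝓗 M

/-- The inclusion `Λⁿ T*_q N ⊆ T_{(q,p)} Λⁿ T*N` of the vertical tangent space: the velocity of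
`t ↦ (q, p + t η)` at `t = 0`. -/
def verticalLift (m : FormBundle n E N) (η : Form n E m.proj) : TangentSpace (formModel n E) m :=
  mfderiv 𝓘(ℝ, ℝ) (formModel n E) (fun t : ℝ => (⟨m.proj, m.snd + t • η⟩ : FormBundle n E N)) 0
    (1 : ℝ)

/-- The pseudofiber direction `L^𝓗_{(q,p)} = (T_{Z(q,p)} Dⁿ_q N)^⊥`, as a set of vertical tangent
vectors at `(q, p)`. -/
def pseudofiberDirection (vol : ∀ q : N, Form n E q) (L : ∀ q : N, MultiVec n E q → ℝ)
    (m : FormBundle n E N) : Set (TangentSpace (formModel n E) m) :=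
  {v | ∃ z ∈ legendreZ vol L m.proj m.snd, ∃ η ∈ conormal z, v = verticalLift m η}

/-! ### Submanifolds of `Λⁿ T*N` and the action -/

/-- The projection `Π_* X` to `T_q N` of an `n`-tuple of tangent vectors at `(q, p)`. -/
def project (m : FormBundle n E N) (X : Fin n → TangentSpace (formModel n E) m) :
    Fin n → TangentSpace 𝓘(ℝ, E) m.proj :=
  fun i => mfderiv (formModel n E) 𝓘(ℝ, E)
    (fun m' : FormBundle n E N => m'.proj) m (X i)

/-- The form `Π^* ω` on `Λⁿ T*N`. -/
def volumeForm (vol : ∀ q : N, Form n E q) (m : FormBundle n E N)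
    (X : Fin n → TangentSpace (formModel n E) m) : ℝ :=
  vol m.proj (project m X)

/-- The Poincaré–Cartan form `θ` on `Λⁿ T*N`. -/
def poincareCartan (m : FormBundle n E N) (X : Fin n → TangentSpace (formModel n E) m) : ℝ :=
  m.snd (project m X)

/-- The form `θ - 𝓗 ω`. -/
def actionForm (vol : ∀ q : N, Form n E q) (𝓗 : FormBundle n E N → ℝ) (m : FormBundle n E N)
    (X : Fin n → TangentSpace (formModel n E) m) : ℝ :=
  poincareCartan m X - 𝓗 m * volumeForm vol m X

/-- The partial derivatives `∂γ/∂x₁, …, ∂γ/∂xₙ` of a map `γ` from `ℝⁿ` to `Λⁿ T*N`. -/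
def partials (γ : (Fin n → ℝ) → FormBundle n E N) (x : Fin n → ℝ) :
    Fin n → TangentSpace (formModel n E) (γ x) :=
  fun i => mfderiv 𝓘(ℝ, Fin n → ℝ) (formModel n E) γ x (Pi.single i 1 : Fin n → ℝ)

/-- `γ : U → Γ` is a smooth parametrization of an open subset of `Γ`, along which `ω` is positive
(so that `γ` is an immersion, and orientation preserving for the orientation of `Γ` by `ω`). -/
structure IsPositivePatch (vol : ∀ q : N, Form n E q) (Γ : Set (FormBundle n E N))
    (U : Set (Fin n → ℝ)) (γ : (Fin n → ℝ) → FormBundle n E N) : Prop where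
  isOpen : IsOpen U
  smooth : ContMDiffOn 𝓘(ℝ, Fin n → ℝ) (formModel n E) ∞ γ U
  injOn : InjOn γ U
  isOpen_image : ∀ U' ⊆ U, IsOpen U' → ∃ V, IsOpen V ∧ γ '' U' = Γ ∩ V
  pos : ∀ x ∈ U, 0 < volumeForm vol (γ x) (partials γ x)

/-- `Γ` is an (embedded) `n`-dimensional submanifold of `M` such that `ω` does not vanish on its
tangent spaces, oriented so that `ω|_Γ > 0`. -/
def IsPositiveSubmanifold (vol : ∀ q : N, Form n E q) (M Γ : Set (FormBundle n E N)) : Prop :=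
  Γ ⊆ M ∧ ∀ m ∈ Γ, ∃ U γ, IsPositivePatch vol Γ U γ ∧ m ∈ γ '' U

/-- Oriented parametrizations of open subsets of `Γ`, together with smooth weights whose supports
in `Γ` are compact subsets of these open subsets and which add up to `1` on `Γ ∩ K`: the data by
which one integrates over `Γ ∩ K`. -/
structure PatchSystem (vol : ∀ q : N, Form n E q) (Γ K : Set (FormBundle n E N)) where
  num : ℕ
  dom : Fin num → Set (Fin n → ℝ)
  param : Fin num → (Fin n → ℝ) → FormBundle n E N
  isPatch : ∀ i, IsPositivePatch vol Γ (dom i) (param i)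
  weight : Fin num → FormBundle n E N → ℝ
  weight_smooth : ∀ i, ContMDiff (formModel n E) 𝓘(ℝ, ℝ) ∞ (weight i)
  weight_support : ∀ i, ∃ C ⊆ dom i, IsCompact C ∧ ∀ m ∈ Γ, m ∉ param i '' C → weight i m = 0
  sum_weight : ∀ m ∈ Γ ∩ K, ∑ i, weight i m = 1

/-- The action `∫ (θ - 𝓗 ω)` of the image under `φ` of the part of `Γ` that is covered by the
patches (counted with the weights), that is, `∫_Γ (∑ᵢ χᵢ) φ^*(θ - 𝓗 ω)`. -/
def PatchSystem.action {vol : ∀ q : N, Form n E q} {Γ K : Set (FormBundle n E N)}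
    (P : PatchSystem vol Γ K) (𝓗 : FormBundle n E N → ℝ)
    (φ : FormBundle n E N → FormBundle n E N) : ℝ :=
  ∑ i, ∫ x in P.dom i, P.weight i (P.param i x) *
    actionForm vol 𝓗 (φ (P.param i x)) (partials (fun y => φ (P.param i y)) x)

/-- `(Φ_s)` is a smooth family of maps with `Φ_0 = id` and `Φ_s = id` outside the compact set
`K ⊆ M` (so, for small `s`, it is a family of diffeomorphisms that preserve `M`). -/
structure IsVariation (M K : Set (FormBundle n E N))
    (Φ : ℝ → FormBundle n E N → FormBundle n E N) : Prop where
  isCompact : IsCompact K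
  subset : K ⊆ M
  smooth : ContMDiff (𝓘(ℝ, ℝ).prod (formModel n E)) (formModel n E) ∞
    (fun x : ℝ × FormBundle n E N => Φ x.1 x.2)
  zero : ∀ m, Φ 0 m = m
  eq_self : ∀ s, ∀ m ∉ K, Φ s m = m

/-- `Γ` is a critical point of `𝓘[Γ] = ∫_Γ (θ - 𝓗 ω)`: the derivative at `s = 0` of the action of
`Φ_s(Γ)` vanishes for all variations whose support `K` is compact and meets `Γ` in a compact set.
(If there is a patch system for `K`, then `Γ ∩ K` is compact, and conversely. Outside `K` the
integrand does not depend on `s`, so the derivative is that of the action of `Φ_s(Γ ∩ K)`.) -/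
def IsCriticalPoint (vol : ∀ q : N, Form n E q) (𝓗 : FormBundle n E N → ℝ)
    (M Γ : Set (FormBundle n E N)) : Prop :=
  ∀ K Φ, IsVariation M K Φ → ∀ P : PatchSystem vol Γ K,
    HasDerivAt (fun s => P.action 𝓗 (Φ s)) 0 0

/-- Hamiltonian `n`-curves in `M`: critical points of the action among the submanifolds with
`ω|_Γ > 0`, contained in a level set of `𝓗`. -/
structure IsHamiltonianCurve (vol : ∀ q : N, Form n E q) (𝓗 : FormBundle n E N → ℝ)
    (M Γ : Set (FormBundle n E N)) : Prop where
  submanifold : IsPositiveSubmanifold vol M Γ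
  critical : IsCriticalPoint vol 𝓗 M Γ
  level : ∃ h : ℝ, ∀ m ∈ Γ, 𝓗 m = h

/-- The image `e^{sξ}(Γ)` of `Γ` under the (local) flow of the vector field `ξ` on `M`: the points
at time `s` of the integral curves in `M` that start in `Γ` and exist up to time `s`. -/
def flowImage (M : Set (FormBundle n E N))
    (ξ : ∀ m : FormBundle n E N, TangentSpace (formModel n E) m) (s : ℝ)
    (Γ : Set (FormBundle n E N)) : Set (FormBundle n E N) :=
  {m | ∃ c : ℝ → FormBundle n E N, c 0 ∈ Γ ∧ (∀ t ∈ uIcc 0 s, c t ∈ M) ∧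
    IsMIntegralCurveOn c ξ (uIcc 0 s) ∧ c s = m}

end LepageDedecker
end

/-! The heart of the matter is the identity `∂𝓗/∂p = Z(q, p)`. Formally it is the envelope theorem:
differentiating `𝓗(p) = ⟨Z(p), p⟩ - L(Z(p))` in `p`, the terms that contain the derivative of `Z`
cancel because `Z(p)` is a critical point. But `Z` is not assumed to be differentiable, or even
continuous; only `𝓗` is smooth. So the set of critical pairs `(z, p)` is parametrized locally by a
smooth map `Ψ` from the space of momenta to itself. At regular values of `Ψ` the formal computation
is legitimate, and by Sard's theorem in equal dimensions these are dense. The differential of `𝓗`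
along the fibre is continuous, the set `D^ω_q N` is closed and criticality passes to limits, so
uniqueness of the critical point gives the identity everywhere (`fderiv_eq_of_mem_criticalSet`).

Assertion 1 follows: decomposable vectors form a cone, so `Z` is itself tangent to the cone at `Z`,
and a conormal form `η` satisfies `d𝓗(η) = ⟨Z, η⟩ = 0`.

For assertion 2, integral curves of a field in the pseudofibre directions stay in one fibre. Adding
a form conormal at `Z` to `p` does not change the critical point, so the second derivative of `𝓗` in
a pseudofibre direction vanishes and `Z` is constant along integral curves. Hence the time `s` flow
is a smooth map `(q, p) ↦ (q, p + η)` with `η` conormal at `Z(q, p)`, with a smooth inverse of the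
same kind, and it preserves `𝓗` (`exists_isConormalShiftPair`).

It remains to see that such a shift preserves critical points of the action
(`IsConormalShiftPair.isCriticalPoint`). Vertical variations show that the projected tangent
multivector of a critical `Γ` is a positive multiple of `Z` (`IsLegendreImage.wedge_partials_eq`). A
variation of the image of `Γ` is conjugated by the shift to a variation of `Γ`, and the two
integrands differ by `η(t)(X₁(t), …, Xₙ(t))`, where `t` is the variation parameter. At `t = 0` the
derivative of this term vanishes. Varying the `Xᵢ` gives a vector tangent to the cone at a multiple
of `Z`, which `η(0)` annihilates. Varying `η` gives a multiple of `⟨Z, η'⟩`, and this is zero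
because `⟨Z(t), η(t)⟩ = 0` for all small `t` and `⟨Z'(0), η(0)⟩ = 0`, since `Z'(0)` is tangent to
the cone (`hasDerivAt_apply_conormal`). -/

namespace LepageDedecker

set_option synthInstance.maxHeartbeats 200000

/-! ### Smoothness of superposition operators on spaces of continuous functions -/

section Nemytskii

universe u

variable {I : Type*} [TopologicalSpace I] [CompactSpace I]
  {V W W' : Type u} [NormedAddCommGroup V] [NormedSpace ℝ V] [NormedAddCommGroup W]
  [NormedSpace ℝ W] [NormedAddCommGroup W'] [NormedSpace ℝ W']

variable (I) in
/-- Pointwise application of a bounded bilinear map to continuous maps. -/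
noncomputable def pointwiseBilinear (b : W' →L[ℝ] V →L[ℝ] W) :
    C(I, W') →L[ℝ] C(I, V) →L[ℝ] C(I, W) :=
  LinearMap.mkContinuous₂
    (LinearMap.mk₂ ℝ (fun (A : C(I, W')) (h : C(I, V)) =>
        (⟨fun t => b (A t) (h t), (b.continuous.comp A.continuous).clm_apply h.continuous⟩ :
          C(I, W)))
      (fun _ _ _ => by ext; simp) (fun _ _ _ => by ext; simp)
      (fun _ _ _ => by ext; simp) (fun _ _ _ => by ext; simp)) ‖b‖ (by
    intro A h
    refine (ContinuousMap.norm_le _ (by positivity)).2 fun t => ?_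
    refine (b.le_opNorm₂ _ _).trans ?_
    gcongr
    · exact A.norm_coe_le_norm t
    · exact h.norm_coe_le_norm t)

/-- Composition with a fixed continuous map, as an operator between spaces of continuous maps. -/
def nemytskii (f : V → W) (hf : Continuous f) (u : C(I, V)) : C(I, W) := ⟨f ∘ u, hf.comp u.2⟩

/-- The mean value inequality on the ball of radius `δ` about `u t` bounds the remainder at `t`.
Uniform continuity of `f'` makes `δ` independent of `t`, which is what an estimate in the supremum
norm requires. -/
theorem hasFDerivAt_nemytskii (b : W' →L[ℝ] V →L[ℝ] W) {f : V → W} (hfc : Continuous f)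
    {f' : V → W'} (hfc' : Continuous f') (hf : ∀ x, HasFDerivAt f (b (f' x)) x)
    (hf' : UniformContinuous f') (u : C(I, V)) :
    HasFDerivAt (nemytskii (I := I) f hfc) (pointwiseBilinear I b (nemytskii f' hfc' u)) u := by
  rw [hasFDerivAt_iff_isLittleO_nhds_zero, Asymptotics.isLittleO_iff]
  intro c hc
  obtain ⟨δ, hδ, hδc⟩ := Metric.uniformContinuous_iff.1
    (b.uniformContinuous.comp hf') c hc
  filter_upwards [Metric.ball_mem_nhds (0 : C(I, V)) hδ] with h hh
  rw [mem_ball_zero_iff] at hh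
  refine (ContinuousMap.norm_le _ (by positivity)).2 fun t => ?_
  change ‖f (u t + h t) - f (u t) - b (f' (u t)) (h t)‖ ≤ c * ‖h‖
  have h1 : ‖h t‖ ≤ ‖h‖ := h.norm_coe_le_norm t
  have key := (convex_ball (u t) δ).norm_image_sub_le_of_norm_hasFDerivWithin_le'
    (f := f) (f' := fun x => b (f' x)) (φ := b (f' (u t))) (C := c) (x := u t) (y := u t + h t)
    (fun x _ => (hf x).hasFDerivWithinAt)
    (fun x hx => by
      rw [← dist_eq_norm]
      exact (hδc hx).le) (Metric.mem_ball_self hδ)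
    (by simpa [Metric.mem_ball, dist_eq_norm] using h1.trans_lt hh)
  rw [add_sub_cancel_left] at key
  exact key.trans (mul_le_mul_of_nonneg_left h1 hc.le)

theorem contDiff_succ_nemytskii (b : W' →L[ℝ] V →L[ℝ] W) {f : V → W} (hfc : Continuous f)
    {f' : V → W'} (hfc' : Continuous f') (hf : ∀ x, HasFDerivAt f (b (f' x)) x)
    (hf' : UniformContinuous f') {k : ℕ} (h : ContDiff ℝ k (nemytskii (I := I) f' hfc')) :
    ContDiff ℝ (k + 1 : ℕ) (nemytskii (I := I) f hfc) := by
  have := (contDiff_succ_iff_hasFDerivAt (n := k) (𝕜 := ℝ) (f := nemytskii (I := I) f hfc)).2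
    ⟨fun u => pointwiseBilinear I b (nemytskii f' hfc' u),
      (pointwiseBilinear I b).contDiff.comp h, hasFDerivAt_nemytskii b hfc hfc' hf hf'⟩
  exact_mod_cast this

variable (I) in
-- The induction runs over all target spaces at once, since the derivative of the operator of `f` is
-- built from the operator of `fderiv ℝ f`, whose target is `V →L[ℝ] W`. Compact support provides
-- the uniform continuity of `fderiv ℝ f`.
theorem contDiff_nemytskii (k : ℕ) :
    ∀ {W : Type u} [NormedAddCommGroup W] [NormedSpace ℝ W] {f : V → W} (hf : ContDiff ℝ ∞ f),
      HasCompactSupport f → ContDiff ℝ k (nemytskii (I := I) f hf.continuous) := by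
  induction k with
  | zero =>
    intro W _ _ f hf _
    exact contDiff_zero.2 (ContinuousMap.continuous_postcomp ⟨f, hf.continuous⟩)
  | succ k ih =>
    intro W _ _ f hf hc
    have hd : ContDiff ℝ ∞ (fderiv ℝ f) := hf.fderiv_right (by simp)
    exact contDiff_succ_nemytskii (ContinuousLinearMap.id ℝ (V →L[ℝ] W)) hf.continuous
      hd.continuous (fun x => (hf.differentiable (by simp) x).hasFDerivAt)
      ((hc.fderiv ℝ).uniformContinuous_of_continuous hd.continuous) (ih hd (hc.fderiv ℝ))

end Nemytskii

/-! ### Smooth dependence of solutions of differential equations on the initial value -/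

section Flow

universe u

variable {V : Type u} [NormedAddCommGroup V] [NormedSpace ℝ V]

variable (V) in
/-- The primitive vanishing at `0`, as an operator on continuous functions on `[0, 1]`. -/
noncomputable def primitive : C(Icc (0 : ℝ) 1, V) →L[ℝ] C(Icc (0 : ℝ) 1, V) :=
  LinearMap.mkContinuous
    { toFun := fun w => ⟨fun t => ∫ τ in (0 : ℝ)..t, IccExtend zero_le_one w τ,
        (intervalIntegral.continuous_primitive
          (fun _ _ => (w.continuous.Icc_extend' (h := zero_le_one)).intervalIntegrable _ _) 0).comp
          continuous_subtype_val⟩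
      map_add' := fun w w' => by
        ext t
        exact intervalIntegral.integral_add
          ((w.continuous.Icc_extend' (h := zero_le_one)).intervalIntegrable _ _)
          ((w'.continuous.Icc_extend' (h := zero_le_one)).intervalIntegrable _ _)
      map_smul' := fun c w => by
        ext t
        exact intervalIntegral.integral_smul c _ } 1 (by
    intro w
    rw [one_mul]
    refine (ContinuousMap.norm_le _ (norm_nonneg _)).2 fun t => ?_
    have := intervalIntegral.norm_integral_le_of_norm_le_const (a := (0 : ℝ)) (b := t)
      (f := IccExtend zero_le_one w) (C := ‖w‖) (fun x _ => w.norm_coe_le_norm _)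
    refine this.trans ?_
    rw [sub_zero, abs_of_nonneg t.2.1]
    exact mul_le_of_le_one_right (norm_nonneg _) t.2.2)

theorem norm_primitive_le : ‖primitive V‖ ≤ 1 :=
  LinearMap.mkContinuous_norm_le _ zero_le_one _

/-- `u` solves `u' = f(u)` on `[0, 1]`. -/
def SolvesODE (f : V → V) (u : ℝ → V) : Prop :=
  ∀ t ∈ Icc (0 : ℝ) 1, HasDerivWithinAt u (f (u t)) (Icc 0 1) t

theorem SolvesODE.continuousOn {f : V → V} {u : ℝ → V} (h : SolvesODE f u) :
    ContinuousOn u (Icc 0 1) := fun t ht => (h t ht).continuousWithinAt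

/-- A solution with initial value `x` is a solution `w` of `w - T w = x` in the Banach space of
continuous functions on `[0, 1]`, where `T w` is the primitive of `f ∘ w`. As `T` is smooth with
Lipschitz constant `1 / 2`, the map `id - T` is a homeomorphism with smooth inverse, and `ψ`
evaluates this inverse at time one on constant functions. Uniqueness of solutions is part of the
conclusion. -/
theorem exists_contDiff_timeOne_of_lipschitz [CompleteSpace V] {f : V → V} (hf : ContDiff ℝ ∞ f)
    (hc : HasCompactSupport f) (hK : LipschitzWith (1 / 2) f) :
    ∃ ψ : V → V, ContDiff ℝ ∞ ψ ∧ ∀ u, SolvesODE f u → u 1 = ψ (u 0) := by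
  -- Nontriviality of `V` is needed for the identity of `X` to have norm `1`.
  cases subsingleton_or_nontrivial V with
  | inl _ => exact ⟨id, contDiff_id, fun u _ => Subsingleton.elim _ _⟩
  | inr _ =>
  let X := C(Icc (0 : ℝ) 1, V)
  let T : X → X := fun w => primitive V (nemytskii f hf.continuous w)
  have hT : ContDiff ℝ ∞ T := by
    refine (primitive V).contDiff.comp (contDiff_infty.2 fun k => contDiff_nemytskii _ k hf hc)
  have hTL : LipschitzWith (1 / 2) T := by
    refine LipschitzWith.of_dist_le_mul fun w w' => ?_
    rw [dist_eq_norm, ← map_sub]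
    refine ((primitive V).le_of_opNorm_le norm_primitive_le _).trans ?_
    rw [one_mul]
    refine (ContinuousMap.norm_le _ (by positivity)).2 fun t => ?_
    have h1 := hK.dist_le_mul (w t) (w' t)
    rw [dist_eq_norm] at h1
    exact h1.trans (mul_le_mul_of_nonneg_left (ContinuousMap.dist_apply_le_dist t) (by simp))
  let P : X → X := fun w => w - T w
  have hP : ContDiff ℝ ∞ P := contDiff_id.sub hT
  have hA : ApproximatesLinearOn P ((ContinuousLinearEquiv.refl ℝ X : X ≃L[ℝ] X) : X →L[ℝ] X)
      univ (1 / 2) := by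
    intro w _ w' _
    have := hTL.dist_le_mul w' w
    rw [dist_eq_norm, dist_comm, dist_eq_norm] at this
    have h2 : P w - P w' - (w - w') = T w' - T w := by simp only [P]; abel
    change ‖P w - P w' - (w - w')‖ ≤ _
    rw [h2]
    exact this
  have hN : Subsingleton X ∨ (1 / 2 : NNReal) <
      ‖((ContinuousLinearEquiv.refl ℝ X).symm : X →L[ℝ] X)‖₊⁻¹ := by
    right
    have : ((ContinuousLinearEquiv.refl ℝ X).symm : X →L[ℝ] X) = ContinuousLinearMap.id ℝ X := rfl
    rw [this]
    have h3 : ‖ContinuousLinearMap.id ℝ X‖₊ = 1 := by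
      ext; simp
    rw [h3, inv_one]
    exact NNReal.half_lt_self one_ne_zero
  let Φ : X ≃ₜ X := hA.toHomeomorph P hN
  have hΦ : ∀ w, Φ w = P w := fun w => rfl
  -- The derivative of `P` is `id - T'` with `‖T'‖ ≤ 1 / 2`, hence invertible by the Neumann series.
  have hlt : ∀ w, ‖fderiv ℝ T w‖ < 1 := by
    intro w
    refine lt_of_le_of_lt (norm_fderiv_le_of_lipschitz ℝ hTL) ?_
    simp only [NNReal.coe_div, NNReal.coe_one, NNReal.coe_ofNat]
    norm_num
  have hsymm : ContDiff ℝ ∞ Φ.symm := by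
    refine Φ.contDiff_symm (f₀' := fun w => ContinuousLinearEquiv.unitsEquiv ℝ X
      (Units.oneSub (fderiv ℝ T w) (hlt w))) (fun w => ?_) hP
    have h4 : HasFDerivAt P (ContinuousLinearMap.id ℝ X - fderiv ℝ T w) w :=
      (hasFDerivAt_id w).sub (hT.differentiable (by simp) w).hasFDerivAt
    exact h4
  let cst : V →L[ℝ] X := LinearMap.mkContinuous
    { toFun := fun x => ContinuousMap.const _ x
      map_add' := fun _ _ => rfl
      map_smul' := fun _ _ => rfl } 1 (fun x => by
        rw [one_mul]
        exact (ContinuousMap.norm_le _ (norm_nonneg _)).2 fun t => le_rfl)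
  refine ⟨fun x => Φ.symm (cst x) ⟨1, by simp⟩, ?_, fun u hu => ?_⟩
  · exact (ContinuousMap.evalCLM ℝ (⟨1, by simp⟩ : Icc (0 : ℝ) 1)).contDiff.comp
      (hsymm.comp cst.contDiff)
  · let w : X := ⟨fun t => u t, continuousOn_iff_continuous_domRestrict.1 hu.continuousOn⟩
    have hw : Φ w = cst (u 0) := by
      rw [hΦ]
      ext t
      change u t - ∫ τ in (0 : ℝ)..t, IccExtend zero_le_one (nemytskii f hf.continuous w) τ = u 0
      have h5 : ∫ τ in (0 : ℝ)..t, IccExtend zero_le_one (nemytskii f hf.continuous w) τ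
          = u t - u 0 := by
        refine intervalIntegral.integral_eq_sub_of_hasDerivAt_of_le t.2.1
          (hu.continuousOn.mono (Icc_subset_Icc_right t.2.2)) (fun τ hτ => ?_)
          ((nemytskii f hf.continuous w).continuous.Icc_extend'.intervalIntegrable _ _)
        have hτ' : τ ∈ Ioo (0 : ℝ) 1 := ⟨hτ.1, hτ.2.trans_le t.2.2⟩
        rw [IccExtend_of_mem _ _ (Ioo_subset_Icc_self hτ')]
        exact (hu τ (Ioo_subset_Icc_self hτ')).hasDerivAt (Icc_mem_nhds hτ'.1 hτ'.2)
      rw [h5]; abel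
    change u 1 = Φ.symm (cst (u 0)) ⟨1, _⟩
    rw [← hw, Φ.symm_apply_apply]
    rfl

/-- The time one map of the flow of a compactly supported smooth vector field is smooth. -/
theorem exists_contDiff_timeOne [CompleteSpace V] {f : V → V} (hf : ContDiff ℝ ∞ f)
    (hc : HasCompactSupport f) :
    ∃ ψ : V → V, ContDiff ℝ ∞ ψ ∧ ∀ u, SolvesODE f u → u 1 = ψ (u 0) := by
  obtain ⟨K, hK⟩ := hf.lipschitzWith_of_hasCompactSupport hc (by simp)
  -- With `m > 2K` the field `f / m` has Lipschitz constant at most `1 / 2`, and the time one map of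
  -- `f` is the `m`-fold iterate of the time one map of `f / m`.
  obtain ⟨m, hm⟩ := exists_nat_gt (2 * (K : ℝ))
  have hm0 : (0 : ℝ) < m := lt_of_le_of_lt (by positivity) hm
  have hgL : LipschitzWith (1 / 2) (fun x => (m : ℝ)⁻¹ • f x) := by
    refine LipschitzWith.of_dist_le_mul fun x y => ?_
    rw [dist_smul₀, norm_inv, Real.norm_of_nonneg hm0.le]
    have h1 := hK.dist_le_mul x y
    have h2 : (m : ℝ)⁻¹ * K ≤ 1 / 2 := by
      rw [inv_mul_le_iff₀ hm0]; linarith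
    calc (m : ℝ)⁻¹ * dist (f x) (f y) ≤ (m : ℝ)⁻¹ * (K * dist x y) := by gcongr
      _ = ((m : ℝ)⁻¹ * K) * dist x y := by ring
      _ ≤ 1 / 2 * dist x y := by gcongr
      _ = _ := by simp
  obtain ⟨ψ, hψ, hψu⟩ := exists_contDiff_timeOne_of_lipschitz (f := fun x => (m : ℝ)⁻¹ • f x)
    (contDiff_const.smul hf) (hc.smul_left (f := fun _ => (m : ℝ)⁻¹)) hgL
  refine ⟨ψ^[m], ?_, fun u hu => ?_⟩
  · exact Nat.rec contDiff_id (fun k ih => by rw [Function.iterate_succ]; exact ih.comp hψ) m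
  · have step : ∀ j : ℕ, j ≤ m → u (j / m) = ψ^[j] (u 0) := by
      intro j
      induction j with
      | zero => simp
      | succ j ih =>
        intro hj
        have hj' : (j : ℝ) + 1 ≤ m := by exact_mod_cast hj
        have hmaps : MapsTo (fun τ : ℝ => (j + τ) / m) (Icc 0 1) (Icc 0 1) := by
          intro τ hτ
          refine ⟨div_nonneg (add_nonneg (by positivity) hτ.1) hm0.le, ?_⟩
          rw [div_le_one hm0]
          linarith [hτ.2]
        have := hψu (fun τ => u ((j + τ) / m)) (fun τ hτ => by
          have h3 : HasDerivWithinAt (fun τ : ℝ => (j + τ) / m) ((m : ℝ)⁻¹) (Icc 0 1) τ := by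
            have := (((hasDerivAt_id τ).const_add (j : ℝ)).div_const (m : ℝ)).hasDerivWithinAt
              (s := Icc 0 1)
            simpa using this
          exact HasDerivWithinAt.scomp τ (hu _ (hmaps hτ)) h3 hmaps)
        rw [Function.iterate_succ_apply', ← ih (by omega)]
        simpa using this
    simpa [div_self hm0.ne'] using step m le_rfl

theorem exists_solvesODE [CompleteSpace V] {f : V → V} (hf : ContDiff ℝ ∞ f)
    (hc : HasCompactSupport f) (x : V) : ∃ u, u 0 = x ∧ SolvesODE f u := by
  obtain ⟨K, hK⟩ := hf.lipschitzWith_of_hasCompactSupport hc (by simp)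
  obtain ⟨C, hC⟩ := hf.continuous.bounded_above_of_compact_support hc
  have hC0 : 0 ≤ C := (norm_nonneg _).trans (hC 0)
  -- The bound `C` of `f` serves both as the bound on the velocity and as the radius of the ball:
  -- during a unit of time a solution moves by at most `C`.
  have hPL : IsPicardLindelof (fun _ : ℝ => f) (tmin := 0) (tmax := 1)
      ⟨0, left_mem_Icc.2 zero_le_one⟩ x ⟨C, hC0⟩ 0 ⟨C, hC0⟩ K := by
    refine ⟨fun _ _ => hK.lipschitzOnWith, fun _ _ => continuousOn_const, fun _ _ y _ => hC y, ?_⟩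
    simp
  obtain ⟨u, hu0, hu⟩ := hPL.exists_eq_forall_mem_Icc_hasDerivWithinAt₀
  exact ⟨u, hu0, hu⟩

/-- A smooth vector field on an open set agrees near a compact subset with a compactly supported
smooth vector field. -/
theorem exists_cutoff [FiniteDimensional ℝ V] {Ω K : Set V} (hΩ : IsOpen Ω) (hK : IsCompact K)
    (hKΩ : K ⊆ Ω) {Y : V → V} (hY : ContDiffOn ℝ ∞ Y Ω) :
    ∃ f : V → V, ContDiff ℝ ∞ f ∧ HasCompactSupport f ∧
      ∃ Ω', IsOpen Ω' ∧ K ⊆ Ω' ∧ Ω' ⊆ Ω ∧ EqOn f Y Ω' := by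
  obtain ⟨K', hK', hKK', hK'Ω⟩ := exists_compact_between hK hΩ hKΩ
  obtain ⟨χ, hχ1, hχ0, -⟩ := exists_contMDiffMap_one_nhds_of_subset_interior (n := (⊤ : ℕ∞))
    𝓘(ℝ, V) hK.isClosed hKK'
  have hχ : ContDiff ℝ ∞ χ := χ.contMDiff.contDiff
  obtain ⟨Ω₁, hΩ₁, hKΩ₁, hΩ₁χ⟩ := mem_nhdsSet_iff_exists.1 hχ1
  refine ⟨fun x => χ x • Y x, contDiff_iff_contDiffAt.2 fun x => ?_,
    HasCompactSupport.intro hK' fun x hx => by simp [hχ0 x hx], Ω₁ ∩ Ω, hΩ₁.inter hΩ,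
    subset_inter hKΩ₁ hKΩ, inter_subset_right, fun x hx => ?_⟩
  · by_cases hx : x ∈ Ω
    · exact hχ.contDiffAt.smul (hY.contDiffAt (hΩ.mem_nhds hx))
    · have hx' : K'ᶜ ∈ 𝓝 x := hK'.isClosed.isOpen_compl.mem_nhds fun h => hx (hK'Ω h)
      refine (contDiffAt_const (c := (0 : V))).congr_of_eventuallyEq ?_
      filter_upwards [hx'] with y hy
      simp [hχ0 y hy]
  · have : χ x = 1 := hΩ₁χ hx.1
    simp [this]

theorem SolvesODE.congr {f g : V → V} {u : ℝ → V} (hu : SolvesODE f u)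
    (h : ∀ t ∈ Icc (0 : ℝ) 1, f (u t) = g (u t)) : SolvesODE g u := fun t ht => by
  rw [← h t ht]; exact hu t ht

/-- After a cutoff near the union of the two compact traces, both end points are values of the same
time one map. -/
theorem SolvesODE.unique [FiniteDimensional ℝ V] {Ω : Set V} (hΩ : IsOpen Ω) {Y : V → V}
    (hY : ContDiffOn ℝ ∞ Y Ω) {u₁ u₂ : ℝ → V} (h₁ : SolvesODE Y u₁) (h₂ : SolvesODE Y u₂)
    (hm₁ : MapsTo u₁ (Icc 0 1) Ω) (hm₂ : MapsTo u₂ (Icc 0 1) Ω) (h0 : u₁ 0 = u₂ 0) :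
    u₁ 1 = u₂ 1 := by
  have := FiniteDimensional.complete ℝ V
  obtain ⟨f, hf, hfc, Ω', -, hKΩ', -, hfY⟩ := exists_cutoff hΩ
    ((isCompact_Icc.image_of_continuousOn h₁.continuousOn).union
      (isCompact_Icc.image_of_continuousOn h₂.continuousOn))
    (union_subset hm₁.image_subset hm₂.image_subset) hY
  obtain ⟨ψ, -, hψ⟩ := exists_contDiff_timeOne hf hfc
  rw [hψ u₁ (h₁.congr fun t ht => (hfY (hKΩ' (Or.inl (mem_image_of_mem _ ht)))).symm),
    hψ u₂ (h₂.congr fun t ht => (hfY (hKΩ' (Or.inr (mem_image_of_mem _ ht)))).symm), h0]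

/-- Near the starting point of a solution that exists up to time one, all solutions exist up to
time one, and the time one map is smooth. -/
theorem SolvesODE.exists_local_flow [FiniteDimensional ℝ V] {Ω : Set V} (hΩ : IsOpen Ω) {Y : V → V}
    (hY : ContDiffOn ℝ ∞ Y Ω) {u₀ : ℝ → V} (h₀ : SolvesODE Y u₀)
    (hm₀ : MapsTo u₀ (Icc 0 1) Ω) :
    ∃ O ∈ 𝓝 (u₀ 0), ∃ ψ : V → V, ContDiff ℝ ∞ ψ ∧ ∀ x ∈ O, ∃ u, u 0 = x ∧ SolvesODE Y u ∧
      MapsTo u (Icc 0 1) Ω ∧ u 1 = ψ x := by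
  have := FiniteDimensional.complete ℝ V
  have hK := isCompact_Icc.image_of_continuousOn h₀.continuousOn
  obtain ⟨f, hf, hfc, Ω', hΩ', hKΩ', hΩ'Ω, hfY⟩ := exists_cutoff hΩ hK hm₀.image_subset hY
  obtain ⟨ψ, hψ, hψu⟩ := exists_contDiff_timeOne hf hfc
  obtain ⟨δ, hδ, hδΩ⟩ := hK.exists_thickening_subset_open hΩ' hKΩ'
  obtain ⟨L, hL⟩ := hf.lipschitzWith_of_hasCompactSupport hfc (by simp)
  have h₀f : SolvesODE f u₀ := h₀.congr fun t ht => (hfY (hKΩ' (mem_image_of_mem _ ht))).symm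
  -- By Grönwall's inequality distances grow at most by the factor `exp L` up to time one. A
  -- solution of the cut off equation that starts in this ball therefore stays within `δ` of the
  -- trace of `u₀`, where `f = Y`.
  refine ⟨Metric.ball (u₀ 0) (δ * Real.exp (-L)), Metric.ball_mem_nhds _ (by positivity), ψ, hψ,
    fun x hx => ?_⟩
  obtain ⟨u, hu0, hu⟩ := exists_solvesODE hf hfc x
  have hder : ∀ {w : ℝ → V}, SolvesODE f w → ∀ t ∈ Ico (0 : ℝ) 1,
      HasDerivWithinAt w (f (w t)) (Ici t) t := fun hw t ht =>
    (hw t (Ico_subset_Icc_self ht)).mono_of_mem_nhdsWithin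
      (mem_nhdsWithin.2 ⟨Iio 1, isOpen_Iio, ht.2, fun y hy => ⟨ht.1.trans hy.2, hy.1.le⟩⟩)
  have hnear : ∀ t ∈ Icc (0 : ℝ) 1, u t ∈ Ω' := by
    intro t ht
    have h1 := dist_le_of_trajectories_ODE (v := fun _ => f) (fun _ => hL) hu.continuousOn
      (hder hu) h₀f.continuousOn (hder h₀f) le_rfl t ht
    refine hδΩ (Metric.mem_thickening_iff.2 ⟨u₀ t, mem_image_of_mem _ ht, h1.trans_lt ?_⟩)
    rw [hu0, sub_zero]
    have h2 : Real.exp (L * t) ≤ Real.exp L :=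
      Real.exp_le_exp.2 (mul_le_of_le_one_right L.2 ht.2)
    calc dist x (u₀ 0) * Real.exp (L * t) ≤ dist x (u₀ 0) * Real.exp L := by gcongr
      _ < δ * Real.exp (-L) * Real.exp L := by
        gcongr; exact hx
      _ = δ := by rw [mul_assoc, ← Real.exp_add]; simp
  exact ⟨u, hu0, hu.congr fun t ht => hfY (hnear t ht), fun t ht => hΩ'Ω (hnear t ht),
    by rw [hψu u hu, hu0]⟩

end Flow

/-! ### The envelope theorem at almost every momentum, by Sard's theorem -/

section Sard

open MeasureTheory

variable {F A : Type*} [NormedAddCommGroup F] [NormedSpace ℝ F] [FiniteDimensional ℝ F]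
  [NormedAddCommGroup A] [NormedSpace ℝ A] [FiniteDimensional ℝ A]

theorem contDiff_clm_flip {A F G : Type*} [NormedAddCommGroup A] [NormedSpace ℝ A]
    [NormedAddCommGroup F] [NormedSpace ℝ F] [NormedAddCommGroup G] [NormedSpace ℝ G] :
    ContDiff ℝ ∞ (fun B : A →L[ℝ] F →L[ℝ] G => B.flip) :=
  ContinuousLinearMap.contDiff (𝕜 := ℝ) (E := A →L[ℝ] F →L[ℝ] G) (F := F →L[ℝ] A →L[ℝ] G)
    (ContinuousLinearMap.flipₗᵢ ℝ A F G).toContinuousLinearEquiv.toContinuousLinearMap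

/-- `p` is a Legendre transform of `ℓ` at `a`, i.e. `a` is a critical point of
`⟨z, p⟩ - ℓ`. -/
def IsLegendrePoint (z : A → F →L[ℝ] ℝ) (ℓ : A → ℝ) (a : A) (p : F) : Prop :=
  (fderiv ℝ z a).flip p = fderiv ℝ ℓ a

/-- A set-theoretic lift of the envelope theorem: `z a` is the differential at `p` of any function
that is given by `⟨z, p⟩ - ℓ` at the critical points near `(a, p)`. -/
def HasEnvelope (z : A → F →L[ℝ] ℝ) (ℓ : A → ℝ) (a : A) (p : F) : Prop :=
  ∀ h : F → ℝ, DifferentiableAt ℝ h p →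
    (∀ᶠ x : A × F in 𝓝 (a, p), IsLegendrePoint z ℓ x.1 x.2 → h x.2 = z x.1 x.2 - ℓ x.1) →
    fderiv ℝ h p = z a

/-- Injectivity of `fderiv ℝ z a₀` makes the transpose `Q a` surjective near `a₀`, so the equation
`Q a p = fderiv ℝ ℓ a` can be solved for `p` once `a` and the component of `p` in the kernel of `Q
a₀` are given. These data together have as many dimensions as `F`, so that the Legendre pairs near
`a₀` are parametrized by a smooth `Ψ` from an open part of `F` to `F`, and `S` is the null set of
its critical values. For `p ∉ S` the equation `h (Ψ P) = z (α P) (Ψ P) - ℓ (α P)` can be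
differentiated in all directions of `F`. -/
theorem exists_null_hasEnvelope_local [MeasurableSpace F] [BorelSpace F] (μ : Measure F)
    [μ.IsAddHaarMeasure] {O : Set A} (hO : IsOpen O) {z : A → F →L[ℝ] ℝ} (hz : ContDiffOn ℝ ∞ z O)
    {ℓ : A → ℝ} (hℓ : ContDiffOn ℝ ∞ ℓ O) {a₀ : A} (ha₀ : a₀ ∈ O)
    (hinj : Function.Injective (fderiv ℝ z a₀)) :
    ∃ O' ∈ 𝓝 a₀, ∃ S : Set F, μ S = 0 ∧ ∀ a ∈ O', ∀ p ∉ S, IsLegendrePoint z ℓ a p →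
      HasEnvelope z ℓ a p := by
  let Q : A → F →L[ℝ] A →L[ℝ] ℝ := fun a => (fderiv ℝ z a).flip
  have hQ : ContDiffOn ℝ ∞ Q O :=
    contDiff_clm_flip.comp_contDiffOn (hz.fderiv_of_isOpen (m := ∞) hO (by simp))
  have hdℓ : ContDiffOn ℝ ∞ (fderiv ℝ ℓ) O := hℓ.fderiv_of_isOpen (m := ∞) hO (by simp)
  -- a right inverse of `Q a₀`
  obtain ⟨J, hJ⟩ : ∃ J : (A →L[ℝ] ℝ) →L[ℝ] F, (Q a₀).comp J = ContinuousLinearMap.id ℝ _ := by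
    -- A functional that vanishes on the range of `Q a₀` is the evaluation at some `b`, and `fderiv
    -- ℝ z a₀ b = 0`, so `b = 0`.
    have hsurj : LinearMap.range (Q a₀ : F →ₗ[ℝ] A →L[ℝ] ℝ) = ⊤ := by
      by_contra hne
      obtain ⟨f, hf0, hf⟩ := Submodule.exists_le_ker_of_lt_top _ (lt_top_iff_ne_top.2 hne)
      let g : Module.Dual ℝ (Module.Dual ℝ A) :=
        f ∘ₗ (LinearMap.toContinuousLinearMap (𝕜 := ℝ) (E := A) (F' := ℝ)).toLinearMap
      let b : A := (Module.evalEquiv ℝ A).symm g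
      have hb : ∀ y : A →L[ℝ] ℝ, f y = y b := fun y =>
        (Module.apply_evalEquiv_symm_apply ℝ A (y : A →ₗ[ℝ] ℝ) g).symm
      have hb0 : b = 0 := by
        refine hinj (ContinuousLinearMap.ext fun p => ?_)
        rw [map_zero]
        exact (hb (Q a₀ p)).symm.trans (LinearMap.mem_ker.1 (hf ⟨p, rfl⟩))
      exact hf0 (LinearMap.ext fun y => by rw [hb, hb0, map_zero]; rfl)
    obtain ⟨J, hJ⟩ := (Q a₀ : F →ₗ[ℝ] A →L[ℝ] ℝ).exists_rightInverse_of_surjective hsurj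
    refine ⟨LinearMap.toContinuousLinearMap J, ?_⟩
    ext1 y
    exact LinearMap.congr_fun hJ y
  -- Any isomorphism of `A` with its dual will do. It lets a single vector `P` of `F` encode both a
  -- point of `A`, namely `κ (Q a₀ P)`, and an element of the kernel of `Q a₀`.
  let κ : (A →L[ℝ] ℝ) ≃L[ℝ] A := ContinuousLinearEquiv.ofFinrankEq (by
    rw [← (LinearMap.toContinuousLinearMap (𝕜 := ℝ) (E := A) (F' := ℝ)).finrank_eq]
    exact Subspace.dual_finrank_eq)
  let T : A → (A →L[ℝ] ℝ) →L[ℝ] (A →L[ℝ] ℝ) := fun a => (Q a).comp J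
  have hT : ContDiffOn ℝ ∞ T O := hQ.clm_comp contDiffOn_const
  let O₁ : Set A := O ∩ {a | IsUnit (T a)}
  have hunit : IsOpen {B : (A →L[ℝ] ℝ) →L[ℝ] (A →L[ℝ] ℝ) | IsUnit B} :=
    Units.isOpen (R := (A →L[ℝ] ℝ) →L[ℝ] (A →L[ℝ] ℝ))
  have hO₁ : IsOpen O₁ := hT.continuousOn.isOpen_inter_preimage hO hunit
  have ha₀₁ : a₀ ∈ O₁ := ⟨ha₀, by
    change IsUnit ((Q a₀).comp J)
    rw [hJ]; exact isUnit_one⟩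
  let R : A → (A →L[ℝ] ℝ) →L[ℝ] (A →L[ℝ] ℝ) := fun a => Ring.inverse (T a)
  have hR : ContDiffOn ℝ ∞ R O₁ := fun a ha => by
    obtain ⟨U, hU⟩ := ha.2
    have h1 : ContDiffAt ℝ ∞ Ring.inverse (T a) := by
      rw [← hU]; exact contDiffAt_ringInverse ℝ (R := (A →L[ℝ] ℝ) →L[ℝ] (A →L[ℝ] ℝ)) U
    exact h1.comp_contDiffWithinAt a ((hT a ha.1).mono inter_subset_left)
  have hRT : ∀ a ∈ O₁, ∀ y, R a (T a y) = y := fun a ha y => by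
    have := Ring.inverse_mul_cancel _ ha.2
    exact congrArg (fun B : (A →L[ℝ] ℝ) →L[ℝ] (A →L[ℝ] ℝ) => B y) this
  have hTR : ∀ a ∈ O₁, ∀ y, T a (R a y) = y := fun a ha y => by
    have := Ring.mul_inverse_cancel _ ha.2
    exact congrArg (fun B : (A →L[ℝ] ℝ) →L[ℝ] (A →L[ℝ] ℝ) => B y) this
  let α : F →L[ℝ] A := (κ : (A →L[ℝ] ℝ) →L[ℝ] A).comp (Q a₀)
  let β : F →L[ℝ] F := ContinuousLinearMap.id ℝ F - J.comp (Q a₀)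
  -- The Legendre equation at `α P` is solved by `J y + β P` with `T (α P) y = fderiv ℝ ℓ (α P) - Q
  -- (α P) (β P)`. Here `R` inverts `T`.
  let Ψ : F → F := fun P => J (R (α P) (fderiv ℝ ℓ (α P) - Q (α P) (β P))) + β P
  let B : Set F := α ⁻¹' O₁
  have hB : IsOpen B := hO₁.preimage α.continuous
  have hαB : MapsTo α B O₁ := fun _ h => h
  have hΨ : ContDiffOn ℝ ∞ Ψ B := by
    have hα := α.contDiff.contDiffOn (s := B) (n := ∞)
    have hβ := β.contDiff.contDiffOn (s := B) (n := ∞)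
    refine (J.contDiff.comp_contDiffOn (((hR.comp hα hαB).clm_apply
      (((hdℓ.mono inter_subset_left).comp hα hαB).sub
        (((hQ.mono inter_subset_left).comp hα hαB).clm_apply hβ))))).add hβ
  have hΨd : ∀ P ∈ B, HasFDerivAt Ψ (fderiv ℝ Ψ P) P := fun P hP =>
    ((hΨ.contDiffAt (hB.mem_nhds hP)).differentiableAt (by simp)).hasFDerivAt
  have hcrit : ∀ P ∈ B, IsLegendrePoint z ℓ (α P) (Ψ P) := fun P hP => by
    change Q (α P) (J _ + β P) = _
    rw [map_add]
    change T (α P) (R (α P) _) + _ = _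
    rw [hTR _ hP]; abel
  let S : Set F := Ψ '' (B ∩ {P | (fderiv ℝ Ψ P).det = 0})
  refine ⟨O₁, hO₁.mem_nhds ha₀₁, S, addHaar_image_eq_zero_of_det_fderivWithin_eq_zero μ
    (fun P hP => (hΨd P hP.1).hasFDerivWithinAt) (fun P hP => hP.2), fun a ha p hp hap h hh hev => ?_⟩
  -- the parameter of `p`
  let P : F := J (κ.symm a) + β p
  have hβJ : ∀ y, β (J y) = 0 := fun y => by
    have : Q a₀ (J y) = y := congrArg (fun B : (A →L[ℝ] ℝ) →L[ℝ] (A →L[ℝ] ℝ) => B y) hJ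
    simp [β, this]
  have hQβ : ∀ y, Q a₀ (β y) = 0 := fun y => by
    have : Q a₀ (J (Q a₀ y)) = Q a₀ y :=
      congrArg (fun B : (A →L[ℝ] ℝ) →L[ℝ] (A →L[ℝ] ℝ) => B (Q a₀ y)) hJ
    simp [β, this]
  have hQP : Q a₀ P = κ.symm a := by
    simp only [P, map_add, hQβ, add_zero]
    exact congrArg (fun B : (A →L[ℝ] ℝ) →L[ℝ] (A →L[ℝ] ℝ) => B (κ.symm a)) hJ
  have hαP : α P = a := by simp [α, hQP]
  have hβP : β P = β p := by
    have h1 : β P = P - J (Q a₀ P) := rfl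
    rw [h1, hQP]; simp [P]
  have hPB : P ∈ B := by change α P ∈ O₁; rwa [hαP]
  have hΨP : Ψ P = p := by
    have h2 : R a (fderiv ℝ ℓ a - Q a (β p)) = Q a₀ p := by
      rw [← hRT a ha (Q a₀ p)]
      congr 1
      have h3 : Q a p = fderiv ℝ ℓ a := hap
      have h4 : T a (Q a₀ p) = Q a (J (Q a₀ p)) := rfl
      rw [← h3, h4, ← map_sub]
      congr 1
      simp [β]
    change J (R (α P) (fderiv ℝ ℓ (α P) - Q (α P) (β P))) + β P = p
    rw [hαP, hβP, h2]
    simp [β]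
  have hdet : (fderiv ℝ Ψ P).det ≠ 0 := fun h0 => hp ⟨P, ⟨hPB, h0⟩, hΨP⟩
  have hsurj : Function.Surjective (fderiv ℝ Ψ P) := by
    have := (LinearMap.equivOfDetNeZero (fderiv ℝ Ψ P : F →ₗ[ℝ] F) hdet).surjective
    exact this
  have hzd : HasFDerivAt z (fderiv ℝ z a) (α P) := by
    rw [hαP]
    exact ((hz.contDiffAt (hO.mem_nhds ha.1)).differentiableAt (by simp)).hasFDerivAt
  have hℓd : HasFDerivAt ℓ (fderiv ℝ ℓ a) (α P) := by
    rw [hαP]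
    exact ((hℓ.contDiffAt (hO.mem_nhds ha.1)).differentiableAt (by simp)).hasFDerivAt
  have hhd : HasFDerivAt h (fderiv ℝ h p) (Ψ P) := by rw [hΨP]; exact hh.hasFDerivAt
  have hcomp : (fun P' => h (Ψ P')) =ᶠ[𝓝 P] fun P' => z (α P') (Ψ P') - ℓ (α P') := by
    have hcont : ContinuousAt (fun P' => (α P', Ψ P')) P :=
      α.continuous.continuousAt.prodMk (hΨd P hPB).continuousAt
    have h5 : Filter.Tendsto (fun P' => (α P', Ψ P')) (𝓝 P) (𝓝 (a, p)) := by
      have := hcont.tendsto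
      rwa [hαP, hΨP] at this
    filter_upwards [h5.eventually hev, hB.mem_nhds hPB] with P' h6 h7
    exact h6 (hcrit P' h7)
  have hd1 := (hhd.comp P (hΨd P hPB)).congr_of_eventuallyEq hcomp.symm
  have hd2 := ((hzd.comp P α.hasFDerivAt).clm_apply (hΨd P hPB)).sub (hℓd.comp P α.hasFDerivAt)
  have heq := hd1.unique hd2
  ext v
  obtain ⟨w, rfl⟩ := hsurj v
  have h8 := congrArg (fun B : F →L[ℝ] ℝ => B w) heq
  -- The envelope cancellation: by the Legendre equation the two terms that contain the derivative
  -- of `α` are equal, and what remains is `fderiv ℝ h p = z a` on the range of the derivative of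
  -- `Ψ`, which is everything.
  have h9 : fderiv ℝ z a (α w) p = fderiv ℝ ℓ a (α w) :=
    congrArg (fun B : A →L[ℝ] ℝ => B (α w)) hap
  simp [hαP, hΨP, h9] at h8
  exact h8

theorem exists_null_hasEnvelope [MeasurableSpace F] [BorelSpace F] (μ : Measure F)
    [μ.IsAddHaarMeasure] {O : Set A} (hO : IsOpen O) {z : A → F →L[ℝ] ℝ} (hz : ContDiffOn ℝ ∞ z O)
    {ℓ : A → ℝ} (hℓ : ContDiffOn ℝ ∞ ℓ O)
    (hinj : ∀ a ∈ O, Function.Injective (fderiv ℝ z a)) :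
    ∃ S : Set F, μ S = 0 ∧ ∀ a ∈ O, ∀ p ∉ S, IsLegendrePoint z ℓ a p → HasEnvelope z ℓ a p := by
  choose! U hU S hS h using fun (a : A) (ha : a ∈ O) =>
    exists_null_hasEnvelope_local μ hO hz hℓ ha (hinj a ha)
  obtain ⟨t, htO, htc, hcov⟩ := TopologicalSpace.countable_cover_nhdsWithin
    (fun a ha => mem_nhdsWithin_of_mem_nhds (hU a ha))
  refine ⟨⋃ a ∈ t, S a, (measure_biUnion_null_iff htc).2 fun a ha => hS a (htO ha),
    fun a ha p hp hap => ?_⟩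
  obtain ⟨b, hb, hab⟩ := mem_iUnion₂.1 (hcov ha)
  exact h b (htO hb) a hab p (fun hpS => hp (mem_iUnion₂.2 ⟨b, hb, hpS⟩)) hap

omit [FiniteDimensional ℝ F] [FiniteDimensional ℝ A] in
-- The first derivatives of `z` and `ℓ` are continuous, so the Legendre relation is closed. It
-- extends criticality from the dense set of regular values to all momenta.
theorem IsLegendrePoint.of_tendsto {O : Set A} (hO : IsOpen O) {z : A → F →L[ℝ] ℝ}
    (hz : ContDiffOn ℝ ∞ z O) {ℓ : A → ℝ} (hℓ : ContDiffOn ℝ ∞ ℓ O) {ι : Type*} {l : Filter ι}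
    [l.NeBot] {a : ι → A} {p : ι → F} {a₀ : A} {p₀ : F} (ha : Filter.Tendsto a l (𝓝 a₀))
    (ha₀ : a₀ ∈ O) (hp : Filter.Tendsto p l (𝓝 p₀)) (h : ∀ᶠ i in l, IsLegendrePoint z ℓ (a i) (p i)) :
    IsLegendrePoint z ℓ a₀ p₀ := by
  have h1 : ContinuousAt (fderiv ℝ z) a₀ :=
    (hz.fderiv_of_isOpen (m := ∞) hO (by simp)).continuousOn.continuousAt (hO.mem_nhds ha₀)
  have h2 : ContinuousAt (fderiv ℝ ℓ) a₀ :=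
    (hℓ.fderiv_of_isOpen (m := ∞) hO (by simp)).continuousOn.continuousAt (hO.mem_nhds ha₀)
  refine ContinuousLinearMap.ext fun b => ?_
  have h3 : ContinuousAt (fun x : A × F => fderiv ℝ z x.1 b x.2) (a₀, p₀) :=
    ((ContinuousAt.comp (g := fderiv ℝ z) (f := Prod.fst) h1 continuousAt_fst).clm_apply
      continuousAt_const).clm_apply continuousAt_snd
  have h4 : Filter.Tendsto (fun i => fderiv ℝ ℓ (a i) b) l (𝓝 (fderiv ℝ ℓ a₀ b)) :=
    (h2.clm_apply continuousAt_const).tendsto.comp ha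
  refine tendsto_nhds_unique_of_eventuallyEq (h3.tendsto.comp (ha.prodMk_nhds hp)) h4 ?_
  filter_upwards [h] with i hi
  exact congrArg (fun B : A →L[ℝ] ℝ => B b) hi

end Sard

/-! ### Decomposable multivectors and graph charts of the Grassmannian -/

section Fibre

variable {n : ℕ} {E : Type*} [NormedAddCommGroup E] [NormedSpace ℝ E]

/-- The decomposable multivector `v₁ ∧ ⋯ ∧ vₙ` of a normed space, as a functional on forms. -/
noncomputable def altEval (v : Fin n → E) : (E [⋀^Fin n]→L[ℝ] ℝ) →L[ℝ] ℝ :=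
  ContinuousAlternatingMap.apply ℝ E ℝ v

@[simp] theorem altEval_apply (v : Fin n → E) (p : E [⋀^Fin n]→L[ℝ] ℝ) : altEval v p = p v := rfl

/-- Multiplying one of the vectors shows that decomposable multivectors form a cone; this is where
`n ≥ 1` is needed. -/
theorem smul_altEval (hn : 1 ≤ n) (t : ℝ) (v : Fin n → E) : ∃ w, altEval w = t • altEval v := by
  refine ⟨Function.update v ⟨0, hn⟩ (t • v ⟨0, hn⟩), ?_⟩
  ext p
  simp only [altEval_apply, smul_apply]
  rw [p.map_update_smul, Function.update_eq_self]

/-- The pullback of `p` to `ℝⁿ` along the combination map of `v` is a form of top degree, hence a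
multiple of the determinant. -/
theorem altEval_linearCombination (M : Matrix (Fin n) (Fin n) ℝ) (v : Fin n → E) :
    altEval (fun l => ∑ m, M l m • v m) = M.det • altEval v := by
  ext p
  let g : (Fin n → ℝ) →ₗ[ℝ] E := Fintype.linearCombination ℝ v
  have h := (p.toAlternatingMap.compLinearMap g).eq_smul_basis_det (Pi.basisFun ℝ (Fin n))
  have h1 := congrArg (fun f : (Fin n → ℝ) [⋀^Fin n]→ₗ[ℝ] ℝ => f M) h
  have h2 : (fun i => g (Pi.basisFun ℝ (Fin n) i)) = v := by
    funext i
    simp [g, Fintype.linearCombination_apply, Pi.single_apply]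
  rw [Pi.basisFun_det] at h1
  change p (fun i => g (M i)) = p (fun i => g (Pi.basisFun ℝ (Fin n) i)) * M.det at h1
  rw [h2] at h1
  change p (fun i => g (M i)) = M.det * p v
  rw [h1, mul_comm]

/-- `f₁ ∧ ⋯ ∧ fₙ`. -/
noncomputable def detForm (f : Fin n → E →L[ℝ] ℝ) : E [⋀^Fin n]→L[ℝ] ℝ :=
  { Matrix.detRowAlternating.compLinearMap (LinearMap.pi fun i => (f i : E →ₗ[ℝ] ℝ)) with
    cont := by
      change Continuous fun u : Fin n → E => Matrix.det (Matrix.of fun j i => f i (u j))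
      refine Continuous.matrix_det ?_
      exact continuous_pi fun j => continuous_pi fun i => (f i).continuous.comp (continuous_apply j)}

theorem detForm_apply (f : Fin n → E →L[ℝ] ℝ) (u : Fin n → E) :
    detForm f u = Matrix.det (Matrix.of fun j i => f i (u j)) := rfl

variable [FiniteDimensional ℝ E]

instance finiteDimensional_continuousAlternatingMap :
    FiniteDimensional ℝ (E [⋀^Fin n]→L[ℝ] ℝ) := by
  let b := Module.finBasis ℝ E
  let T : (E [⋀^Fin n]→L[ℝ] ℝ) →ₗ[ℝ] ((Fin n → Fin (Module.finrank ℝ E)) → ℝ) :=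
    { toFun := fun p I => p fun i => b (I i)
      map_add' := fun _ _ => rfl
      map_smul' := fun _ _ => rfl }
  refine FiniteDimensional.of_injective T fun p q hpq => ?_
  refine ContinuousAlternatingMap.toAlternatingMap_injective
    (Module.Basis.ext_alternating b fun I _ => ?_)
  exact congrFun hpq I

/-- Coordinates, as continuous functionals. -/
noncomputable def coordL {ι : Type*} (b : Module.Basis ι ℝ E) (i : ι) : E →L[ℝ] ℝ :=
  LinearMap.toContinuousLinearMap (b.coord i)

theorem coordL_apply {ι : Type*} (b : Module.Basis ι ℝ E) (i : ι) (x : E) :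
    coordL b i x = b.repr x i := rfl

/-- The forms `detForm` of coordinate functionals span: `n! • p` is the sum over all index maps `I`
of `p (b ∘ I)` times the corresponding form. Summing over all maps, not only increasing ones, avoids
a choice of order on the basis at the price of the factor `n!`. -/
theorem eq_zero_of_forall_detForm {ι : Type*} [Fintype ι] (b : Module.Basis ι ℝ E)
    (z : (E [⋀^Fin n]→L[ℝ] ℝ) →L[ℝ] ℝ)
    (hz : ∀ I : Fin n → ι, z (detForm fun i => coordL b (I i)) = 0) : z = 0 := by
  classical
  ext p
  have key : (n.factorial : ℝ) • p =
      ∑ I : Fin n → ι, (p fun i => b (I i)) • detForm fun i => coordL b (I i) := by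
    ext u
    have hsum : ∀ σ : Equiv.Perm (Fin n), (p fun i => u (σ i)) =
        ∑ I : Fin n → ι, (∏ i, b.repr (u (σ i)) (I i)) * p fun i => b (I i) := by
      intro σ
      have h1 : (fun i => u (σ i)) = fun i => ∑ j, b.repr (u (σ i)) j • b j := by
        funext i; rw [b.sum_repr]
      have h2 := p.toMultilinearMap.map_sum (fun i j => b.repr (u (σ i)) j • b j)
      change p (fun i => ∑ j, b.repr (u (σ i)) j • b j) = _ at h2
      rw [h1, h2]
      refine Finset.sum_congr rfl fun I _ => ?_
      exact p.toMultilinearMap.map_smul_univ (fun i => b.repr (u (σ i)) (I i)) fun i => b (I i)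
    have hperm : ∀ σ : Equiv.Perm (Fin n),
        ((Equiv.Perm.sign σ : ℤ) : ℝ) * (p fun i => u (σ i)) = p u := by
      intro σ
      have h3 := p.toAlternatingMap.map_perm u σ
      change p (u ∘ σ) = Equiv.Perm.sign σ • p u at h3
      change _ * p (u ∘ σ) = _
      rw [h3]
      rcases Int.units_eq_one_or (Equiv.Perm.sign σ) with h | h <;> simp [h]
    have hL : ((n.factorial : ℝ) • p) u = ∑ σ : Equiv.Perm (Fin n), p u := by
      simp [Fintype.card_perm]
    rw [hL, Finset.sum_congr rfl fun σ _ => (hperm σ).symm]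
    simp only [hsum, Finset.mul_sum]
    rw [Finset.sum_comm]
    have hR : (∑ I : Fin n → ι, (p fun i => b (I i)) • detForm fun i => coordL b (I i)) u =
        ∑ I : Fin n → ι, (p fun i => b (I i)) * detForm (fun i => coordL b (I i)) u := by
      rw [ContinuousAlternatingMap.sum_apply]; rfl
    rw [hR]
    refine Finset.sum_congr rfl fun I _ => ?_
    rw [detForm_apply, Matrix.det_apply', Finset.mul_sum]
    refine Finset.sum_congr rfl fun σ _ => ?_
    simp only [Matrix.of_apply, coordL_apply]
    ring
  have h4 : (n.factorial : ℝ) * z p = 0 := by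
    rw [← smul_eq_mul, ← map_smul, key, map_sum]
    exact Finset.sum_eq_zero fun I _ => by rw [map_smul, hz, smul_zero]
  have h5 : (n.factorial : ℝ) ≠ 0 := by positivity
  simpa [h5] using h4

section Chart

variable {κ : Type*} [Fintype κ] (b : Module.Basis (Fin n ⊕ κ) ℝ E)

/-- The `n`-tuples of vectors that span the graphs of the linear maps from the span of the first
`n` basis vectors to the span of the others. -/
noncomputable def graphFrame (a : Fin n → κ → ℝ) (i : Fin n) : E :=
  b (Sum.inl i) + ∑ j, a i j • b (Sum.inr j)

omit [FiniteDimensional ℝ E] in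
theorem repr_graphFrame_inl (a : Fin n → κ → ℝ) (i l : Fin n) :
    b.repr (graphFrame b a l) (Sum.inl i) = if l = i then 1 else 0 := by
  classical
  simp [graphFrame, Finsupp.single_apply]

omit [FiniteDimensional ℝ E] in
theorem repr_graphFrame_inr (a : Fin n → κ → ℝ) (l : Fin n) (j : κ) :
    b.repr (graphFrame b a l) (Sum.inr j) = a l j := by
  classical
  simp [graphFrame, Finsupp.single_apply]

theorem eq_graphFrame {v : Fin n → E}
    (hv : ∀ i l, b.repr (v l) (Sum.inl i) = if l = i then 1 else 0) :
    v = graphFrame b fun l j => b.repr (v l) (Sum.inr j) := by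
  funext l
  refine b.repr.injective (Finsupp.ext fun x => ?_)
  cases x with
  | inl i => rw [hv, repr_graphFrame_inl]
  | inr j => rw [repr_graphFrame_inr]

/-- The form that is equal to `1` on the tuples `graphFrame b a`. -/
noncomputable def baseForm : E [⋀^Fin n]→L[ℝ] ℝ := detForm fun i => coordL b (Sum.inl i)

/-- The form that is equal to `a i j` on the tuple `graphFrame b a`. -/
noncomputable def slopeForm (i : Fin n) (j : κ) : E [⋀^Fin n]→L[ℝ] ℝ :=
  detForm (Function.update (fun i => coordL b (Sum.inl i)) i (coordL b (Sum.inr j)))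

theorem baseForm_graphFrame (a : Fin n → κ → ℝ) : baseForm b (graphFrame b a) = 1 := by
  rw [baseForm, detForm_apply]
  have : (Matrix.of fun j i => coordL b (Sum.inl i) (graphFrame b a j)) =
      (1 : Matrix (Fin n) (Fin n) ℝ) := by
    ext l i
    simp only [Matrix.of_apply, coordL_apply, repr_graphFrame_inl, Matrix.one_apply]
  rw [this, Matrix.det_one]

theorem slopeForm_graphFrame (a : Fin n → κ → ℝ) (i : Fin n) (j : κ) :
    slopeForm b i j (graphFrame b a) = a i j := by
  rw [slopeForm, detForm_apply]
  have : (Matrix.of fun l i' => (Function.update (fun i => coordL b (Sum.inl i)) i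
      (coordL b (Sum.inr j)) i') (graphFrame b a l)) =
      (1 : Matrix (Fin n) (Fin n) ℝ).updateCol i (fun l => a l j) := by
    ext l i'
    by_cases h : i' = i
    · subst h
      simp [coordL_apply, repr_graphFrame_inr]
    · simp [h, coordL_apply, repr_graphFrame_inl, Matrix.one_apply]
  rw [this, ← Matrix.cramer_apply, Matrix.cramer_one]
  rfl

/-- The coordinates of a decomposable multivector in the chart of its Grassmannian. -/
noncomputable def slope (z : (E [⋀^Fin n]→L[ℝ] ℝ) →L[ℝ] ℝ) : Fin n → κ → ℝ :=
  fun i j => z (slopeForm b i j) / z (baseForm b)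

theorem slope_smul_graphFrame {t : ℝ} (ht : t ≠ 0) (a : Fin n → κ → ℝ) :
    slope b (t • altEval (graphFrame b a)) = a := by
  funext i j
  simp [slope, baseForm_graphFrame, slopeForm_graphFrame, ht]

/-- If `M` is the matrix of coordinates of `v` along the first `n` basis vectors, then `baseForm b v
= det M`. When this is not zero, `M⁻¹` turns `v` into the graph frame of the same plane, and the
multivector changes by the determinant. -/
theorem altEval_eq_smul_graphFrame {v : Fin n → E} (hv : altEval v (baseForm b) ≠ 0) :
    altEval v = altEval v (baseForm b) • altEval (graphFrame b (slope b (altEval v))) := by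
  let M : Matrix (Fin n) (Fin n) ℝ := Matrix.of fun l i => b.repr (v l) (Sum.inl i)
  have hM : altEval v (baseForm b) = M.det := rfl
  have hMu : IsUnit M.det := isUnit_iff_ne_zero.2 (hM ▸ hv)
  let w : Fin n → E := fun l => ∑ m, M⁻¹ l m • v m
  have hvw : (fun l => ∑ m, M l m • w m) = v := by
    funext l
    simp only [w, Finset.smul_sum, smul_smul]
    rw [Finset.sum_comm]
    have h1 : ∀ m, ∑ x, (M l x * M⁻¹ x m) • v m = (1 : Matrix (Fin n) (Fin n) ℝ) l m • v m := by
      intro m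
      rw [← Finset.sum_smul, ← Matrix.mul_apply, Matrix.mul_nonsing_inv _ hMu]
    simp [h1, Matrix.one_apply]
  have hw := eq_graphFrame b (v := w) (fun i l => by
    have h2 : b.repr (w l) (Sum.inl i) = (M⁻¹ * M) l i := by
      simp [w, Matrix.mul_apply, M]
    rw [h2, Matrix.nonsing_inv_mul _ hMu, Matrix.one_apply])
  have h3 : altEval v = M.det • altEval w := by
    conv_lhs => rw [← hvw]
    exact altEval_linearCombination M w
  rw [hM]
  have h4 : slope b (altEval v) = fun l j => b.repr (w l) (Sum.inr j) := by
    rw [h3, hw, slope_smul_graphFrame b hMu.ne_zero, ← hw]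
  rw [h4, ← hw, h3]

end Chart

end Fibre

/-! ### Bounded reparametrization, by which germs of curves become curves defined for all times -/

section Reparam

/-- A bounded reparametrization of the line that is tangent to the identity at `0`. -/
theorem exists_bounded_reparam {δ : ℝ} (hδ : 0 < δ) :
    ∃ τ : ℝ → ℝ, ContDiff ℝ ∞ τ ∧ τ 0 = 0 ∧ HasDerivAt τ 1 0 ∧ ∀ t, |τ t| < δ := by
  refine ⟨fun t => δ / 2 * Real.sin (t / (δ / 2)), ?_, by simp, ?_, fun t => ?_⟩
  · exact contDiff_const.mul (Real.contDiff_sin.comp (contDiff_id.div_const _))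
  · have h1 : HasDerivAt (fun t : ℝ => t / (δ / 2)) (1 / (δ / 2)) 0 :=
      (hasDerivAt_id (0 : ℝ)).div_const _
    have h2 := ((Real.hasDerivAt_sin ((0 : ℝ) / (δ / 2))).comp 0 h1).const_mul (δ / 2)
    simp only [zero_div, Real.cos_zero, one_mul] at h2
    rwa [mul_one_div_cancel (by positivity)] at h2
  · rw [abs_mul, abs_of_pos (by positivity)]
    calc δ / 2 * |Real.sin (t / (δ / 2))| ≤ δ / 2 * 1 := by
          gcongr; exact Real.abs_sin_le_one _
      _ < δ := by linarith

end Reparam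

/-! ### The Legendre correspondence in a single fibre -/

section Fibre

variable {n : ℕ} {E : Type*} [NormedAddCommGroup E] [NormedSpace ℝ E]

/-- The decomposable multivectors on which the form `ν` is `1`. -/
def unitSet (ν : E [⋀^Fin n]→L[ℝ] ℝ) : Set ((E [⋀^Fin n]→L[ℝ] ℝ) →L[ℝ] ℝ) :=
  {z | z ∈ range altEval ∧ z ν = 1}

/-- The critical points of `⟨·, p⟩ - ℓ` on `unitSet ν`. -/
def criticalSet (ν : E [⋀^Fin n]→L[ℝ] ℝ) (ℓ : ((E [⋀^Fin n]→L[ℝ] ℝ) →L[ℝ] ℝ) → ℝ)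
    (p : E [⋀^Fin n]→L[ℝ] ℝ) : Set ((E [⋀^Fin n]→L[ℝ] ℝ) →L[ℝ] ℝ) :=
  {z | z ∈ unitSet ν ∧ ∀ c : ℝ → (E [⋀^Fin n]→L[ℝ] ℝ) →L[ℝ] ℝ,
    (∀ η, ContDiff ℝ ∞ fun t => c t η) → (∀ t, c t ∈ unitSet ν) → c 0 = z →
      HasDerivAt (fun t => c t p - ℓ (c t)) 0 0}

/-- `ℓ` is smooth along smooth families in `unitSet ν`. -/
def IsSmoothOnUnitSet (ν : E [⋀^Fin n]→L[ℝ] ℝ)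
    (ℓ : ((E [⋀^Fin n]→L[ℝ] ℝ) →L[ℝ] ℝ) → ℝ) : Prop :=
  ∀ (A : Type) [NormedAddCommGroup A] [NormedSpace ℝ A]
    (z : A → (E [⋀^Fin n]→L[ℝ] ℝ) →L[ℝ] ℝ) (a : A), ContDiffAt ℝ ∞ z a →
    (∀ᶠ a' in 𝓝 a, z a' ∈ unitSet ν) → ContDiffAt ℝ ∞ (fun a' => ℓ (z a')) a

variable [FiniteDimensional ℝ E]

theorem contDiff_altEval : ContDiff ℝ ∞ (altEval : (Fin n → E) → _) :=
  contDiff_clm_apply_iff.2 fun p => p.toContinuousMultilinearMap.contDiff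

section Chart

variable {κ : Type} [Fintype κ] (b : Module.Basis (Fin n ⊕ κ) ℝ E) (ν : E [⋀^Fin n]→L[ℝ] ℝ)

omit [FiniteDimensional ℝ E] in
theorem contDiff_graphFrame : ContDiff ℝ ∞ (graphFrame b) := by
  refine contDiff_pi.2 fun i => contDiff_const.add (ContDiff.sum fun j _ => ?_)
  exact ((contDiff_apply ℝ ℝ j).comp (contDiff_apply ℝ (κ → ℝ) i)).smul contDiff_const

/-- The parametrization of an open part of `unitSet ν` by slopes. -/
noncomputable def unitChart (a : Fin n → κ → ℝ) : (E [⋀^Fin n]→L[ℝ] ℝ) →L[ℝ] ℝ :=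
  (ν (graphFrame b a))⁻¹ • altEval (graphFrame b a)

/-- The domain of `unitChart`. -/
def unitChartDomain : Set (Fin n → κ → ℝ) := {a | ν (graphFrame b a) ≠ 0}

theorem contDiff_volume_graphFrame : ContDiff ℝ ∞ fun a => ν (graphFrame b a) :=
  ν.toContinuousMultilinearMap.contDiff.comp (contDiff_graphFrame b)

theorem isOpen_unitChartDomain : IsOpen (unitChartDomain b ν) :=
  isOpen_ne_fun (contDiff_volume_graphFrame b ν).continuous continuous_const

theorem contDiffOn_unitChart : ContDiffOn ℝ ∞ (unitChart b ν) (unitChartDomain b ν) :=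
  contDiffOn_clm_apply.2 fun p => ((contDiff_volume_graphFrame b ν).contDiffOn.inv
    fun _ h => h).mul (contDiff_volume_graphFrame b p).contDiffOn

omit [FiniteDimensional ℝ E] in
theorem unitChart_mem (hn : 1 ≤ n) {a : Fin n → κ → ℝ} (ha : a ∈ unitChartDomain b ν) :
    unitChart b ν a ∈ unitSet ν := by
  obtain ⟨w, hw⟩ := smul_altEval hn (ν (graphFrame b a))⁻¹ (graphFrame b a)
  refine ⟨⟨w, hw⟩, ?_⟩
  exact inv_mul_cancel₀ ha

theorem unitChart_baseForm_ne_zero {a : Fin n → κ → ℝ} (ha : a ∈ unitChartDomain b ν) :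
    unitChart b ν a (baseForm b) ≠ 0 := by
  change (ν (graphFrame b a))⁻¹ * baseForm b (graphFrame b a) ≠ 0
  rw [baseForm_graphFrame, mul_one]
  exact inv_ne_zero ha

theorem slope_unitChart {a : Fin n → κ → ℝ} (ha : a ∈ unitChartDomain b ν) :
    slope b (unitChart b ν a) = a := slope_smul_graphFrame b (inv_ne_zero ha) a

theorem contDiffAt_slope {z : (E [⋀^Fin n]→L[ℝ] ℝ) →L[ℝ] ℝ} (hz : z (baseForm b) ≠ 0) :
    ContDiffAt ℝ ∞ (slope b) z := by
  refine contDiffAt_pi.2 fun i => contDiffAt_pi.2 fun j => ?_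
  exact ContDiffAt.div (contDiffAt_id.clm_apply contDiffAt_const)
    (contDiffAt_id.clm_apply contDiffAt_const) hz

/-- A multivector is determined by its slopes up to a scalar, and the normalization `z ν = 1` fixes
the scalar. -/
theorem slope_mem_unitChartDomain {z : (E [⋀^Fin n]→L[ℝ] ℝ) →L[ℝ] ℝ} (hz : z ∈ unitSet ν)
    (hb : z (baseForm b) ≠ 0) : slope b z ∈ unitChartDomain b ν ∧ unitChart b ν (slope b z) = z := by
  obtain ⟨⟨v, rfl⟩, hν⟩ := hz
  have h1 := altEval_eq_smul_graphFrame b hb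
  have h2 := congrArg (fun y : (E [⋀^Fin n]→L[ℝ] ℝ) →L[ℝ] ℝ => y ν) h1
  change altEval v ν = altEval v (baseForm b) * ν (graphFrame b (slope b (altEval v))) at h2
  rw [hν] at h2
  refine ⟨fun h0 => ?_, ?_⟩
  · rw [h0, mul_zero] at h2
    exact one_ne_zero h2
  · conv_rhs => rw [h1]
    rw [unitChart, ← eq_inv_of_mul_eq_one_left h2.symm]

/-- `slope b` is a differentiable left inverse of the chart. -/
theorem fderiv_unitChart_injective {a : Fin n → κ → ℝ} (ha : a ∈ unitChartDomain b ν) :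
    Function.Injective (fderiv ℝ (unitChart b ν) a) := by
  have h1 : HasFDerivAt (unitChart b ν) (fderiv ℝ (unitChart b ν) a) a :=
    (((contDiffOn_unitChart b ν).contDiffAt ((isOpen_unitChartDomain b ν).mem_nhds
      ha)).differentiableAt (by simp)).hasFDerivAt
  have h2 := ((contDiffAt_slope b (unitChart_baseForm_ne_zero b ν ha)).differentiableAt
    (by simp)).hasFDerivAt
  have h3 : HasFDerivAt (fun a => slope b (unitChart b ν a)) (ContinuousLinearMap.id ℝ _) a := by
    refine (hasFDerivAt_id a).congr_of_eventuallyEq ?_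
    filter_upwards [(isOpen_unitChartDomain b ν).mem_nhds ha] with a' ha'
    exact slope_unitChart b ν ha'
  have h4 := (h2.comp a h1).unique h3
  intro x y hxy
  have h5 : ∀ x, fderiv ℝ (slope b) (unitChart b ν a) (fderiv ℝ (unitChart b ν) a x) = x :=
    fun x => congrArg (fun B : (Fin n → κ → ℝ) →L[ℝ] (Fin n → κ → ℝ) => B x) h4
  rw [← h5 x, ← h5 y, hxy]

variable {ν} {ℓ : ((E [⋀^Fin n]→L[ℝ] ℝ) →L[ℝ] ℝ) → ℝ}

theorem contDiffOn_comp_unitChart (hn : 1 ≤ n) (hℓ : IsSmoothOnUnitSet ν ℓ) :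
    ContDiffOn ℝ ∞ (fun a => ℓ (unitChart b ν a)) (unitChartDomain b ν) := fun a ha => by
  have hO := (isOpen_unitChartDomain b ν).mem_nhds ha
  refine (hℓ _ (unitChart b ν) a ((contDiffOn_unitChart b ν).contDiffAt hO) ?_).contDiffWithinAt
  filter_upwards [hO] with a' ha' using unitChart_mem b ν hn ha'

/-- Criticality tested on curves is compared with the vanishing of a differential in a chart. A
curve through the point is near time zero the image of the curve of its slopes, and the chain rule
applies. Conversely, the lines through `a`, reparametrized so that they never leave the domain of
the chart, supply enough test curves. -/
theorem isLegendrePoint_iff_mem_criticalSet (hn : 1 ≤ n) (hℓ : IsSmoothOnUnitSet ν ℓ)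
    {a : Fin n → κ → ℝ} (ha : a ∈ unitChartDomain b ν) (p : E [⋀^Fin n]→L[ℝ] ℝ) :
    IsLegendrePoint (unitChart b ν) (fun a => ℓ (unitChart b ν a)) a p ↔
      unitChart b ν a ∈ criticalSet ν ℓ p := by
  have hO := (isOpen_unitChartDomain b ν).mem_nhds ha
  have hz : HasFDerivAt (unitChart b ν) (fderiv ℝ (unitChart b ν) a) a :=
    (((contDiffOn_unitChart b ν).contDiffAt hO).differentiableAt (by simp)).hasFDerivAt
  have hℓz : HasFDerivAt (fun a => ℓ (unitChart b ν a))
      (fderiv ℝ (fun a => ℓ (unitChart b ν a)) a) a :=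
    (((contDiffOn_comp_unitChart b hn hℓ).contDiffAt hO).differentiableAt (by simp)).hasFDerivAt
  have hW : HasFDerivAt (fun a => unitChart b ν a p - ℓ (unitChart b ν a))
      ((fderiv ℝ (unitChart b ν) a).flip p - fderiv ℝ (fun a => ℓ (unitChart b ν a)) a) a := by
    have := (hz.clm_apply (hasFDerivAt_const p a)).sub hℓz
    refine this.congr_fderiv ?_
    ext x
    simp
  constructor
  · intro hL
    refine ⟨unitChart_mem b ν hn ha, fun c hc hcu hc0 => ?_⟩
    have hcd : ContDiff ℝ ∞ c := contDiff_clm_apply_iff.2 hc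
    have hb0 : c 0 (baseForm b) ≠ 0 := hc0 ▸ unitChart_baseForm_ne_zero b ν ha
    have hs0 : slope b (c 0) = a := by rw [hc0, slope_unitChart b ν ha]
    have hsd : HasDerivAt (fun t => slope b (c t)) (deriv (fun t => slope b (c t)) 0) 0 :=
      (((contDiffAt_slope b hb0).comp 0 hcd.contDiffAt).differentiableAt (by simp)).hasDerivAt
    rw [IsLegendrePoint] at hL
    rw [hL, sub_self, ← hs0] at hW
    have h1 := hW.comp_hasDerivAt (0 : ℝ) hsd
    refine h1.congr_of_eventuallyEq ?_
    filter_upwards [(hc (baseForm b)).continuous.continuousAt.eventually_ne hb0] with t ht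
    simp [(slope_mem_unitChartDomain b ν (hcu t) ht).2]
  · intro hcrit
    rw [IsLegendrePoint, ← sub_eq_zero]
    ext x
    obtain ⟨δ, hδ, hball⟩ := Metric.mem_nhds_iff.1 hO
    obtain ⟨τ, hτ, hτ0, hτ1, hτδ⟩ := exists_bounded_reparam (δ := δ / (‖x‖ + 1)) (by positivity)
    have hmem : ∀ t, a + τ t • x ∈ unitChartDomain b ν := fun t => hball (by
      rw [Metric.mem_ball, dist_eq_norm, add_sub_cancel_left, norm_smul, Real.norm_eq_abs]
      have h2 := hτδ t
      rw [lt_div_iff₀ (by positivity)] at h2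
      refine lt_of_le_of_lt ?_ h2
      gcongr
      linarith)
    have hline : ContDiff ℝ ∞ fun t => a + τ t • x := contDiff_const.add (hτ.smul contDiff_const)
    have hc : ContDiff ℝ ∞ fun t => unitChart b ν (a + τ t • x) := contDiff_iff_contDiffAt.2 fun t => by
      have h6 : ContDiffAt ℝ ∞ (unitChart b ν) (a + τ t • x) := (contDiffOn_unitChart b ν).contDiffAt
        ((isOpen_unitChartDomain b ν).mem_nhds (hmem t))
      exact h6.comp t hline.contDiffAt
    have h3 := hcrit.2 (fun t => unitChart b ν (a + τ t • x))
      (fun η => hc.clm_apply contDiff_const) (fun t => unitChart_mem b ν hn (hmem t)) (by simp [hτ0])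
    have h4 : HasDerivAt (fun t => a + τ t • x) x 0 := by
      simpa using (hτ1.smul_const x).const_add a
    have hW' := hW
    have h0 : a = a + τ 0 • x := by simp [hτ0]
    rw [h0] at hW'
    have h7 := hW'.comp_hasDerivAt (0 : ℝ) h4
    have h5 := h7.unique h3
    rw [← h0] at h5
    exact h5

end Chart

variable {ν : E [⋀^Fin n]→L[ℝ] ℝ}

/-- The multivectors of `unitSet ν` are covered by finitely many charts. -/
theorem exists_chart_family : ∃ (J : Type) (_ : Countable J) (κ : J → Type)
    (_ : ∀ j, Fintype (κ j)) (b : ∀ j, Module.Basis (Fin n ⊕ κ j) ℝ E),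
    ∀ z : (E [⋀^Fin n]→L[ℝ] ℝ) →L[ℝ] ℝ, z ≠ 0 → ∃ j, z (baseForm (b j)) ≠ 0 := by
  classical
  let B := Module.finBasis ℝ E
  -- There is one chart for each injective choice of `n` vectors of a basis of `E`, which are moved
  -- to the front. The choices that are not injective give the zero form and are not needed.
  let J := {I : Fin n → Fin (Module.finrank ℝ E) // Function.Injective I}
  let e : ∀ I : J, Fin n ⊕ ((range I.1)ᶜ : Set _) ≃ Fin (Module.finrank ℝ E) := fun I =>
    ((Equiv.ofInjective I.1 I.2).sumCongr (Equiv.refl _)).trans (Equiv.Set.sumCompl (range I.1))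
  refine ⟨J, inferInstance, fun I => ((range I.1)ᶜ : Set _), fun I => inferInstance,
    fun I => B.reindex (e I).symm, fun z hz => ?_⟩
  by_contra! hcon
  refine hz (eq_zero_of_forall_detForm B z fun I => ?_)
  by_cases hI : Function.Injective I
  · have := hcon ⟨I, hI⟩
    rw [baseForm] at this
    convert this using 3
    funext i
    ext x
    rw [coordL_apply, coordL_apply, Module.Basis.repr_reindex_apply]
    rfl
  · obtain ⟨i, j, hij, hne⟩ := Function.not_injective_iff.1 hI
    have : detForm (fun i => coordL B (I i)) = 0 := by
      ext u
      rw [detForm_apply]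
      refine Matrix.det_zero_of_column_eq hne fun k => ?_
      simp [hij]
    rw [this, map_zero]

/-- A limit `z` satisfies `z ν = 1`, so it is not zero and some `baseForm` does not vanish on it.
Near `z` the elements of the set satisfy the identity of `altEval_eq_smul_graphFrame`, whose right
side is a continuous function of the multivector alone, so the identity persists in the limit and
exhibits `z` as decomposable. -/
theorem isClosed_unitSet (hn : 1 ≤ n) (ν : E [⋀^Fin n]→L[ℝ] ℝ) : IsClosed (unitSet ν) := by
  obtain ⟨J, _, κ, _, b, hb⟩ := exists_chart_family (n := n) (E := E)
  refine isClosed_of_closure_subset fun z hz => ?_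
  have hev : Continuous fun y : (E [⋀^Fin n]→L[ℝ] ℝ) →L[ℝ] ℝ => y ν :=
    (ContinuousLinearMap.apply ℝ ℝ ν).continuous
  have hzν : z ν = 1 :=
    closure_minimal (fun y hy => hy.2) (isClosed_singleton.preimage hev) hz
  obtain ⟨j, hj⟩ := hb z fun h => by simp [h] at hzν
  have hj' := hj
  have hs : ContinuousAt (slope (b j)) z := (contDiffAt_slope (b j) hj).continuousAt
  have hev' : Continuous fun y : (E [⋀^Fin n]→L[ℝ] ℝ) →L[ℝ] ℝ => y (baseForm (b j)) :=
    (ContinuousLinearMap.apply ℝ ℝ (baseForm (b j))).continuous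
  have hR : ContinuousAt (fun y : (E [⋀^Fin n]→L[ℝ] ℝ) →L[ℝ] ℝ =>
      y (baseForm (b j)) • altEval (graphFrame (b j) (slope (b j) y))) z :=
    hev'.continuousAt.smul (ContinuousAt.comp (f := slope (b j))
      (g := fun a => altEval (graphFrame (b j) a)) (contDiff_altEval.comp
      (contDiff_graphFrame (b j))).continuous.continuousAt hs)
  have hne : (𝓝[unitSet ν] z).NeBot := mem_closure_iff_nhdsWithin_neBot.1 hz
  have heq : z = z (baseForm (b j)) • altEval (graphFrame (b j) (slope (b j) z)) := by
    refine tendsto_nhds_unique (f := id) (l := 𝓝[unitSet ν] z)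
      (Filter.tendsto_id.mono_left nhdsWithin_le_nhds) ?_
    refine (hR.tendsto.mono_left nhdsWithin_le_nhds).congr' ?_
    filter_upwards [self_mem_nhdsWithin,
      nhdsWithin_le_nhds (hev'.continuousAt.eventually_ne hj)] with y hy hy0
    obtain ⟨⟨v, rfl⟩, -⟩ := hy
    exact (altEval_eq_smul_graphFrame (b j) hy0).symm
  obtain ⟨w, hw⟩ := smul_altEval hn (z (baseForm (b j))) (graphFrame (b j) (slope (b j) z))
  exact ⟨⟨w, hw.trans heq.symm⟩, hzν⟩

open MeasureTheory in
/-- The differential of a smooth Legendre image Hamiltonian is the Legendre correspondence. -/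
theorem fderiv_eq_of_mem_criticalSet (hn : 1 ≤ n) {ℓ : ((E [⋀^Fin n]→L[ℝ] ℝ) →L[ℝ] ℝ) → ℝ}
    (hℓ : IsSmoothOnUnitSet ν ℓ) {M : Set (E [⋀^Fin n]→L[ℝ] ℝ)} (hM : IsOpen M)
    (hex : ∀ p ∈ M, ∃! z, z ∈ criticalSet ν ℓ p) {h : (E [⋀^Fin n]→L[ℝ] ℝ) → ℝ}
    (hh : ContDiffOn ℝ ∞ h M) (hW : ∀ p ∈ M, ∀ z ∈ criticalSet ν ℓ p, h p = z p - ℓ z)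
    {p : E [⋀^Fin n]→L[ℝ] ℝ} (hp : p ∈ M) {z : (E [⋀^Fin n]→L[ℝ] ℝ) →L[ℝ] ℝ}
    (hz : z ∈ criticalSet ν ℓ p) : fderiv ℝ h p = z := by
  obtain ⟨J, _, κ, _, b, hb⟩ := exists_chart_family (n := n) (E := E)
  have hne0 : ∀ z ∈ unitSet ν, z ≠ 0 := fun z hz h0 => by
    have := hz.2
    simp [h0] at this
  let _ : MeasurableSpace (E [⋀^Fin n]→L[ℝ] ℝ) := borel _
  have : BorelSpace (E [⋀^Fin n]→L[ℝ] ℝ) := ⟨rfl⟩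
  let μ : Measure (E [⋀^Fin n]→L[ℝ] ℝ) := Measure.addHaar
  -- One null set of exceptional momenta for each of the countably many charts.
  choose S hS0 hS using fun j => exists_null_hasEnvelope μ
    (isOpen_unitChartDomain (b j) ν) (contDiffOn_unitChart (b j) ν)
    (contDiffOn_comp_unitChart (b j) hn hℓ)
    (fun a ha => fderiv_unitChart_injective (b j) ν ha)
  have hgood : ∀ p ∈ M, p ∉ ⋃ j, S j → ∀ z ∈ criticalSet ν ℓ p, fderiv ℝ h p = z := by
    intro p hp hpS z hz
    obtain ⟨j, hj⟩ := hb z (hne0 z hz.1)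
    obtain ⟨ha, haz⟩ := slope_mem_unitChartDomain (b j) ν hz.1 hj
    have h1 := hS j (slope (b j) z) ha p (fun hpj => hpS (mem_iUnion.2 ⟨j, hpj⟩))
      ((isLegendrePoint_iff_mem_criticalSet (b j) hn hℓ ha p).2 (by rwa [haz]))
      h ((hh.contDiffAt (hM.mem_nhds hp)).differentiableAt (by simp)) (by
        have hn1 : ∀ᶠ x : (Fin n → κ j → ℝ) × (E [⋀^Fin n]→L[ℝ] ℝ) in 𝓝 (slope (b j) z, p),
            x.1 ∈ unitChartDomain (b j) ν ∧ x.2 ∈ M :=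
          prod_mem_nhds ((isOpen_unitChartDomain (b j) ν).mem_nhds ha) (hM.mem_nhds hp)
        filter_upwards [hn1] with x hx hxL
        exact hW x.2 hx.2 _ ((isLegendrePoint_iff_mem_criticalSet (b j) hn hℓ hx.1 x.2).1 hxL))
    rw [h1, haz]
  -- A null set for a Haar measure has empty interior, so the good momenta are dense.
  have hdense : Dense (⋃ j, S j)ᶜ := by
    have : μ (⋃ j, S j) = 0 := measure_iUnion_null hS0
    rw [← interior_eq_empty_iff_dense_compl]
    exact Measure.interior_eq_empty_of_null this
  let G : Set (E [⋀^Fin n]→L[ℝ] ℝ) := M ∩ (⋃ j, S j)ᶜ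
  have hne : (𝓝[G] p).NeBot := mem_closure_iff_nhdsWithin_neBot.1
    (hdense.open_subset_closure_inter hM hp)
  have hG : ∀ p ∈ G, fderiv ℝ h p ∈ criticalSet ν ℓ p := fun p hp => by
    obtain ⟨z, hz, -⟩ := hex p hp.1
    rwa [hgood p hp.1 hp.2 z hz]
  -- At an arbitrary `p` the continuous map `fderiv ℝ h` replaces the Legendre map, about whose
  -- continuity nothing is known. Its value at `p` is a limit of critical points, hence lies in the
  -- closed set `unitSet ν` and is critical for `p`; uniqueness identifies it with `z`.
  have hcont : ContinuousAt (fderiv ℝ h) p :=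
    ((hh.fderiv_of_isOpen (m := ∞) hM (by simp)).continuousOn).continuousAt (hM.mem_nhds hp)
  have hcontG : Filter.Tendsto (fderiv ℝ h) (𝓝[G] p) (𝓝 (fderiv ℝ h p)) :=
    hcont.tendsto.mono_left nhdsWithin_le_nhds
  have hmem : fderiv ℝ h p ∈ unitSet ν := (isClosed_unitSet hn ν).mem_of_tendsto hcontG (by
    filter_upwards [self_mem_nhdsWithin] with q hq using (hG q hq).1)
  obtain ⟨j, hj⟩ := hb _ (hne0 _ hmem)
  obtain ⟨ha, haz⟩ := slope_mem_unitChartDomain (b j) ν hmem hj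
  have hO := isOpen_unitChartDomain (b j) ν
  have hslope : Filter.Tendsto (fun q => slope (b j) (fderiv ℝ h q)) (𝓝[G] p)
      (𝓝 (slope (b j) (fderiv ℝ h p))) :=
    (contDiffAt_slope (b j) hj).continuousAt.tendsto.comp hcontG
  have hcrit : IsLegendrePoint (unitChart (b j) ν) (fun a => ℓ (unitChart (b j) ν a))
      (slope (b j) (fderiv ℝ h p)) p := by
    refine IsLegendrePoint.of_tendsto hO (contDiffOn_unitChart (b j) ν)
      (contDiffOn_comp_unitChart (b j) hn hℓ) hslope ha
      (Filter.tendsto_id.mono_left nhdsWithin_le_nhds) ?_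
    have hev : ∀ᶠ q in 𝓝[G] p, fderiv ℝ h q (baseForm (b j)) ≠ 0 :=
      (((ContinuousLinearMap.apply ℝ ℝ (baseForm (b j))).continuous.tendsto _).comp
        hcontG).eventually_ne hj
    filter_upwards [self_mem_nhdsWithin, hev] with q hq hq0
    obtain ⟨hqa, hqz⟩ := slope_mem_unitChartDomain (b j) ν (hG q hq).1 hq0
    exact (isLegendrePoint_iff_mem_criticalSet (b j) hn hℓ hqa q).2 (by rw [hqz]; exact hG q hq)
  have hfin := (isLegendrePoint_iff_mem_criticalSet (b j) hn hℓ ha p).1 hcrit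
  rw [haz] at hfin
  exact (hex p hp).unique hfin hz

end Fibre

/-! ### Bundle coordinates on `Λⁿ T*N` -/

section Coordinates

variable {n : ℕ} {E : Type*} [NormedAddCommGroup E] [NormedSpace ℝ E]
  {N : Type*} [TopologicalSpace N] [ChartedSpace E N] [IsManifold 𝓘(ℝ, E) ∞ N]

/-- The coordinate isomorphism `T_q N → E` of the trivialization of the tangent bundle at `q₀`. -/
noncomputable def tangentCoord (q₀ q : N) : TangentSpace 𝓘(ℝ, E) q →L[ℝ] E :=
  (trivializationAt E (TangentSpace 𝓘(ℝ, E)) q₀).continuousLinearMapAt ℝ q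

/-- The inverse of `tangentCoord`. -/
noncomputable def tangentCoordSymm (q₀ q : N) : E →L[ℝ] TangentSpace 𝓘(ℝ, E) q :=
  (trivializationAt E (TangentSpace 𝓘(ℝ, E)) q₀).symmL ℝ q

/-- The fibre coordinate of a point of `Λⁿ T*N` over the chart at `q₀`. -/
noncomputable def formCoord (q₀ : N) (m : FormBundle n E N) : E [⋀^Fin n]→L[ℝ] ℝ :=
  (trivializationAt (E [⋀^Fin n]→L[ℝ] ℝ) (fun q : N => Form n E q) q₀ m).2

/-- The form with a given fibre coordinate. -/
noncomputable def coordForm (q₀ q : N) (f : E [⋀^Fin n]→L[ℝ] ℝ) : Form n E q :=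
  f.compContinuousLinearMap (tangentCoord q₀ q)

theorem mem_baseSet_iff {q₀ q : N} :
    q ∈ (trivializationAt (E [⋀^Fin n]→L[ℝ] ℝ) (fun q : N => Form n E q) q₀).baseSet ↔
      q ∈ (chartAt E q₀).source := by
  rw [FiberBundle.trivializationAt_continuousAlternatingMap_baseSet,
    TangentBundle.trivializationAt_baseSet]
  exact and_iff_left (mem_univ q)

theorem mem_trivialization_source_iff {q₀ : N} {m : FormBundle n E N} :
    m ∈ (trivializationAt (E [⋀^Fin n]→L[ℝ] ℝ) (fun q : N => Form n E q) q₀).source ↔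
      m.proj ∈ (chartAt E q₀).source := by
  rw [Trivialization.mem_source, mem_baseSet_iff]

theorem formCoord_apply (q₀ : N) (m : FormBundle n E N) (v : Fin n → E) :
    formCoord q₀ m v = m.snd fun i => tangentCoordSymm q₀ m.proj (v i) := by
  have h : formCoord q₀ m = (((trivializationAt ℝ (Bundle.Trivial N ℝ) q₀).continuousLinearMapAt ℝ
      m.proj).compContinuousAlternatingMap m.snd).compContinuousLinearMap
        (tangentCoordSymm q₀ m.proj) := rfl
  rw [h]
  change (trivializationAt ℝ (Bundle.Trivial N ℝ) q₀).continuousLinearMapAt ℝ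
      m.proj (m.snd fun i => tangentCoordSymm q₀ m.proj (v i)) = _
  rw [Bundle.Trivialization.continuousLinearMapAt_apply,
    Bundle.Trivialization.linearMapAt_apply, if_pos]
  · rfl
  · exact mem_univ _

theorem tangentCoordSymm_tangentCoord {q₀ q : N} (hq : q ∈ (chartAt E q₀).source)
    (v : TangentSpace 𝓘(ℝ, E) q) : tangentCoordSymm q₀ q (tangentCoord q₀ q v) = v :=
  Trivialization.symmL_continuousLinearMapAt _ (by rwa [TangentBundle.trivializationAt_baseSet]) v

theorem tangentCoord_tangentCoordSymm {q₀ q : N} (hq : q ∈ (chartAt E q₀).source)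
    (v : E) : tangentCoord q₀ q (tangentCoordSymm q₀ q v) = v :=
  Trivialization.continuousLinearMapAt_symmL _ (by rwa [TangentBundle.trivializationAt_baseSet]) v

/-- The space `T_q N` is by definition `E`, read in the preferred chart at `q`, so the
trivialization based at `q` is the identity over `q`. For this reason fibres can be treated below as
the fixed vector space of forms on `E`. -/
theorem tangentCoord_self (q : N) (v : TangentSpace 𝓘(ℝ, E) q) : tangentCoord q q v = v := by
  rw [tangentCoord, TangentBundle.continuousLinearMapAt_trivializationAt_eq_core (by simp)]
  exact (tangentBundleCore 𝓘(ℝ, E) N).coordChange_self (achart E q) q (mem_chart_source E q) v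

theorem tangentCoordSymm_self (q : N) (v : E) : tangentCoordSymm q q v = v := by
  have h := tangentCoordSymm_tangentCoord (mem_chart_source E q) (show TangentSpace 𝓘(ℝ, E) q from v)
  rwa [tangentCoord_self] at h

theorem snd_apply_eq_formCoord {q₀ : N} {m : FormBundle n E N}
    (hm : m.proj ∈ (chartAt E q₀).source) (X : Fin n → TangentSpace 𝓘(ℝ, E) m.proj) :
    m.snd X = formCoord q₀ m fun i => tangentCoord q₀ m.proj (X i) := by
  rw [formCoord_apply]
  congr 1
  funext i
  exact (tangentCoordSymm_tangentCoord hm (X i)).symm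

theorem formCoord_self (q : N) (p : E [⋀^Fin n]→L[ℝ] ℝ) :
    formCoord q (⟨q, p⟩ : FormBundle n E N) = p := by
  ext v
  rw [formCoord_apply]
  exact congrArg p (funext fun i => tangentCoordSymm_self q (v i))

theorem formCoord_coordForm {q₀ q : N} (hq : q ∈ (chartAt E q₀).source)
    (f : E [⋀^Fin n]→L[ℝ] ℝ) : formCoord q₀ (⟨q, coordForm q₀ q f⟩ : FormBundle n E N) = f := by
  ext v
  rw [formCoord_apply]
  exact congrArg f (funext fun i => tangentCoord_tangentCoordSymm hq (v i))

theorem coordForm_formCoord {q₀ : N} {m : FormBundle n E N}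
    (hm : m.proj ∈ (chartAt E q₀).source) : coordForm q₀ m.proj (formCoord q₀ m) = m.snd := by
  ext X
  exact (snd_apply_eq_formCoord hm X).symm

theorem coordForm_self (q : N) (f : E [⋀^Fin n]→L[ℝ] ℝ) : coordForm q q f = f := by
  ext X
  exact congrArg f (funext fun i => tangentCoord_self q (X i))

theorem formCoord_add_smul (q₀ q : N) (p η : Form n E q) (t : ℝ) :
    formCoord q₀ (⟨q, p + t • η⟩ : FormBundle n E N) =
      formCoord q₀ (⟨q, p⟩ : FormBundle n E N) + t • formCoord q₀ (⟨q, η⟩ : FormBundle n E N) := by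
  ext v
  rw [formCoord_apply]
  simp only [ContinuousAlternatingMap.add_apply, ContinuousAlternatingMap.smul_apply,
    formCoord_apply]

theorem formCoord_sub (q₀ q : N) (p η : Form n E q) :
    formCoord q₀ (⟨q, p - η⟩ : FormBundle n E N) =
      formCoord q₀ (⟨q, p⟩ : FormBundle n E N) - formCoord q₀ (⟨q, η⟩ : FormBundle n E N) := by
  ext v
  rw [formCoord_apply]
  simp only [ContinuousAlternatingMap.sub_apply, formCoord_apply]

variable {G : Type*} [NormedAddCommGroup G] [NormedSpace ℝ G] {H : Type*} [TopologicalSpace H]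
  {I : ModelWithCorners ℝ G H} {X : Type*} [TopologicalSpace X] [ChartedSpace H X]

theorem contMDiffAt_formBundle_iff {μ : X → FormBundle n E N} {x : X} {q₀ : N}
    (hx : (μ x).proj ∈ (chartAt E q₀).source) :
    ContMDiffAt I (formModel n E) ∞ μ x ↔ ContMDiffAt I 𝓘(ℝ, E) ∞ (fun y => (μ y).proj) x ∧
      ContMDiffAt I 𝓘(ℝ, E [⋀^Fin n]→L[ℝ] ℝ) ∞ (fun y => formCoord q₀ (μ y)) x :=
  Trivialization.contMDiffAt_iff (mem_trivialization_source_iff.2 hx)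

theorem contMDiffAt_formCoord {q₀ : N} {m : FormBundle n E N}
    (hm : m.proj ∈ (chartAt E q₀).source) :
    ContMDiffAt (formModel n E) 𝓘(ℝ, E [⋀^Fin n]→L[ℝ] ℝ) ∞ (formCoord q₀) m :=
  ((contMDiffAt_formBundle_iff (μ := id) hm).1 contMDiffAt_id).2

theorem extChartAt_formBundle (m₀ m : FormBundle n E N)
    (hm : m.proj ∈ (chartAt E m₀.proj).source) :
    extChartAt (formModel n E) m₀ m = (extChartAt 𝓘(ℝ, E) m₀.proj m.proj, formCoord m₀.proj m) := by
  have h := congrArg (fun e : PartialEquiv (FormBundle n E N) (E × (E [⋀^Fin n]→L[ℝ] ℝ)) => e m)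
    (FiberBundle.extChartAt (IB := 𝓘(ℝ, E)) m₀)
  refine h.trans ?_
  have h2 := (trivializationAt (E [⋀^Fin n]→L[ℝ] ℝ) (fun q : N => Form n E q) m₀.proj).coe_fst
    (mem_trivialization_source_iff.2 hm)
  change (extChartAt 𝓘(ℝ, E) m₀.proj (trivializationAt (E [⋀^Fin n]→L[ℝ] ℝ)
    (fun q : N => Form n E q) m₀.proj m).1, formCoord m₀.proj m) = _
  rw [h2]

theorem mem_chartAt_formBundle_source_iff {m₀ m : FormBundle n E N} :
    m ∈ (extChartAt (formModel n E) m₀).source ↔ m.proj ∈ (chartAt E m₀.proj).source := by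
  have h := FiberBundle.extChartAt (IB := 𝓘(ℝ, E)) m₀
  rw [h]
  simp only [PartialEquiv.trans_source, mem_inter_iff]
  constructor
  · intro hm
    exact mem_trivialization_source_iff.1 hm.1
  · intro hm
    refine ⟨mem_trivialization_source_iff.2 hm, ?_⟩
    have h2 := (trivializationAt (E [⋀^Fin n]→L[ℝ] ℝ) (fun q : N => Form n E q) m₀.proj).coe_fst
      (mem_trivialization_source_iff.2 hm)
    simp only [mem_preimage, PartialEquiv.prod_source, PartialEquiv.refl_source, mem_prod, mem_univ,
      and_true, extChartAt_source]
    change (trivializationAt (E [⋀^Fin n]→L[ℝ] ℝ)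
      (fun q : N => Form n E q) m₀.proj m).1 ∈ _
    rwa [h2]

theorem tangentCoord_mfderiv {q₀ : N} {c : G → N} {x : G}
    (hc : MDifferentiableAt 𝓘(ℝ, G) 𝓘(ℝ, E) c x) (hx : c x ∈ (chartAt E q₀).source) (v : G) :
    tangentCoord q₀ (c x) (mfderiv 𝓘(ℝ, G) 𝓘(ℝ, E) c x v) =
      fderiv ℝ (fun y => extChartAt 𝓘(ℝ, E) q₀ (c y)) x v := by
  have h : tangentCoord q₀ (c x) = mfderiv 𝓘(ℝ, E) 𝓘(ℝ, E) (extChartAt 𝓘(ℝ, E) q₀) (c x) :=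
    TangentBundle.continuousLinearMapAt_trivializationAt hx
  rw [h, ← mfderiv_eq_fderiv]
  have h2 := mfderiv_comp (I := 𝓘(ℝ, G)) (I' := 𝓘(ℝ, E)) (I'' := 𝓘(ℝ, E)) x
    (mdifferentiableAt_extChartAt (I := 𝓘(ℝ, E)) hx) hc
  exact (congrArg (fun L : G →L[ℝ] E => L v) h2).symm

end Coordinates

/-! ### Fibres of `Λⁿ T*N` and vertical tangent vectors -/

section Fibre

variable {n : ℕ} {E : Type*} [NormedAddCommGroup E] [NormedSpace ℝ E]
  {N : Type*} [TopologicalSpace N] [ChartedSpace E N] [IsManifold 𝓘(ℝ, E) ∞ N]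

variable (n E) in
/-- The inclusion of the fibre `Λⁿ T*_q N`. -/
def fibreIncl (q : N) (p : E [⋀^Fin n]→L[ℝ] ℝ) : FormBundle n E N := ⟨q, p⟩

theorem contMDiff_fibreIncl (q : N) :
    ContMDiff 𝓘(ℝ, E [⋀^Fin n]→L[ℝ] ℝ) (formModel n E) ∞ (fibreIncl n E q) := fun p => by
  refine (contMDiffAt_formBundle_iff (q₀ := q) (mem_chart_source E q)).2
    ⟨contMDiffAt_const, ?_⟩
  simp only [fibreIncl, formCoord_self]
  exact contMDiffAt_id

theorem verticalLift_fibreIncl (q : N) (p η : E [⋀^Fin n]→L[ℝ] ℝ) :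
    verticalLift (fibreIncl n E q p) η =
      mfderiv 𝓘(ℝ, E [⋀^Fin n]→L[ℝ] ℝ) (formModel n E) (fibreIncl n E q) p η := by
  have h1 : HasDerivAt (fun t : ℝ => p + t • η) η 0 := by
    simpa using ((hasDerivAt_id (0 : ℝ)).smul_const η).const_add p
  have h2 : MDifferentiableAt 𝓘(ℝ, E [⋀^Fin n]→L[ℝ] ℝ) (formModel n E) (fibreIncl n E q)
      (p + (0 : ℝ) • η) := (contMDiff_fibreIncl q).mdifferentiable (by simp) _
  have h3 := mfderiv_comp (0 : ℝ) h2 h1.differentiableAt.mdifferentiableAt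
  rw [mfderiv_eq_fderiv, h1.hasFDerivAt.fderiv] at h3
  refine (congrArg (fun L : ℝ →L[ℝ] E × (E [⋀^Fin n]→L[ℝ] ℝ) => L 1) h3).trans ?_
  change mfderiv 𝓘(ℝ, E [⋀^Fin n]→L[ℝ] ℝ) (formModel n E) (fibreIncl n E q) (p + (0 : ℝ) • η)
    ((1 : ℝ) • η) = _
  rw [one_smul, zero_smul, add_zero]

/-- The inclusion of the fibre is smooth, and the chain rule reduces derivatives along vertical
vectors to derivatives on a vector space. -/
theorem mfderiv_verticalLift {G : Type*} [NormedAddCommGroup G] [NormedSpace ℝ G] {H : Type*}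
    [TopologicalSpace H] {I : ModelWithCorners ℝ G H} {X : Type*} [TopologicalSpace X]
    [ChartedSpace H X] {f : FormBundle n E N → X} {q : N} {p : E [⋀^Fin n]→L[ℝ] ℝ}
    (hf : MDifferentiableAt (formModel n E) I f (fibreIncl n E q p)) (η : E [⋀^Fin n]→L[ℝ] ℝ) :
    mfderiv (formModel n E) I f (fibreIncl n E q p) (verticalLift (fibreIncl n E q p) η) =
      mfderiv 𝓘(ℝ, E [⋀^Fin n]→L[ℝ] ℝ) I (fun p => f (fibreIncl n E q p)) p η := by
  rw [verticalLift_fibreIncl]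
  have h3 := mfderiv_comp (I := 𝓘(ℝ, E [⋀^Fin n]→L[ℝ] ℝ)) (I' := formModel n E) (I'' := I)
    (f := fibreIncl n E q) (g := f) p hf ((contMDiff_fibreIncl q).mdifferentiable (by simp) _)
  exact (congrArg (fun L : (E [⋀^Fin n]→L[ℝ] ℝ) →L[ℝ] G => L η) h3).symm

theorem mfderiv_proj_verticalLift (q : N) (p η : E [⋀^Fin n]→L[ℝ] ℝ) :
    mfderiv (formModel n E) 𝓘(ℝ, E) (fun m' : FormBundle n E N => m'.proj) (fibreIncl n E q p)
      (verticalLift (fibreIncl n E q p) η) = 0 := by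
  refine (mfderiv_verticalLift ((contMDiff_proj _).mdifferentiable (n := ∞) (by simp) _) η).trans ?_
  simp only [fibreIncl]
  rw [mfderiv_const]
  rfl

theorem mfderiv_extChartAt_verticalLift (m₀ : FormBundle n E N) {q : N}
    (hq : q ∈ (chartAt E m₀.proj).source) (p η : E [⋀^Fin n]→L[ℝ] ℝ) :
    mfderiv (formModel n E) 𝓘(ℝ, E × (E [⋀^Fin n]→L[ℝ] ℝ)) (extChartAt (formModel n E) m₀)
      (fibreIncl n E q p) (verticalLift (fibreIncl n E q p) η) =
        (0, formCoord m₀.proj (fibreIncl n E q η)) := by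
  have hm' : fibreIncl n E q p ∈ (extChartAt (formModel n E) m₀).source :=
    mem_chartAt_formBundle_source_iff.2 hq
  rw [extChartAt_source] at hm'
  refine (mfderiv_verticalLift (mdifferentiableAt_extChartAt hm') η).trans ?_
  rw [mfderiv_eq_fderiv]
  have h1 : HasFDerivAt (fun p : E [⋀^Fin n]→L[ℝ] ℝ =>
      extChartAt (formModel n E) m₀ (fibreIncl n E q p)) (fderiv ℝ (fun p : E [⋀^Fin n]→L[ℝ] ℝ =>
      extChartAt (formModel n E) m₀ (fibreIncl n E q p)) p) (p + (0 : ℝ) • η) := by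
    rw [zero_smul, add_zero]
    refine DifferentiableAt.hasFDerivAt (MDifferentiableAt.differentiableAt ?_)
    exact MDifferentiableAt.comp (I' := formModel n E) p
      (mdifferentiableAt_extChartAt hm') ((contMDiff_fibreIncl q).mdifferentiable (by simp) _)
  have h2 : HasDerivAt (fun t : ℝ => p + t • η) η 0 := by
    simpa using ((hasDerivAt_id (0 : ℝ)).smul_const η).const_add p
  have h3 := h1.comp_hasDerivAt (0 : ℝ) h2
  have h4 : HasDerivAt (fun t : ℝ => extChartAt (formModel n E) m₀ (fibreIncl n E q (p + t • η)))
      ((0 : E), formCoord m₀.proj (fibreIncl n E q η)) 0 := by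
    have h5 : (fun t : ℝ => extChartAt (formModel n E) m₀ (fibreIncl n E q (p + t • η))) =
      fun t : ℝ => (extChartAt 𝓘(ℝ, E) m₀.proj q,
        formCoord m₀.proj (fibreIncl n E q p) + t • formCoord m₀.proj (fibreIncl n E q η)) := by
      funext t
      rw [extChartAt_formBundle m₀ (fibreIncl n E q (p + t • η)) hq]
      exact congrArg (Prod.mk _) (formCoord_add_smul m₀.proj q p η t)
    rw [h5]
    refine (hasDerivAt_const _ _).prodMk ?_
    simpa using ((hasDerivAt_id (0 : ℝ)).smul_const (formCoord m₀.proj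
      (fibreIncl n E q η))).const_add (formCoord m₀.proj (fibreIncl n E q p))
  exact h3.unique h4

variable {M : Set (FormBundle n E N)} {𝓗 : FormBundle n E N → ℝ}

theorem contDiffOn_fibreIncl (h𝓗 : ContMDiffOn (formModel n E) 𝓘(ℝ, ℝ) ∞ 𝓗 M) (q : N) :
    ContDiffOn ℝ ∞ (fun p => 𝓗 (fibreIncl n E q p)) (fibreIncl n E q ⁻¹' M) :=
  (h𝓗.comp (contMDiff_fibreIncl q).contMDiffOn fun _ h => h).contDiffOn

theorem isOpen_fibreIncl_preimage (hM : IsOpen M) (q : N) : IsOpen (fibreIncl n E q ⁻¹' M) :=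
  hM.preimage (contMDiff_fibreIncl (n := n) q).continuous

end Fibre

/-! ### The Hamiltonian and the Legendre image under conormal translations -/

section Legendre

variable {n : ℕ} {E : Type*} [NormedAddCommGroup E] [NormedSpace ℝ E] [FiniteDimensional ℝ E]
  {N : Type*} [TopologicalSpace N] [ChartedSpace E N] [IsManifold 𝓘(ℝ, E) ∞ N]
  {vol : ∀ q : N, Form n E q} {L : ∀ q : N, MultiVec n E q → ℝ} {M : Set (FormBundle n E N)}
  {𝓗 : FormBundle n E N → ℝ}

theorem contDiffAt_clm_of_apply {A F : Type*} [NormedAddCommGroup A] [NormedSpace ℝ A]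
    [NormedAddCommGroup F] [NormedSpace ℝ F] [FiniteDimensional ℝ F] {f : A → F →L[ℝ] ℝ} {a : A}
    (h : ∀ p, ContDiffAt ℝ ∞ (fun a' => f a' p) a) : ContDiffAt ℝ ∞ f a := by
  let b := Module.finBasis ℝ F
  have h1 : f = fun a' => ∑ i, f a' (b i) • LinearMap.toContinuousLinearMap (b.coord i) := by
    funext a'
    ext p
    have := congrArg (f a') (b.sum_repr p)
    rw [map_sum] at this
    simp only [map_smul, smul_eq_mul] at this
    rw [← this]
    simp [mul_comm]
  rw [h1]
  exact ContDiffAt.sum fun i _ => (h (b i)).smul contDiffAt_const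

/-- Smoothness of `L` is given only along the subset `D^ω N` of `Λⁿ TN`. A smooth family of
multivectors over `q` that takes its values in `D^ω_q N` near `a` pulls this subset back to a
neighbourhood of `a`, so the composite is smooth in the ordinary sense. -/
theorem IsSmoothLagrangian.isSmoothOnUnitSet (hL : IsSmoothLagrangian vol L) (q : N) :
    IsSmoothOnUnitSet (E := E) (vol q) (L q) := by
  intro A _ _ z a hz hmem
  let ι : A → MultiVecBundle n E N := fun a' => ⟨q, z a'⟩
  have hι : ContMDiffAt 𝓘(ℝ, A) (𝓘(ℝ, E).prod 𝓘(ℝ, (E [⋀^Fin n]→L[ℝ] ℝ) →L[ℝ] ℝ)) ∞ ι a := by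
    refine contMDiffAt_totalSpace.2 ⟨contMDiffAt_const, ?_⟩
    let S : (E [⋀^Fin n]→L[ℝ] ℝ) →L[ℝ] Form n E q :=
      (trivializationAt (E [⋀^Fin n]→L[ℝ] ℝ) (fun q : N => Form n E q) q).symmL ℝ q
    have h2 : ∀ a' p, (trivializationAt ((E [⋀^Fin n]→L[ℝ] ℝ) →L[ℝ] ℝ)
        (fun q : N => MultiVec n E q) q (ι a')).2 p = z a' (S p) := by
      intro a' p
      rw [hom_trivializationAt_apply]
      change (trivializationAt ℝ (Bundle.Trivial N ℝ) q).continuousLinearMapAt ℝ q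
        (z a' (S p)) = _
      rw [Bundle.Trivialization.continuousLinearMapAt_apply,
        Bundle.Trivialization.linearMapAt_apply, if_pos]
      · rfl
      · exact mem_univ _
    refine ContDiffAt.contMDiffAt (contDiffAt_clm_of_apply fun p => ?_)
    simp only [ι] at h2 ⊢
    simp only [h2]
    exact hz.clm_apply contDiffAt_const
  have h := (hL (ι a) (hmem.self_of_nhds)).comp a (hι.contMDiffWithinAt (s := ι ⁻¹'
    {x | x.snd ∈ unitDecomposable vol x.proj})) (mapsTo_preimage _ _)
  exact (h.contMDiffAt hmem).contDiffAt

theorem IsLegendreImage.fderiv_eq (h𝓗 : IsLegendreImage vol L M 𝓗) (hn : 1 ≤ n)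
    (hL : IsSmoothLagrangian vol L) (hM : IsOpen M) {q : N} {p : E [⋀^Fin n]→L[ℝ] ℝ}
    (hp : fibreIncl n E q p ∈ M) {z : (E [⋀^Fin n]→L[ℝ] ℝ) →L[ℝ] ℝ} (hz : z ∈ legendreZ vol L q p) :
    fderiv ℝ (fun p => 𝓗 (fibreIncl n E q p)) p = z :=
  fderiv_eq_of_mem_criticalSet (E := E) (ν := vol q) (ℓ := L q) hn (hL.isSmoothOnUnitSet q)
    (isOpen_fibreIncl_preimage hM q) (fun p hp => h𝓗.existsUnique (fibreIncl n E q p) hp)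
    (contDiffOn_fibreIncl h𝓗.smooth q) (fun p hp z hz => h𝓗.eq_W (fibreIncl n E q p) hp z hz) hp hz

theorem IsLegendreImage.mfderiv_verticalLift (h𝓗 : IsLegendreImage vol L M 𝓗) (hn : 1 ≤ n)
    (hL : IsSmoothLagrangian vol L) (hM : IsOpen M) {q : N} {p : E [⋀^Fin n]→L[ℝ] ℝ}
    (hp : fibreIncl n E q p ∈ M) {z : (E [⋀^Fin n]→L[ℝ] ℝ) →L[ℝ] ℝ} (hz : z ∈ legendreZ vol L q p)
    (η : E [⋀^Fin n]→L[ℝ] ℝ) :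
    mfderiv (formModel n E) 𝓘(ℝ, ℝ) 𝓗 (fibreIncl n E q p) (verticalLift (fibreIncl n E q p) η) =
      z η := by
  refine (LepageDedecker.mfderiv_verticalLift (f := 𝓗)
    ((h𝓗.smooth.contMDiffAt (hM.mem_nhds hp)).mdifferentiableAt (by simp)) η).trans ?_
  rw [mfderiv_eq_fderiv, h𝓗.fderiv_eq hn hL hM hp hz]
  rfl

omit [FiniteDimensional ℝ E] [IsManifold 𝓘(ℝ, E) ∞ N] in
-- The cone contains the ray through `z`, and `z` is the velocity at time zero of `t ↦ (1 + t) z`.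
-- Together with `∂𝓗/∂p = Z` this is the reason for the first assertion of the theorem.
theorem mem_tangentDecomposable_self (hn : 1 ≤ n) {q : N} {z : MultiVec n E q}
    (hz : z ∈ decomposable n E q) : z ∈ tangentDecomposable z := by
  obtain ⟨v, rfl⟩ := hz
  refine ⟨fun t : ℝ => (1 + t) • wedge v, fun p => ?_, fun t => ?_, by simp, fun p => ?_⟩
  · exact (contDiff_const.add contDiff_id).mul contDiff_const
  · obtain ⟨w, hw⟩ := smul_altEval (E := E) hn (1 + t) v
    exact ⟨w, hw⟩
  · have : HasDerivAt (fun t : ℝ => (1 + t) * pairing (wedge v) p) (1 * pairing (wedge v) p) 0 :=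
      ((hasDerivAt_id (0 : ℝ)).const_add 1).mul_const _
    rwa [one_mul] at this

omit [FiniteDimensional ℝ E] [IsManifold 𝓘(ℝ, E) ∞ N] in
theorem pairing_conormal_self (hn : 1 ≤ n) {q : N} {z : MultiVec n E q}
    (hz : z ∈ decomposable n E q) {η : Form n E q} (hη : η ∈ conormal z) : pairing z η = 0 :=
  hη z (mem_tangentDecomposable_self hn hz)

theorem hasDerivAt_clm_apply_const {F G : Type*} [NormedAddCommGroup F] [NormedSpace ℝ F]
    [NormedAddCommGroup G] [NormedSpace ℝ G] {c : ℝ → F →L[ℝ] G} {c' : F →L[ℝ] G} {t : ℝ}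
    (h : HasDerivAt c c' t) (p : F) : HasDerivAt (fun t => c t p) (c' p) t := by
  simpa using h.clm_apply (hasDerivAt_const t p)

omit [IsManifold 𝓘(ℝ, E) ∞ N] in
/-- A conormal form annihilates the velocity of a smooth curve in the decomposable multivectors. -/
theorem hasDerivAt_pairing_conormal {q : N} {z : MultiVec n E q} {η : Form n E q}
    (hη : η ∈ conormal z) {c : ℝ → MultiVec n E q} (hc : IsSmoothCurve c)
    (hd : ∀ t, c t ∈ decomposable n E q) (h0 : c 0 = z) :
    HasDerivAt (fun t => pairing (c t) η) 0 0 := by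
  let c' : ℝ → (E [⋀^Fin n]→L[ℝ] ℝ) →L[ℝ] ℝ := c
  have hc' : ContDiff ℝ ∞ c' := contDiff_clm_apply_iff.2 hc
  have h1 : HasDerivAt c' (deriv c' 0) 0 := (hc'.differentiable (by simp) 0).hasDerivAt
  have h2 : ∀ p : E [⋀^Fin n]→L[ℝ] ℝ, HasDerivAt (fun t => c' t p) (deriv c' 0 p) 0 := fun p =>
    hasDerivAt_clm_apply_const h1 p
  have h3 : deriv c' 0 η = 0 := hη (deriv c' 0) ⟨c, hc, hd, h0, h2⟩
  have h4 := h2 η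
  rwa [h3] at h4

omit [IsManifold 𝓘(ℝ, E) ∞ N] in
-- The test curves run in the decomposable multivectors, so the additional term `⟨c t, η⟩` has
-- derivative zero at `t = 0`.
theorem legendreZ_add_conormal {q : N} {p η : Form n E q} {z : MultiVec n E q}
    (hz : z ∈ legendreZ vol L q p) (hη : η ∈ conormal z) : z ∈ legendreZ vol L q (p + η) := by
  refine ⟨hz.1, fun c hc hu h0 => ?_⟩
  have h1 := (hz.2 c hc hu h0).add (hasDerivAt_pairing_conormal hη hc (fun t => (hu t).1) h0)
  rw [add_zero] at h1
  refine h1.congr_of_eventuallyEq (Filter.Eventually.of_forall fun t => ?_)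
  change c t (p + η) - L q (c t) = c t p - L q (c t) + c t η
  rw [map_add]
  ring

/-- Both points have the Legendre image `z`, and `W` changes by `⟨z, η⟩ = 0`. The segment between
the points need not lie in `M`, since nothing is integrated. -/
theorem IsLegendreImage.add_conormal (h𝓗 : IsLegendreImage vol L M 𝓗) (hn : 1 ≤ n) {q : N}
    {p η : Form n E q} {z : MultiVec n E q} (hp : (⟨q, p⟩ : FormBundle n E N) ∈ M)
    (hpη : (⟨q, p + η⟩ : FormBundle n E N) ∈ M)
    (hz : z ∈ legendreZ vol L q p) (hη : η ∈ conormal z) :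
    𝓗 ⟨q, p + η⟩ = 𝓗 ⟨q, p⟩ := by
  rw [h𝓗.eq_W _ hpη z (legendreZ_add_conormal hz hη), h𝓗.eq_W _ hp z hz]
  change z (p + η) - L q z = z p - L q z
  rw [map_add, show z η = 0 from pairing_conormal_self hn hz.1.1 hη]
  simp

end Legendre

/-! ### Local flows on a manifold, for integral curves inside one chart -/

section ChartFlow

universe u

variable {V : Type u} [NormedAddCommGroup V] [NormedSpace ℝ V] {H : Type*} [TopologicalSpace H]
  {I : ModelWithCorners ℝ V H} [I.Boundaryless] {X : Type*} [TopologicalSpace X]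
  [ChartedSpace H X] [IsManifold I ∞ X]

/-- A vector field in the chart at `x₀`. -/
noncomputable def chartField (I : ModelWithCorners ℝ V H) (ξ : ∀ x : X, TangentSpace I x) (x₀ : X)
    (w : V) : V :=
  mfderiv I 𝓘(ℝ, V) (extChartAt I x₀) ((extChartAt I x₀).symm w) (ξ ((extChartAt I x₀).symm w))

/-- The part of the domain of the inverse chart at `x₀` that is mapped to `M`. -/
def chartDomain (I : ModelWithCorners ℝ V H) (x₀ : X) (M : Set X) : Set V :=
  (extChartAt I x₀).target ∩ (extChartAt I x₀).symm ⁻¹' M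

omit [IsManifold I ∞ X] in
theorem isOpen_chartDomain (x₀ : X) {M : Set X} (hM : IsOpen M) : IsOpen (chartDomain I x₀ M) :=
  (continuousOn_extChartAt_symm x₀).isOpen_inter_preimage (isOpen_extChartAt_target x₀) hM

omit [I.Boundaryless] in
theorem contDiffOn_chartField {ξ : ∀ x : X, TangentSpace I x} {M : Set X}
    (hξ : ContMDiffOn I I.tangent ∞ (fun x => (⟨x, ξ x⟩ : TangentBundle I X)) M) (x₀ : X) :
    ContDiffOn ℝ ∞ (chartField I ξ x₀) (chartDomain I x₀ M) := by
  have h1 : ContMDiffOn I 𝓘(ℝ, V) ∞ (fun x => (trivializationAt V (TangentSpace I) x₀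
      (⟨x, ξ x⟩ : TangentBundle I X)).2) ((extChartAt I x₀).source ∩ M) := fun x hx => by
    have hx1 : x ∈ (chartAt H x₀).source := by simpa using hx.1
    refine ((Trivialization.contMDiffWithinAt_iff (e := trivializationAt V (TangentSpace I) x₀)
      ?_).1 ((hξ x hx.2).mono inter_subset_right)).2
    rw [TangentBundle.trivializationAt_source]
    exact hx1
  have h2 := h1.comp ((contMDiffOn_extChartAt_symm (n := ∞) (I := I) x₀).mono
    (inter_subset_left (t := (extChartAt I x₀).symm ⁻¹' M)))
    (fun w hw => ⟨(extChartAt I x₀).map_target hw.1, hw.2⟩)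
  refine h2.contDiffOn.congr fun w hw => ?_
  have hw1 : (extChartAt I x₀).symm w ∈ (chartAt H x₀).source := by
    simpa using (extChartAt I x₀).map_target hw.1
  have h3 : chartField I ξ x₀ w = (trivializationAt V (TangentSpace I) x₀).continuousLinearMapAt ℝ
      ((extChartAt I x₀).symm w) (ξ ((extChartAt I x₀).symm w)) :=
    congrArg (fun L : TangentSpace I ((extChartAt I x₀).symm w) →L[ℝ] V =>
      L (ξ ((extChartAt I x₀).symm w)))
      (TangentBundle.continuousLinearMapAt_trivializationAt hw1).symm
  rw [h3, Trivialization.continuousLinearMapAt_apply, Trivialization.linearMapAt_apply, if_pos]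
  · rfl
  · rwa [TangentBundle.trivializationAt_baseSet]

omit [I.Boundaryless] in
theorem hasDerivWithinAt_extChartAt_comp {ξ : ∀ x : X, TangentSpace I x} {c : ℝ → X} {S : Set ℝ}
    {t : ℝ} {x₀ : X} (hc : HasMFDerivWithinAt 𝓘(ℝ, ℝ) I c S t
      ((1 : ℝ →L[ℝ] ℝ).smulRight (ξ (c t)))) (hs : c t ∈ (extChartAt I x₀).source) :
    HasDerivWithinAt (fun t => extChartAt I x₀ (c t)) (chartField I ξ x₀ (extChartAt I x₀ (c t)))
      S t := by
  have hs' : c t ∈ (chartAt H x₀).source := by simpa using hs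
  have h1 := (mdifferentiableAt_extChartAt (I := I) hs').hasMFDerivAt.comp_hasMFDerivWithinAt t hc
  have h2 : HasMFDerivWithinAt 𝓘(ℝ, ℝ) 𝓘(ℝ, V) (fun t => extChartAt I x₀ (c t)) S t
      (ContinuousLinearMap.toSpanSingleton ℝ
        (chartField I ξ x₀ (extChartAt I x₀ (c t))) : ℝ →L[ℝ] V) := by
    refine h1.congr_mfderiv (ContinuousLinearMap.ext fun a : ℝ => ?_)
    rw [chartField, (extChartAt I x₀).left_inv hs]
    exact (mfderiv I 𝓘(ℝ, V) (extChartAt I x₀) (c t)).map_smul a (ξ (c t))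
  exact h2.hasFDerivWithinAt

theorem hasMFDerivWithinAt_extChartAt_symm_comp {ξ : ∀ x : X, TangentSpace I x} {u : ℝ → V}
    {S : Set ℝ} {t : ℝ} {x₀ : X} (hu : HasDerivWithinAt u (chartField I ξ x₀ (u t)) S t)
    (hs : u t ∈ (extChartAt I x₀).target) :
    HasMFDerivWithinAt 𝓘(ℝ, ℝ) I (fun t => (extChartAt I x₀).symm (u t)) S t
      ((1 : ℝ →L[ℝ] ℝ).smulRight (ξ ((extChartAt I x₀).symm (u t)))) := by
  have h0 : MDifferentiableAt 𝓘(ℝ, V) I (extChartAt I x₀).symm (u t) :=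
    ((contMDiffOn_extChartAt_symm (n := ∞) (I := I) x₀).contMDiffAt
      ((isOpen_extChartAt_target x₀).mem_nhds hs)).mdifferentiableAt (by simp)
  have h1 := h0.hasMFDerivAt.comp_hasMFDerivWithinAt t hu.hasFDerivWithinAt.hasMFDerivWithinAt
  refine h1.congr_mfderiv ?_
  refine ContinuousLinearMap.ext fun a : ℝ => ?_
  have h3 : ∀ (B : V →L[ℝ] V) (v : V), B (a • v) = a • B v := fun B v => B.map_smul a v
  refine (h3 (mfderiv 𝓘(ℝ, V) I (extChartAt I x₀).symm (u t))
    (chartField I ξ x₀ (u t))).trans (congrArg (fun v : V => a • v) ?_)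
  rw [chartField]
  have h2 := mfderivWithin_extChartAt_symm_comp_mfderiv_extChartAt (I := I) (x := x₀) hs
  rw [I.range_eq_univ, mfderivWithin_univ] at h2
  exact congrArg (fun L : TangentSpace I ((extChartAt I x₀).symm (u t)) →L[ℝ]
    TangentSpace I ((extChartAt I x₀).symm (u t)) => L (ξ ((extChartAt I x₀).symm (u t)))) h2

/-- `m'` is the value at time `s` of an integral curve of `ξ` in `M` that starts in `m`. -/
def FlowRel (M : Set X) (ξ : ∀ x : X, TangentSpace I x) (s : ℝ) (m m' : X) : Prop :=
  ∃ c : ℝ → X, c 0 = m ∧ (∀ t ∈ uIcc 0 s, c t ∈ M) ∧ IsMIntegralCurveOn c ξ (uIcc 0 s) ∧ c s = m'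

omit [I.Boundaryless] [IsManifold I ∞ X] in
-- The same curve with its time translated by `s` leads back, so the inverse of a flow map is again
-- a flow map.
theorem FlowRel.symm {M : Set X} {ξ : ∀ x : X, TangentSpace I x} {s : ℝ} {m m' : X}
    (h : FlowRel M ξ s m m') : FlowRel M ξ (-s) m' m := by
  obtain ⟨c, h0, hM, hc, h1⟩ := h
  have key : ∀ t, t ∈ uIcc 0 (-s) ↔ t + s ∈ uIcc 0 s := fun t => by
    simp only [mem_uIcc]
    constructor <;> rintro (h | h) <;> [right; left; right; left] <;>
      constructor <;> linarith [h.1, h.2]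
  refine ⟨fun t => c (t + s), by simpa using h1, fun t ht => hM _ ((key t).1 ht), ?_,
    by simpa using h0⟩
  have h2 := hc.comp_add s
  have h3 : {t | t + s ∈ uIcc 0 s} = uIcc 0 (-s) := by
    ext t; exact (key t).symm
  have h4 : IsMIntegralCurveOn (c ∘ (· + s)) ξ (uIcc 0 (-s)) := h3 ▸ h2
  exact h4

omit [I.Boundaryless] [IsManifold I ∞ X] in
theorem flowRel_zero {M : Set X} {ξ : ∀ x : X, TangentSpace I x} {m : X} (hm : m ∈ M) :
    FlowRel M ξ 0 m m := by
  refine ⟨fun _ => m, rfl, fun _ _ => hm, fun t ht => ?_, rfl⟩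
  rw [uIcc_self] at ht ⊢
  refine ⟨continuousWithinAt_const, ?_⟩
  rw [mem_singleton_iff] at ht
  subst ht
  simp only [mfld_simps]
  change HasFDerivWithinAt _ _ ({(0 : ℝ)} : Set ℝ) (0 : ℝ)
  -- The time interval is the single point `0`, which is isolated in itself, so the derivative
  -- within it is arbitrary and the constant curve qualifies.
  refine HasFDerivWithinAt.of_not_accPt ?_
  rw [accPt_iff_clusterPt, Filter.inf_principal]
  simp [ClusterPt]

theorem mul_mem_uIcc_zero {s t : ℝ} (ht : t ∈ Icc (0 : ℝ) 1) : t * s ∈ uIcc 0 s := by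
  rw [mem_uIcc]
  rcases le_total 0 s with h | h
  · left; constructor <;> nlinarith [ht.1, ht.2]
  · right; constructor <;> nlinarith [ht.1, ht.2]

theorem div_mem_Icc {s t : ℝ} (hs : s ≠ 0) (ht : t ∈ uIcc 0 s) : t / s ∈ Icc (0 : ℝ) 1 := by
  rw [mem_uIcc] at ht
  rcases ht with h | h
  · have : 0 < s := lt_of_le_of_ne (h.1.trans h.2) hs.symm
    exact ⟨div_nonneg h.1 this.le, (div_le_one this).2 h.2⟩
  · have : s < 0 := lt_of_le_of_ne (h.1.trans h.2) hs
    exact ⟨div_nonneg_of_nonpos h.2 this.le, (div_le_one_of_neg this).2 h.1⟩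

omit [I.Boundaryless] in
-- Rescaling the time to `[0, 1]` and multiplying the field by `s` treats positive and negative
-- times alike.
theorem solvesODE_of_isMIntegralCurveOn {ξ : ∀ x : X, TangentSpace I x} {c : ℝ → X} {s : ℝ}
    {x₀ : X} (hc : IsMIntegralCurveOn c ξ (uIcc 0 s))
    (hs : ∀ t ∈ uIcc 0 s, c t ∈ (extChartAt I x₀).source) :
    SolvesODE (fun w => s • chartField I ξ x₀ w) (fun t => extChartAt I x₀ (c (t * s))) :=
  fun t ht => by
    have h1 := hasDerivWithinAt_extChartAt_comp (hc _ (mul_mem_uIcc_zero (s := s) ht))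
      (hs _ (mul_mem_uIcc_zero ht))
    exact h1.scomp t ((hasDerivAt_mul_const s).hasDerivWithinAt (s := Icc 0 1))
      fun t ht => mul_mem_uIcc_zero ht

theorem isMIntegralCurveOn_of_solvesODE {ξ : ∀ x : X, TangentSpace I x} {u : ℝ → V} {s : ℝ}
    (hs0 : s ≠ 0) {x₀ : X} (hu : SolvesODE (fun w => s • chartField I ξ x₀ w) u)
    (hs : ∀ t ∈ Icc (0 : ℝ) 1, u t ∈ (extChartAt I x₀).target) :
    IsMIntegralCurveOn (fun t => (extChartAt I x₀).symm (u (t / s))) ξ (uIcc 0 s) := fun t ht => by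
  have h1 := hu _ (div_mem_Icc hs0 ht)
  have h2 := h1.scomp t (((hasDerivAt_id t).div_const s).hasDerivWithinAt (s := uIcc 0 s))
    fun t ht => div_mem_Icc hs0 ht
  refine hasMFDerivWithinAt_extChartAt_symm_comp (u := fun t => u (t / s)) (h2.congr_deriv ?_)
    (hs _ (div_mem_Icc hs0 ht))
  simp [smul_smul, hs0]

variable [FiniteDimensional ℝ V]

/-- Curves inside one chart suffice for the application: the fields in question are vertical, and a
bundle chart contains whole fibres. -/
theorem flowRel_unique_of_mem_source {M : Set X} (hM : IsOpen M) {ξ : ∀ x : X, TangentSpace I x}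
    (hξ : ContMDiffOn I I.tangent ∞ (fun x => (⟨x, ξ x⟩ : TangentBundle I X)) M) {s : ℝ} {x₀ : X}
    {c₁ c₂ : ℝ → X} (h₁ : IsMIntegralCurveOn c₁ ξ (uIcc 0 s))
    (h₂ : IsMIntegralCurveOn c₂ ξ (uIcc 0 s))
    (hs₁ : ∀ t ∈ uIcc 0 s, c₁ t ∈ (extChartAt I x₀).source ∩ M)
    (hs₂ : ∀ t ∈ uIcc 0 s, c₂ t ∈ (extChartAt I x₀).source ∩ M) (h0 : c₁ 0 = c₂ 0) :
    c₁ s = c₂ s := by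
  have key : ∀ c : ℝ → X, (∀ t ∈ uIcc 0 s, c t ∈ (extChartAt I x₀).source ∩ M) →
      MapsTo (fun t => extChartAt I x₀ (c (t * s))) (Icc 0 1) (chartDomain I x₀ M) :=
    fun c hc t ht => by
      have h := hc _ (mul_mem_uIcc_zero (s := s) ht)
      refine ⟨(extChartAt I x₀).map_source h.1, ?_⟩
      rw [mem_preimage, (extChartAt I x₀).left_inv h.1]
      exact h.2
  have h := SolvesODE.unique (isOpen_chartDomain x₀ hM)
    (contDiffOn_const.smul (contDiffOn_chartField hξ x₀))
    (solvesODE_of_isMIntegralCurveOn h₁ fun t ht => (hs₁ t ht).1)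
    (solvesODE_of_isMIntegralCurveOn h₂ fun t ht => (hs₂ t ht).1) (key c₁ hs₁) (key c₂ hs₂)
    (by simp [h0])
  simp only [one_mul] at h
  exact (extChartAt I x₀).injOn (hs₁ s right_mem_uIcc).1 (hs₂ s right_mem_uIcc).1 h

theorem exists_local_flow_of_mem_source {M : Set X} (hM : IsOpen M)
    {ξ : ∀ x : X, TangentSpace I x}
    (hξ : ContMDiffOn I I.tangent ∞ (fun x => (⟨x, ξ x⟩ : TangentBundle I X)) M) {s : ℝ} {x₀ : X}
    {c : ℝ → X} (hc : IsMIntegralCurveOn c ξ (uIcc 0 s))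
    (hs : ∀ t ∈ uIcc 0 s, c t ∈ (extChartAt I x₀).source ∩ M) :
    ∃ O ∈ 𝓝 (c 0), ∃ φ : X → X, ContMDiffAt I I ∞ φ (c 0) ∧ ∀ x ∈ O, FlowRel M ξ s x (φ x) := by
  have h00 := hs 0 left_mem_uIcc
  rcases eq_or_ne s 0 with rfl | hs0
  · exact ⟨M, hM.mem_nhds h00.2, id, contMDiffAt_id, fun x hx => flowRel_zero hx⟩
  obtain ⟨O, hO, ψ, hψ, h⟩ := SolvesODE.exists_local_flow (isOpen_chartDomain x₀ hM)
    (contDiffOn_const.smul (contDiffOn_chartField hξ x₀))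
    (solvesODE_of_isMIntegralCurveOn hc fun t ht => (hs t ht).1) (fun t ht => by
      have h := hs _ (mul_mem_uIcc_zero (s := s) ht)
      refine ⟨(extChartAt I x₀).map_source h.1, ?_⟩
      rw [mem_preimage, (extChartAt I x₀).left_inv h.1]
      exact h.2)
  simp only [zero_mul] at hO
  have hcont : ContinuousAt (extChartAt I x₀) (c 0) := continuousAt_extChartAt' h00.1
  refine ⟨(extChartAt I x₀).source ∩ extChartAt I x₀ ⁻¹' O,
    Filter.inter_mem ((isOpen_extChartAt_source x₀).mem_nhds h00.1) (hcont hO),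
    fun x => (extChartAt I x₀).symm (ψ (extChartAt I x₀ x)), ?_, fun x hx => ?_⟩
  · obtain ⟨u, -, -, hu, hu1⟩ := h _ (mem_of_mem_nhds hO)
    have h1 : ψ (extChartAt I x₀ (c 0)) ∈ (extChartAt I x₀).target :=
      hu1 ▸ (hu (right_mem_Icc.2 zero_le_one)).1
    have h2 : ContMDiffAt I 𝓘(ℝ, V) ∞ (fun x => ψ (extChartAt I x₀ x)) (c 0) :=
      hψ.contMDiff.contMDiffAt.comp (c 0) (contMDiffAt_extChartAt' (by simpa using h00.1))
    exact ((contMDiffOn_extChartAt_symm x₀).contMDiffAt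
      ((isOpen_extChartAt_target x₀).mem_nhds h1)).comp (c 0) h2
  · obtain ⟨u, hu0, hu, hum, hu1⟩ := h _ hx.2
    refine ⟨fun t => (extChartAt I x₀).symm (u (t / s)), ?_, fun t ht => ?_, ?_, ?_⟩
    · simp only [zero_div, hu0]
      exact (extChartAt I x₀).left_inv hx.1
    · exact (hum (div_mem_Icc hs0 ht)).2
    · exact isMIntegralCurveOn_of_solvesODE hs0 hu fun t ht => (hum ht).1
    · simp only [div_self hs0, hu1]

end ChartFlow

theorem eq_of_hasDerivWithinAt_zero {W : Type*} [NormedAddCommGroup W] [NormedSpace ℝ W]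
    {f : ℝ → W} {a b : ℝ} (h : ∀ t ∈ uIcc a b, HasDerivWithinAt f 0 (uIcc a b) t) {t : ℝ}
    (ht : t ∈ uIcc a b) : f t = f a := by
  rcases eq_or_ne a b with rfl | hab
  · rw [uIcc_self, mem_singleton_iff] at ht
    rw [ht]
  refine (convex_uIcc a b).is_const_of_fderivWithin_eq_zero (𝕜 := ℝ)
    (fun t ht => (h t ht).differentiableWithinAt) (fun t ht => ?_) ht left_mem_uIcc
  have hu : UniqueDiffWithinAt ℝ (uIcc a b) t :=
    uniqueDiffOn_Icc (min_lt_max.2 hab) t ht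
  rw [(h t ht).hasFDerivWithinAt.fderivWithin hu]
  ext; simp

theorem IsMIntegralCurveOn.eq_of_mfderiv_eq_zero {V H X : Type*} [NormedAddCommGroup V]
    [NormedSpace ℝ V] [TopologicalSpace H] {I : ModelWithCorners ℝ V H} [TopologicalSpace X]
    [ChartedSpace H X] {ξ : ∀ x : X, TangentSpace I x} {c : ℝ → X} {s : ℝ}
    (hc : IsMIntegralCurveOn c ξ (uIcc 0 s)) {f : X → ℝ}
    (hf : ∀ t ∈ uIcc 0 s, MDifferentiableAt I 𝓘(ℝ, ℝ) f (c t))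
    (h0 : ∀ t ∈ uIcc 0 s, mfderiv I 𝓘(ℝ, ℝ) f (c t) (ξ (c t)) = 0) {t : ℝ} (ht : t ∈ uIcc 0 s) :
    f (c t) = f (c 0) := by
  refine eq_of_hasDerivWithinAt_zero (f := fun t => f (c t)) (fun t ht => ?_) ht
  have h1 := (hf t ht).hasMFDerivAt.comp_hasMFDerivWithinAt t (hc t ht)
  have h2 : HasMFDerivWithinAt 𝓘(ℝ, ℝ) 𝓘(ℝ, ℝ) (fun t => f (c t)) (uIcc 0 s) t
      (ContinuousLinearMap.toSpanSingleton ℝ (0 : ℝ) : ℝ →L[ℝ] ℝ) := by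
    refine h1.congr_mfderiv (ContinuousLinearMap.ext fun a : ℝ => ?_)
    refine ((mfderiv I 𝓘(ℝ, ℝ) f (c t)).map_smul a (ξ (c t))).trans ?_
    rw [h0 t ht]
    rfl
  exact h2.hasFDerivWithinAt

/-! ### Separation and countability of `Λⁿ T*N`, for the existence of cutoff functions -/

section Topology

variable {n : ℕ} {E : Type*} [NormedAddCommGroup E] [NormedSpace ℝ E] [FiniteDimensional ℝ E]
  {N : Type*} [TopologicalSpace N] [ChartedSpace E N] [IsManifold 𝓘(ℝ, E) ∞ N] [T2Space N]

/-- Points over different base points are separated in `N`; points over the same base point are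
separated by the fibre coordinate of one chart. -/
instance t2Space_formBundle : T2Space (FormBundle n E N) := by
  refine ⟨fun m m' hne => ?_⟩
  have hc : Continuous fun m : FormBundle n E N => m.proj :=
    (contMDiff_proj (n := ∞) (IB := 𝓘(ℝ, E)) (fun q : N => Form n E q)).continuous
  by_cases h : m.proj = m'.proj
  · have hU : IsOpen {x : FormBundle n E N | x.proj ∈ (chartAt E m.proj).source} :=
      (chartAt E m.proj).open_source.preimage hc
    have hf : ContinuousOn (formCoord m.proj)
        {x : FormBundle n E N | x.proj ∈ (chartAt E m.proj).source} := fun x hx =>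
      (contMDiffAt_formCoord hx).continuousAt.continuousWithinAt
    have hne' : formCoord m.proj m ≠ formCoord m.proj m' := fun he => by
      apply hne
      have h1 := coordForm_formCoord (q₀ := m.proj) (m := m) (mem_chart_source E _)
      have h2 := coordForm_formCoord (q₀ := m.proj) (m := m') (h ▸ mem_chart_source E _)
      obtain ⟨q, p⟩ := m
      obtain ⟨q', p'⟩ := m'
      obtain rfl : q = q' := h
      simp only at h1 h2 he
      rw [he, h2] at h1
      rw [h1]
    obtain ⟨A, B, hA, hB, hmA, hmB, hAB⟩ := t2_separation hne'
    refine ⟨_, _, hf.isOpen_inter_preimage hU hA, hf.isOpen_inter_preimage hU hB,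
      ⟨mem_chart_source E _, hmA⟩, ⟨h ▸ mem_chart_source E _, hmB⟩, ?_⟩
    exact (hAB.preimage _).mono inter_subset_right inter_subset_right
  · obtain ⟨A, B, hA, hB, hmA, hmB, hAB⟩ := t2_separation h
    exact ⟨_, _, hA.preimage hc, hB.preimage hc, hmA, hmB, hAB.preimage _⟩

variable [SecondCountableTopology N]

instance sigmaCompactSpace_formBundle : SigmaCompactSpace (FormBundle n E N) := by
  obtain ⟨s, hs, hsU⟩ := TopologicalSpace.countable_cover_nhds
    fun q : N => (chartAt E q).open_source.mem_nhds (mem_chart_source E q)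
  have hE : SecondCountableTopology E :=
    have := FiniteDimensional.proper_real E
    inferInstance
  have hF : SecondCountableTopology (E [⋀^Fin n]→L[ℝ] ℝ) :=
    have := FiniteDimensional.proper_real (E [⋀^Fin n]→L[ℝ] ℝ)
    inferInstance
  have hEF : SecondCountableTopology (ModelProd E (E [⋀^Fin n]→L[ℝ] ℝ)) :=
    inferInstanceAs (SecondCountableTopology (E × (E [⋀^Fin n]→L[ℝ] ℝ)))
  have : SecondCountableTopology (FormBundle n E N) := by
    refine ChartedSpace.secondCountable_of_countable_cover (ModelProd E (E [⋀^Fin n]→L[ℝ] ℝ))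
      (s := (fun q => fibreIncl n E q 0) '' s) ?_ (hs.image _)
    refine eq_univ_of_forall fun m => ?_
    obtain ⟨q, hq, hm⟩ := mem_iUnion₂.1 (hsU ▸ mem_univ m.proj)
    refine mem_iUnion₂.2 ⟨fibreIncl n E q 0, mem_image_of_mem _ hq, ?_⟩
    rw [← extChartAt_source (formModel n E)]
    exact mem_chartAt_formBundle_source_iff.2 hm
  have : LocallyCompactSpace (FormBundle n E N) :=
    Manifold.locallyCompact_of_finiteDimensional (formModel n E)
  infer_instance

end Topology

/-! ### Integral curves of fields in the pseudofibre directions -/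

section FibreFlow

variable {n : ℕ} {E : Type*} [NormedAddCommGroup E] [NormedSpace ℝ E] [FiniteDimensional ℝ E]
  {N : Type*} [TopologicalSpace N] [ChartedSpace E N] [IsManifold 𝓘(ℝ, E) ∞ N]
  {vol : ∀ q : N, Form n E q} {L : ∀ q : N, MultiVec n E q → ℝ} {M : Set (FormBundle n E N)}
  {𝓗 : FormBundle n E N → ℝ}

omit [FiniteDimensional ℝ E] in
theorem eq_fibreIncl {m : FormBundle n E N} {q : N} (h : m.proj = q) :
    m = fibreIncl n E q (formCoord q m) := by
  obtain ⟨q', p⟩ := m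
  obtain rfl : q' = q := h
  exact congrArg (fibreIncl n E q') (formCoord_self (E := E) q' p).symm

omit [FiniteDimensional ℝ E] in
theorem exists_mem_pseudofiberDirection {ξ : ∀ m : FormBundle n E N, TangentSpace (formModel n E) m}
    (hξ : ∀ m ∈ M, ξ m ∈ pseudofiberDirection vol L m) {q : N} {p : E [⋀^Fin n]→L[ℝ] ℝ}
    (hm : fibreIncl n E q p ∈ M) : ∃ z : (E [⋀^Fin n]→L[ℝ] ℝ) →L[ℝ] ℝ, z ∈ legendreZ vol L q p ∧
      ∃ η : E [⋀^Fin n]→L[ℝ] ℝ, η ∈ conormal (q := q) z ∧ ξ (fibreIncl n E q p) = verticalLift (fibreIncl n E q p) η :=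
  hξ _ hm

/-- A function lifted from `N` has zero derivative along a vertical field. A smooth function on `N`
that separates two base points of the curve would thus be constant along it. A global function is
used because the curve is not yet known to stay in a chart. -/
theorem IsMIntegralCurveOn.proj_eq [T2Space N] [SecondCountableTopology N]
    {ξ : ∀ m : FormBundle n E N, TangentSpace (formModel n E) m}
    (hξ : ∀ m ∈ M, ξ m ∈ pseudofiberDirection vol L m) {c : ℝ → FormBundle n E N} {s : ℝ}
    (hc : IsMIntegralCurveOn c ξ (uIcc 0 s)) (hM : ∀ t ∈ uIcc 0 s, c t ∈ M) {t : ℝ}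
    (ht : t ∈ uIcc 0 s) : (c t).proj = (c 0).proj := by
  by_contra hne
  have : LocallyCompactSpace N := Manifold.locallyCompact_of_finiteDimensional 𝓘(ℝ, E)
  obtain ⟨f, hf0, hf1, -⟩ := exists_contMDiffMap_zero_one_of_isClosed (n := (⊤ : ℕ∞)) 𝓘(ℝ, E)
    (isClosed_singleton (x := (c t).proj)) (isClosed_singleton (x := (c 0).proj))
    (disjoint_singleton.2 hne)
  have hfd : MDifferentiable 𝓘(ℝ, E) 𝓘(ℝ, ℝ) f := f.contMDiff.mdifferentiable (by simp)
  have hpd : MDifferentiable (formModel n E) 𝓘(ℝ, E) (fun m : FormBundle n E N => m.proj) :=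
    (contMDiff_proj _).mdifferentiable (n := ∞) (by simp)
  have h := IsMIntegralCurveOn.eq_of_mfderiv_eq_zero hc (f := fun m => f m.proj)
    (fun t _ => (hfd _).comp _ (hpd _)) (fun t ht => ?_) ht
  · rw [hf0 (mem_singleton _), hf1 (mem_singleton _)] at h
    simp at h
  · obtain ⟨z, -, η, -, h⟩ := hξ _ (hM t ht)
    rw [h]
    have h1 := mfderiv_comp (c t) (hfd (c t).proj) (hpd (c t))
    have h2 := congrArg (fun B : E × (E [⋀^Fin n]→L[ℝ] ℝ) →L[ℝ] ℝ => B (verticalLift (c t) η)) h1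
    refine h2.trans ?_
    change mfderiv 𝓘(ℝ, E) 𝓘(ℝ, ℝ) f (c t).proj (mfderiv (formModel n E) 𝓘(ℝ, E)
      (fun m : FormBundle n E N => m.proj) (c t) (verticalLift (c t) η)) = 0
    rw [show mfderiv (formModel n E) 𝓘(ℝ, E)
      (fun m : FormBundle n E N => m.proj) (c t) (verticalLift (c t) η) = 0 from
      mfderiv_proj_verticalLift (n := n) (E := E) (c t).proj (c t).snd η]
    exact map_zero _

omit [FiniteDimensional ℝ E] in
theorem chartField_extChartAt_of_eq_verticalLift
    {ξ : ∀ m : FormBundle n E N, TangentSpace (formModel n E) m} (m₀ : FormBundle n E N) {q : N}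
    (hq : q ∈ (chartAt E m₀.proj).source) {p η : E [⋀^Fin n]→L[ℝ] ℝ}
    (h : ξ (fibreIncl n E q p) = verticalLift (fibreIncl n E q p) η) :
    chartField (formModel n E) ξ m₀ (extChartAt (formModel n E) m₀ (fibreIncl n E q p)) =
      (0, formCoord m₀.proj (fibreIncl n E q η)) := by
  have hs : fibreIncl n E q p ∈ (extChartAt (formModel n E) m₀).source :=
    mem_chartAt_formBundle_source_iff.2 hq
  rw [chartField, (extChartAt (formModel n E) m₀).left_inv hs, h]
  exact mfderiv_extChartAt_verticalLift m₀ hq p η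

omit [FiniteDimensional ℝ E] [IsManifold 𝓘(ℝ, E) ∞ N] in
theorem smul_mem_conormal {q : N} {z : MultiVec n E q} {η : Form n E q} (h : η ∈ conormal z)
    (t : ℝ) : t • η ∈ conormal z := fun ζ hζ => by
  have := h ζ hζ
  rw [pairing] at this ⊢
  rw [map_smul, this]
  exact smul_zero t

/-- Along an integral curve of a field in the pseudofibre directions, the Legendre image does not
change and the momentum moves in the conormal direction. -/
theorem IsLegendreImage.exists_conormal_of_isMIntegralCurveOn [T2Space N]
    [SecondCountableTopology N] (h𝓗 : IsLegendreImage vol L M 𝓗) (hn : 1 ≤ n)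
    (hL : IsSmoothLagrangian vol L) (hM : IsOpen M)
    {ξ : ∀ m : FormBundle n E N, TangentSpace (formModel n E) m}
    (hξ : ∀ m ∈ M, ξ m ∈ pseudofiberDirection vol L m) {c : ℝ → FormBundle n E N} {s : ℝ}
    (hc : IsMIntegralCurveOn c ξ (uIcc 0 s)) (hcM : ∀ t ∈ uIcc 0 s, c t ∈ M) :
    ∃ η : Form n E (c 0).proj, c s = ⟨(c 0).proj, (c 0).snd + η⟩ ∧
      ∃ z ∈ legendreZ vol L (c 0).proj (c 0).snd, η ∈ conormal z := by
  let q := (c 0).proj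
  let P : ℝ → E [⋀^Fin n]→L[ℝ] ℝ := fun t => formCoord q (c t)
  have hcP : ∀ t ∈ uIcc 0 s, c t = fibreIncl n E q (P t) := fun t ht =>
    eq_fibreIncl (IsMIntegralCurveOn.proj_eq hξ hc hcM ht)
  have hPM : ∀ t ∈ uIcc 0 s, fibreIncl n E q (P t) ∈ M := fun t ht => hcP t ht ▸ hcM t ht
  choose! Z hZ X hX hξX using fun t ht => exists_mem_pseudofiberDirection hξ (hPM t ht)
  have hq : q ∈ (chartAt E (c 0).proj).source := mem_chart_source E _
  have hP : ∀ t ∈ uIcc 0 s, HasDerivWithinAt P (X t) (uIcc 0 s) t := fun t ht => by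
    have hs : c t ∈ (extChartAt (formModel n E) (c 0)).source := by
      rw [hcP t ht]; exact mem_chartAt_formBundle_source_iff.2 hq
    have h1 := hasDerivWithinAt_extChartAt_comp (hc t ht) hs
    have h2 : chartField (formModel n E) ξ (c 0) (extChartAt (formModel n E) (c 0) (c t)) =
        ((0 : E), X t) := by
      have h3 := chartField_extChartAt_of_eq_verticalLift (c 0) hq (hξX t ht)
      rw [← hcP t ht] at h3
      rw [h3]
      exact congrArg (Prod.mk _) (formCoord_self (E := E) q (X t))
    rw [h2] at h1
    have h4 := (ContinuousLinearMap.snd ℝ E (E [⋀^Fin n]→L[ℝ] ℝ)).hasFDerivAt.comp_hasDerivWithinAt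
      t h1
    refine h4.congr (fun t ht => ?_) ?_
    · change _ = (extChartAt (formModel n E) (c 0) (c t)).2
      rw [extChartAt_formBundle _ _ (by rw [hcP t ht]; exact hq)]
    · change _ = (extChartAt (formModel n E) (c 0) (c t)).2
      rw [extChartAt_formBundle _ _ (by rw [hcP t ht]; exact hq)]
  let h : (E [⋀^Fin n]→L[ℝ] ℝ) → ℝ := fun p => 𝓗 (fibreIncl n E q p)
  have hMq : IsOpen (fibreIncl n E q ⁻¹' M) := isOpen_fibreIncl_preimage hM q
  have hh : ContDiffOn ℝ ∞ h (fibreIncl n E q ⁻¹' M) := contDiffOn_fibreIncl h𝓗.smooth q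
  -- Here `Z t = fderiv ℝ h (P t)`, so its derivative in `t` is the second derivative of `h` in the
  -- direction `X t`. This is computed on the straight line `P t + τ • X t`, along which the
  -- Legendre image, and with it `fderiv ℝ h`, stays equal to `Z t` because `X t` is conormal.
  have hZt : ∀ t ∈ uIcc 0 s, Z t = Z 0 := fun t ht => by
    have h0 : (0 : ℝ) ∈ uIcc 0 s := left_mem_uIcc
    have key : ∀ e : E [⋀^Fin n]→L[ℝ] ℝ, fderiv ℝ h (P t) e = fderiv ℝ h (P 0) e := fun e => by
      refine eq_of_hasDerivWithinAt_zero (f := fun t => fderiv ℝ h (P t) e) (fun t ht => ?_) ht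
      have hd : DifferentiableAt ℝ (fun p => fderiv ℝ h p e) (P t) :=
        (((hh.fderiv_of_isOpen (m := ∞) hMq (by simp)).contDiffAt
          (hMq.mem_nhds (hPM t ht))).differentiableAt (by simp)).clm_apply
          (differentiableAt_const e)
      have hl : HasDerivAt (fun τ : ℝ => P t + τ • X t) (X t) 0 := by
        simpa using ((hasDerivAt_id (0 : ℝ)).smul_const (X t)).const_add (P t)
      have hd' : HasFDerivAt (fun p => fderiv ℝ h p e) (fderiv ℝ (fun p => fderiv ℝ h p e) (P t))
          (P t + (0 : ℝ) • X t) := by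
        simpa using hd.hasFDerivAt
      have h1 := hd'.comp_hasDerivAt (0 : ℝ) hl
      have h2 : HasDerivAt ((fun p => fderiv ℝ h p e) ∘ fun τ : ℝ => P t + τ • X t) 0 0 := by
        refine (hasDerivAt_const (0 : ℝ) (Z t e)).congr_of_eventuallyEq ?_
        have h3 : ∀ᶠ τ : ℝ in 𝓝 0, P t + τ • X t ∈ fibreIncl n E q ⁻¹' M :=
          hl.continuousAt.eventually (hMq.mem_nhds (by simpa using hPM t ht))
        filter_upwards [h3] with τ hτ
        have h4 := smul_mem_conormal (hX t ht) τ
        exact congrArg (fun B : (E [⋀^Fin n]→L[ℝ] ℝ) →L[ℝ] ℝ => B e)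
          (h𝓗.fderiv_eq hn hL hM hτ (legendreZ_add_conormal (hZ t ht) h4))
      have h5 := hd.hasFDerivAt.comp_hasDerivWithinAt t (hP t ht)
      rw [h1.unique h2] at h5
      exact h5
    rw [← h𝓗.fderiv_eq hn hL hM (hPM t ht) (hZ t ht), ← h𝓗.fderiv_eq hn hL hM (hPM 0 h0) (hZ 0 h0)]
    exact ContinuousLinearMap.ext key
  have h0 : (0 : ℝ) ∈ uIcc 0 s := left_mem_uIcc
  have hs : s ∈ uIcc 0 s := right_mem_uIcc
  have hP0 : P 0 = (c 0).snd := formCoord_self (E := E) (c 0).proj (c 0).snd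
  refine ⟨P s - P 0, ?_, Z 0, hP0 ▸ hZ 0 h0, fun ζ hζ => ?_⟩
  · rw [hcP s hs, ← hP0]
    exact congrArg (fibreIncl n E q) (add_sub_cancel (P 0) (P s)).symm
  · let ζ' : (E [⋀^Fin n]→L[ℝ] ℝ) →L[ℝ] ℝ := ζ
    -- All velocities `X t` lie in the conormal space of the same `Z 0`, hence so does the total
    -- displacement.
    have h1 : ζ' (P s) = ζ' (P 0) := by
      refine eq_of_hasDerivWithinAt_zero (f := fun t => ζ' (P t)) (fun t ht => ?_) hs
      have h2 := ζ'.hasFDerivAt.comp_hasDerivWithinAt t (hP t ht)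
      have h3 : ζ' (X t) = 0 := by
        have := hX t ht
        rw [hZt t ht] at this
        exact this ζ hζ
      rw [h3] at h2
      exact h2
    change ζ' (P s - P 0) = 0
    rw [map_sub, h1, sub_self]

end FibreFlow

/-! ### The flow as a pair of mutually inverse conormal shifts -/

section ConormalShift

variable {n : ℕ} {E : Type*} [NormedAddCommGroup E] [NormedSpace ℝ E] [FiniteDimensional ℝ E]
  {N : Type*} [TopologicalSpace N] [ChartedSpace E N] [IsManifold 𝓘(ℝ, E) ∞ N]
  {vol : ∀ q : N, Form n E q} {L : ∀ q : N, MultiVec n E q → ℝ} {M : Set (FormBundle n E N)}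
  {𝓗 : FormBundle n E N → ℝ}

/-- The fibre preserving map with fibre component `g`. -/
def fibreMap (g : ∀ m : FormBundle n E N, Form n E m.proj) (m : FormBundle n E N) :
    FormBundle n E N := ⟨m.proj, g m⟩

variable (vol L M) in
/-- A smooth fibre preserving map of an open subset `D` of `M` to `M` that moves the momentum in
the conormal direction of the Legendre image. -/
structure IsConormalShift (D : Set (FormBundle n E N))
    (g : ∀ m : FormBundle n E N, Form n E m.proj) : Prop where
  isOpen : IsOpen D
  subset : D ⊆ M
  mapsTo : MapsTo (fibreMap g) D M
  smooth : ContMDiffOn (formModel n E) (formModel n E) ∞ (fibreMap g) D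
  conormal : ∀ m ∈ D, ∃ z ∈ legendreZ vol L m.proj m.snd, g m - m.snd ∈ conormal z

variable (vol L M) in
/-- Two mutually inverse conormal shifts. -/
structure IsConormalShiftPair (D D' : Set (FormBundle n E N))
    (g g' : ∀ m : FormBundle n E N, Form n E m.proj) : Prop where
  left : IsConormalShift vol L M D g
  right : IsConormalShift vol L M D' g'
  mapsTo : MapsTo (fibreMap g) D D'
  mapsTo' : MapsTo (fibreMap g') D' D
  leftInv : ∀ m ∈ D, fibreMap g' (fibreMap g m) = m
  rightInv : ∀ m ∈ D', fibreMap g (fibreMap g' m) = m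

omit [FiniteDimensional ℝ E] in
theorem IsConormalShiftPair.symm {D D' : Set (FormBundle n E N)}
    {g g' : ∀ m : FormBundle n E N, Form n E m.proj} (h : IsConormalShiftPair vol L M D D' g g') :
    IsConormalShiftPair vol L M D' D g' g :=
  ⟨h.right, h.left, h.mapsTo', h.mapsTo, h.rightInv, h.leftInv⟩

theorem IsConormalShift.hamiltonian_eq {D : Set (FormBundle n E N)}
    {g : ∀ m : FormBundle n E N, Form n E m.proj} (h : IsConormalShift vol L M D g)
    (h𝓗 : IsLegendreImage vol L M 𝓗) (hn : 1 ≤ n) {m : FormBundle n E N} (hm : m ∈ D) :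
    𝓗 (fibreMap g m) = 𝓗 m := by
  obtain ⟨z, hz, hη⟩ := h.conormal m hm
  have h1 : fibreMap g m = ⟨m.proj, m.snd + (g m - m.snd)⟩ := by
    rw [add_sub_cancel]; rfl
  have h2 := h.mapsTo hm
  rw [h1] at h2 ⊢
  exact h𝓗.add_conormal hn (h.subset hm) h2 hz hη

theorem IsConormalShift.legendreZ_mem {D : Set (FormBundle n E N)}
    {g : ∀ m : FormBundle n E N, Form n E m.proj} (h : IsConormalShift vol L M D g)
    {m : FormBundle n E N} (hm : m ∈ D) : ∃ z, z ∈ legendreZ vol L m.proj m.snd ∧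
      z ∈ legendreZ vol L m.proj (g m) ∧ g m - m.snd ∈ LepageDedecker.conormal z := by
  obtain ⟨z, hz, hη⟩ := h.conormal m hm
  refine ⟨z, hz, ?_, hη⟩
  have := legendreZ_add_conormal hz hη
  rwa [add_sub_cancel] at this

variable [T2Space N] [SecondCountableTopology N]

section Flow

variable {ξ : ∀ m : FormBundle n E N, TangentSpace (formModel n E) m}

theorem flowRel_unique (hM : IsOpen M)
    (hξs : ContMDiffOn (formModel n E) (formModel n E).tangent ∞
      (fun m => (⟨m, ξ m⟩ : TangentBundle (formModel n E) (FormBundle n E N))) M)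
    (hξ : ∀ m ∈ M, ξ m ∈ pseudofiberDirection vol L m) {s : ℝ} {m m₁ m₂ : FormBundle n E N}
    (h₁ : FlowRel M ξ s m m₁) (h₂ : FlowRel M ξ s m m₂) : m₁ = m₂ := by
  obtain ⟨c₁, h10, h1M, h1c, rfl⟩ := h₁
  obtain ⟨c₂, h20, h2M, h2c, rfl⟩ := h₂
  refine flowRel_unique_of_mem_source (x₀ := m) hM hξs h1c h2c (fun t ht => ⟨?_, h1M t ht⟩)
    (fun t ht => ⟨?_, h2M t ht⟩) (h10.trans h20.symm) <;>
  rw [mem_chartAt_formBundle_source_iff]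
  · rw [IsMIntegralCurveOn.proj_eq hξ h1c h1M ht, h10]
    exact mem_chart_source E _
  · rw [IsMIntegralCurveOn.proj_eq hξ h2c h2M ht, h20]
    exact mem_chart_source E _

theorem FlowRel.exists_local (hM : IsOpen M)
    (hξs : ContMDiffOn (formModel n E) (formModel n E).tangent ∞
      (fun m => (⟨m, ξ m⟩ : TangentBundle (formModel n E) (FormBundle n E N))) M)
    (hξ : ∀ m ∈ M, ξ m ∈ pseudofiberDirection vol L m) {s : ℝ} {m m₁ : FormBundle n E N}
    (h : FlowRel M ξ s m m₁) : ∃ O ∈ 𝓝 m, ∃ φ : FormBundle n E N → FormBundle n E N,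
      ContMDiffAt (formModel n E) (formModel n E) ∞ φ m ∧ ∀ x ∈ O, FlowRel M ξ s x (φ x) := by
  obtain ⟨c, rfl, hcM, hc, rfl⟩ := h
  refine exists_local_flow_of_mem_source (x₀ := c 0) hM hξs hc fun t ht => ⟨?_, hcM t ht⟩
  rw [mem_chartAt_formBundle_source_iff, IsMIntegralCurveOn.proj_eq hξ hc hcM ht]
  exact mem_chart_source E _

theorem FlowRel.exists_conormal (h𝓗 : IsLegendreImage vol L M 𝓗) (hn : 1 ≤ n)
    (hL : IsSmoothLagrangian vol L) (hM : IsOpen M)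
    (hξ : ∀ m ∈ M, ξ m ∈ pseudofiberDirection vol L m) {s : ℝ} {m m₁ : FormBundle n E N}
    (h : FlowRel M ξ s m m₁) : ∃ p : Form n E m.proj, m₁ = ⟨m.proj, p⟩ ∧
      ∃ z ∈ legendreZ vol L m.proj m.snd, p - m.snd ∈ conormal z := by
  obtain ⟨c, rfl, hcM, hc, rfl⟩ := h
  obtain ⟨η, h1, z, hz, hη⟩ := h𝓗.exists_conormal_of_isMIntegralCurveOn hn hL hM hξ hc hcM
  refine ⟨_, h1, z, hz, ?_⟩
  rwa [add_sub_cancel_left]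

omit [FiniteDimensional ℝ E] [T2Space N] [SecondCountableTopology N] in
theorem FlowRel.mem_left {s : ℝ} {m m₁ : FormBundle n E N} (h : FlowRel M ξ s m m₁) : m ∈ M := by
  obtain ⟨c, rfl, hcM, -, -⟩ := h
  exact hcM 0 left_mem_uIcc

/-- The domain `D` consists of the points whose integral curve in `M` lasts until time `s`; the
inverse is the flow for time `-s`. Off the domain the fibre component is chosen as the momentum
itself, which is immaterial. The flow image involves only the points of `D`, so `s` need not be
small. -/
theorem exists_isConormalShiftPair (h𝓗 : IsLegendreImage vol L M 𝓗) (hn : 1 ≤ n)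
    (hL : IsSmoothLagrangian vol L) (hM : IsOpen M)
    (hξs : ContMDiffOn (formModel n E) (formModel n E).tangent ∞
      (fun m => (⟨m, ξ m⟩ : TangentBundle (formModel n E) (FormBundle n E N))) M)
    (hξ : ∀ m ∈ M, ξ m ∈ pseudofiberDirection vol L m) (s : ℝ) :
    ∃ D D' g g', IsConormalShiftPair vol L M D D' g g' ∧
      ∀ Γ, flowImage M ξ s Γ = fibreMap g '' (Γ ∩ D) := by
  have key : ∀ s : ℝ, ∃ g : ∀ m : FormBundle n E N, Form n E m.proj,
      ∀ m m₁, FlowRel M ξ s m m₁ → fibreMap g m = m₁ := fun s => by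
    have h : ∀ m : FormBundle n E N, ∃ p : Form n E m.proj, ∀ m₁, FlowRel M ξ s m m₁ →
        (⟨m.proj, p⟩ : FormBundle n E N) = m₁ := fun m => by
      by_cases hm : ∃ m₁, FlowRel M ξ s m m₁
      · obtain ⟨m₁, hm₁⟩ := hm
        obtain ⟨p, hp, -⟩ := hm₁.exists_conormal h𝓗 hn hL hM hξ
        exact ⟨p, fun m₂ hm₂ => hp ▸ flowRel_unique hM hξs hξ hm₁ hm₂⟩
      · exact ⟨m.snd, fun m₁ hm₁ => absurd ⟨m₁, hm₁⟩ hm⟩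
    choose g hg using h
    exact ⟨g, hg⟩
  choose g hg using key
  let D : ℝ → Set (FormBundle n E N) := fun s => {m | ∃ m₁, FlowRel M ξ s m m₁}
  have hrel : ∀ s, ∀ m ∈ D s, FlowRel M ξ s m (fibreMap (g s) m) := fun s m hm => by
    obtain ⟨m₁, h⟩ := hm
    rwa [hg s m m₁ h]
  have hmaps : ∀ s, ∀ m ∈ D s, FlowRel M ξ (-s) (fibreMap (g s) m) m := fun s m hm =>
    (hrel s m hm).symm
  have hshift : ∀ s, IsConormalShift vol L M (D s) (g s) := fun s => by
    refine ⟨isOpen_iff_mem_nhds.2 fun m ⟨m₁, h⟩ => ?_, fun m ⟨m₁, h⟩ => h.mem_left,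
      fun m hm => (hmaps s m hm).mem_left, fun m hm => ?_, fun m hm => ?_⟩
    · obtain ⟨O, hO, φ, -, h1⟩ := h.exists_local hM hξs hξ
      filter_upwards [hO] with x hx using ⟨_, h1 x hx⟩
    · obtain ⟨O, hO, φ, hφ, h1⟩ := (hrel s m hm).exists_local hM hξs hξ
      refine (hφ.congr_of_eventuallyEq ?_).contMDiffWithinAt
      filter_upwards [hO] with x hx using hg s x _ (h1 x hx)
    · obtain ⟨p, hp, h1⟩ := (hrel s m hm).exists_conormal h𝓗 hn hL hM hξ
      have h2 : g s m = p := by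
        have h3 : (⟨m.proj, g s m⟩ : FormBundle n E N) = ⟨m.proj, p⟩ := hp
        simpa using h3
      rwa [h2]
  refine ⟨D s, D (-s), g s, g (-s), ⟨hshift s, hshift (-s), fun m hm => ⟨m, hmaps s m hm⟩,
    fun m hm => ⟨m, ?_⟩, fun m hm => hg _ _ _ (hmaps s m hm), fun m hm => hg _ _ _ ?_⟩,
    fun Γ => ?_⟩
  · simpa using hmaps (-s) m hm
  · simpa using hmaps (-s) m hm
  · ext m'
    constructor
    · rintro ⟨c, h0, hcM, hc, h1⟩
      have h : FlowRel M ξ s (c 0) m' := ⟨c, rfl, hcM, hc, h1⟩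
      exact ⟨c 0, ⟨h0, m', h⟩, hg _ _ _ h⟩
    · rintro ⟨m, ⟨hm, hmD⟩, rfl⟩
      obtain ⟨c, h0, hcM, hc, h1⟩ := hrel s m hmD
      exact ⟨c, h0.symm ▸ hm, hcM, hc, h1⟩

end Flow

end ConormalShift

/-! ### Differentiation of the action under the integral sign -/

open MeasureTheory in
/-- Differentiation under the integral sign for a smooth integrand with a compactly supported
weight. -/
theorem hasDerivAt_setIntegral_mul {A : Type*} [NormedAddCommGroup A] [NormedSpace ℝ A]
    [FiniteDimensional ℝ A] [MeasurableSpace A] [BorelSpace A] {μ : Measure A}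
    [IsFiniteMeasureOnCompacts μ] {U C : Set A} (hU : IsOpen U) (hC : IsCompact C) (hCU : C ⊆ U)
    {w : A → ℝ} (hw : ContinuousOn w C) (hw0 : ∀ x ∈ U, x ∉ C → w x = 0) {a : ℝ → A → ℝ}
    (ha : ∀ x ∈ C, ContDiffAt ℝ ∞ (fun z : ℝ × A => a z.1 z.2) (0, x)) :
    HasDerivAt (fun σ => ∫ x in U, w x * a σ x ∂μ)
      (∫ x in U, w x * deriv (fun σ => a σ x) 0 ∂μ) 0 := by
  have hred : ∀ f : A → ℝ, ∫ x in U, w x * f x ∂μ = ∫ x in C, w x * f x ∂μ := fun f =>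
    setIntegral_eq_of_subset_of_forall_sdiff_eq_zero hU.measurableSet hCU fun x hx => by
      rw [hw0 x hx.1 hx.2, zero_mul]
  simp only [hred]
  let F : ℝ × A → ℝ := fun z => a z.1 z.2
  let W : Set (ℝ × A) := interior {z | ContDiffAt ℝ 1 F z}
  have hW : ∀ z ∈ W, ContDiffAt ℝ 1 F z := fun z hz => interior_subset hz
  have h0W : ({0} : Set ℝ) ×ˢ C ⊆ W := by
    rintro ⟨σ, x⟩ ⟨hσ, hx⟩
    obtain rfl : σ = 0 := hσ
    exact mem_interior_iff_mem_nhds.2 (((ha x hx).of_le (by simp)).eventually (by simp))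
  -- The integrand is `C¹` near each point of `{0} × C`. By the tube lemma one `δ` serves all of the
  -- compact set `C`, and the derivative is bounded on `[-δ, δ] × C`, which gives a dominating
  -- function.
  obtain ⟨u, v, hu, -, h0u, hCv, huv⟩ := generalized_tube_lemma isCompact_singleton hC
    isOpen_interior h0W
  obtain ⟨δ, hδ, hδu⟩ := Metric.nhds_basis_closedBall.mem_iff.1
    (hu.mem_nhds (h0u (mem_singleton 0)))
  have hKW : Metric.closedBall (0 : ℝ) δ ×ˢ C ⊆ W := fun z hz => huv ⟨hδu hz.1, hCv hz.2⟩
  let G : ℝ × A → ℝ := fun z => fderiv ℝ F z (1, 0)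
  have hG : ContinuousOn G W := fun z hz =>
    (((hW z hz).fderiv_right (m := 0) (by simp)).continuousAt.clm_apply
      continuousAt_const).continuousWithinAt
  have hF : ContinuousOn F W := fun z hz => (hW z hz).continuousAt.continuousWithinAt
  obtain ⟨B, hB⟩ := ((isCompact_closedBall (0 : ℝ) δ).prod hC).exists_bound_of_continuousOn
    (hG.mono hKW)
  have hder : ∀ z ∈ W, HasDerivAt (fun σ => a σ z.2) (G z) z.1 := fun z hz => by
    have h1 : HasFDerivAt F (fderiv ℝ F z) (z.1, z.2) :=
      ((hW z hz).differentiableAt (by simp)).hasFDerivAt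
    exact h1.comp_hasDerivAt z.1 ((hasDerivAt_id z.1).prodMk (hasDerivAt_const z.1 z.2))
  have hslice : ∀ σ ∈ Metric.closedBall (0 : ℝ) δ, MapsTo (fun x => (σ, x)) C W := fun σ hσ x hx =>
    hKW ⟨hσ, hx⟩
  have hcs : ∀ σ : ℝ, ContinuousOn (fun x : A => (σ, x)) C := fun σ => by fun_prop
  have h0 : (0 : ℝ) ∈ Metric.closedBall (0 : ℝ) δ := Metric.mem_closedBall_self hδ.le
  have hmain := hasDerivAt_integral_of_dominated_loc_of_deriv_le (μ := μ.restrict C)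
    (F := fun σ x => w x * a σ x) (F' := fun σ x => w x * G (σ, x)) (x₀ := 0)
    (s := Metric.closedBall 0 δ) (bound := fun x => ‖w x‖ * B) (Metric.closedBall_mem_nhds 0 hδ)
    (Filter.mem_of_superset (Metric.closedBall_mem_nhds 0 hδ) fun σ hσ =>
      (hw.mul (hF.comp (hcs σ) (hslice σ hσ))).aestronglyMeasurable hC.measurableSet)
    ((hw.mul (hF.comp (hcs 0) (hslice 0 h0))).integrableOn_compact hC)
    ((hw.mul (hG.comp (hcs 0) (hslice 0 h0))).aestronglyMeasurable hC.measurableSet)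
    ((ae_restrict_iff' hC.measurableSet).2 (Filter.Eventually.of_forall fun x hx σ hσ => by
      rw [norm_mul]
      exact mul_le_mul_of_nonneg_left (hB (σ, x) ⟨hσ, hx⟩) (norm_nonneg _)))
    ((hw.norm.mul continuousOn_const).integrableOn_compact hC)
    ((ae_restrict_iff' hC.measurableSet).2 (Filter.Eventually.of_forall fun x hx σ hσ =>
      (hder (σ, x) (hKW ⟨hσ, hx⟩)).const_mul (w x)))
  have h1 : ∫ x in C, w x * deriv (fun σ => a σ x) 0 ∂μ = ∫ x in C, w x * G (0, x) ∂μ :=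
    setIntegral_congr_fun hC.measurableSet fun x hx => by
      rw [(hder (0, x) (hKW ⟨h0, hx⟩)).deriv]
  rw [h1]
  exact hmain.2

/-! ### The action density in coordinates and the first variation -/

section ActionForm

variable {n : ℕ} {E : Type*} [NormedAddCommGroup E] [NormedSpace ℝ E]
  {N : Type*} [TopologicalSpace N] [ChartedSpace E N] [IsManifold 𝓘(ℝ, E) ∞ N]

theorem project_partials {μ : (Fin n → ℝ) → FormBundle n E N} {x : Fin n → ℝ}
    (hμ : MDifferentiableAt 𝓘(ℝ, Fin n → ℝ) (formModel n E) μ x) :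
    project (μ x) (partials μ x) = fun i => mfderiv 𝓘(ℝ, Fin n → ℝ) 𝓘(ℝ, E)
      (fun y => (μ y).proj) x (Pi.single i 1 : Fin n → ℝ) := by
  funext i
  have h := mfderiv_comp (I := 𝓘(ℝ, Fin n → ℝ)) (I' := formModel n E) (I'' := 𝓘(ℝ, E))
    (g := fun m : FormBundle n E N => m.proj) x
    ((contMDiff_proj _).mdifferentiable (n := ∞) (by simp) (μ x)) hμ
  exact (congrArg (fun B : (Fin n → ℝ) →L[ℝ] E => B (Pi.single i 1)) h).symm

/-- The coordinates of the partial derivatives of the base components of a family of maps. -/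
noncomputable def frameCoord (q₀ : N) (μ : ℝ → (Fin n → ℝ) → FormBundle n E N)
    (z : ℝ × (Fin n → ℝ)) : Fin n → E := fun i =>
  fderiv ℝ (fun z : ℝ × (Fin n → ℝ) => extChartAt 𝓘(ℝ, E) q₀ (μ z.1 z.2).proj) z
    (0, Pi.single i 1)

variable {μ : ℝ → (Fin n → ℝ) → FormBundle n E N} {z₀ : ℝ × (Fin n → ℝ)} {q₀ : N}

theorem contDiffAt_extChartAt_proj
    (hμ : ContMDiffAt 𝓘(ℝ, ℝ × (Fin n → ℝ)) (formModel n E) ∞ (fun z => μ z.1 z.2) z₀)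
    (hq : (μ z₀.1 z₀.2).proj ∈ (chartAt E q₀).source) :
    ContDiffAt ℝ ∞ (fun z : ℝ × (Fin n → ℝ) => extChartAt 𝓘(ℝ, E) q₀ (μ z.1 z.2).proj) z₀ := by
  have h1 : ContMDiffAt 𝓘(ℝ, ℝ × (Fin n → ℝ)) 𝓘(ℝ, E) ∞
      (fun z : ℝ × (Fin n → ℝ) => (μ z.1 z.2).proj) z₀ := (contMDiffAt_proj _).comp z₀ hμ
  have h2 : ContMDiffAt 𝓘(ℝ, ℝ × (Fin n → ℝ)) 𝓘(ℝ, E) ∞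
      (fun z : ℝ × (Fin n → ℝ) => extChartAt 𝓘(ℝ, E) q₀ (μ z.1 z.2).proj) z₀ :=
    (contMDiffAt_extChartAt' (I := 𝓘(ℝ, E)) (n := ∞) hq).comp z₀ h1
  exact h2.contDiffAt

theorem contDiffAt_frameCoord
    (hμ : ContMDiffAt 𝓘(ℝ, ℝ × (Fin n → ℝ)) (formModel n E) ∞ (fun z => μ z.1 z.2) z₀)
    (hq : (μ z₀.1 z₀.2).proj ∈ (chartAt E q₀).source) :
    ContDiffAt ℝ ∞ (frameCoord q₀ μ) z₀ := by
  refine contDiffAt_pi.2 fun i => ?_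
  exact ((contDiffAt_extChartAt_proj hμ hq).fderiv_right (m := ∞) (by simp)).clm_apply
    contDiffAt_const

theorem apply_project_partials
    (hμ : ContMDiffAt 𝓘(ℝ, ℝ × (Fin n → ℝ)) (formModel n E) 1 (fun z => μ z.1 z.2) z₀)
    (hq : (μ z₀.1 z₀.2).proj ∈ (chartAt E q₀).source) (p : Form n E (μ z₀.1 z₀.2).proj) :
    p (project (μ z₀.1 z₀.2) (partials (μ z₀.1) z₀.2)) =
      formCoord q₀ ⟨(μ z₀.1 z₀.2).proj, p⟩ (frameCoord q₀ μ z₀) := by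
  have hι : ContMDiff 𝓘(ℝ, Fin n → ℝ) 𝓘(ℝ, ℝ × (Fin n → ℝ)) 1
      (fun x : Fin n → ℝ => (z₀.1, x)) :=
    (contDiff_const.prodMk contDiff_id).contMDiff
  have hμ1 : ContMDiffAt 𝓘(ℝ, Fin n → ℝ) (formModel n E) 1 (μ z₀.1) z₀.2 :=
    ContMDiffAt.comp (g := fun z : ℝ × (Fin n → ℝ) => μ z.1 z.2) z₀.2 hμ hι.contMDiffAt
  rw [project_partials (hμ1.mdifferentiableAt (by simp))]
  refine (snd_apply_eq_formCoord (m := ⟨(μ z₀.1 z₀.2).proj, p⟩) hq _).trans ?_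
  congr 1
  funext i
  have hpr : ContMDiffAt 𝓘(ℝ, ℝ × (Fin n → ℝ)) 𝓘(ℝ, E) 1
      (fun z : ℝ × (Fin n → ℝ) => (μ z.1 z.2).proj) z₀ := (contMDiffAt_proj _).comp z₀ hμ
  have hpr1 : MDifferentiableAt 𝓘(ℝ, Fin n → ℝ) 𝓘(ℝ, E) (fun x => (μ z₀.1 x).proj) z₀.2 :=
    ((contMDiffAt_proj _).comp z₀.2 hμ1).mdifferentiableAt (by simp)
  refine (tangentCoord_mfderiv hpr1 hq _).trans ?_
  have h2 : ContMDiffAt 𝓘(ℝ, ℝ × (Fin n → ℝ)) 𝓘(ℝ, E) 1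
      (fun z : ℝ × (Fin n → ℝ) => extChartAt 𝓘(ℝ, E) q₀ (μ z.1 z.2).proj) z₀ :=
    (contMDiffAt_extChartAt' (I := 𝓘(ℝ, E)) (n := 1) hq).comp z₀ hpr
  have h3 : HasFDerivAt (fun x : Fin n → ℝ => ((z₀.1, x) : ℝ × (Fin n → ℝ)))
      (ContinuousLinearMap.inr ℝ ℝ (Fin n → ℝ)) z₀.2 := hasFDerivAt_prodMk_right z₀.1 z₀.2
  have h4 := (h2.contDiffAt.differentiableAt (by simp)).hasFDerivAt.comp z₀.2 h3
  exact congrArg (fun B : (Fin n → ℝ) →L[ℝ] E => B (Pi.single i 1)) h4.fderiv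

variable [FiniteDimensional ℝ E]

theorem contDiff_alternating_apply :
    ContDiff ℝ ∞ fun z : (E [⋀^Fin n]→L[ℝ] ℝ) × (Fin n → E) => z.1 z.2 :=
  ((contDiff_altEval (n := n) (E := E)).comp contDiff_snd).clm_apply contDiff_fst

/-- Evaluating a smooth family of forms on the partial derivatives of a smooth family of maps gives
a smooth function. -/
theorem contDiffAt_apply_project_partials
    (hμ : ContMDiffAt 𝓘(ℝ, ℝ × (Fin n → ℝ)) (formModel n E) ∞ (fun z => μ z.1 z.2) z₀)
    (p : ∀ z : ℝ × (Fin n → ℝ), Form n E (μ z.1 z.2).proj)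
    (hp : ContMDiffAt 𝓘(ℝ, ℝ × (Fin n → ℝ)) (formModel n E) ∞
      (fun z => (⟨(μ z.1 z.2).proj, p z⟩ : FormBundle n E N)) z₀) :
    ContDiffAt ℝ ∞ (fun z : ℝ × (Fin n → ℝ) =>
      p z (project (μ z.1 z.2) (partials (μ z.1) z.2))) z₀ := by
  have hq : (μ z₀.1 z₀.2).proj ∈ (chartAt E (μ z₀.1 z₀.2).proj).source := mem_chart_source E _
  have h1 := ((contMDiffAt_formBundle_iff (q₀ := (μ z₀.1 z₀.2).proj)
    (μ := fun z => (⟨(μ z.1 z.2).proj, p z⟩ : FormBundle n E N)) hq).1 hp).2.contDiffAt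
  have h2 := contDiff_alternating_apply.contDiffAt.comp z₀
    (h1.prodMk (contDiffAt_frameCoord hμ hq))
  refine h2.congr_of_eventuallyEq ?_
  have hc : ∀ᶠ z in 𝓝 z₀, (μ z.1 z.2).proj ∈ (chartAt E (μ z₀.1 z₀.2).proj).source :=
    ((contMDiffAt_proj (n := ∞) _).comp z₀ hμ).continuousAt.eventually
      ((chartAt E (μ z₀.1 z₀.2).proj).open_source.mem_nhds hq)
  filter_upwards [hc, (contMDiffAt_iff_contMDiffAt_nhds (by simp)).1
    (hμ.of_le (n := ∞) (m := 1) (by simp))] with z hz hz1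
  exact apply_project_partials hz1 hz (p z)

theorem contDiffAt_volumeForm {vol : ∀ q : N, Form n E q} (hvol : IsSmoothForm vol)
    (hμ : ContMDiffAt 𝓘(ℝ, ℝ × (Fin n → ℝ)) (formModel n E) ∞ (fun z => μ z.1 z.2) z₀) :
    ContDiffAt ℝ ∞ (fun z : ℝ × (Fin n → ℝ) =>
      volumeForm vol (μ z.1 z.2) (partials (μ z.1) z.2)) z₀ :=
  contDiffAt_apply_project_partials hμ (fun z => vol (μ z.1 z.2).proj)
    (ContMDiffAt.comp (g := fun q : N => (⟨q, vol q⟩ : FormBundle n E N)) z₀ (hvol _)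
      ((contMDiffAt_proj _).comp z₀ hμ))

theorem contDiffAt_actionForm {vol : ∀ q : N, Form n E q} (hvol : IsSmoothForm vol)
    {𝓗 : FormBundle n E N → ℝ}
    (hμ : ContMDiffAt 𝓘(ℝ, ℝ × (Fin n → ℝ)) (formModel n E) ∞ (fun z => μ z.1 z.2) z₀)
    (h𝓗 : ContMDiffAt (formModel n E) 𝓘(ℝ, ℝ) ∞ 𝓗 (μ z₀.1 z₀.2)) :
    ContDiffAt ℝ ∞ (fun z : ℝ × (Fin n → ℝ) =>
      actionForm vol 𝓗 (μ z.1 z.2) (partials (μ z.1) z.2)) z₀ :=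
  (contDiffAt_apply_project_partials hμ (fun z => (μ z.1 z.2).snd) hμ).sub
    ((h𝓗.comp z₀ hμ).contDiffAt.mul (contDiffAt_volumeForm hvol hμ))

omit [FiniteDimensional ℝ E] in
theorem contMDiffAt_comp_patch {Φ : ℝ → FormBundle n E N → FormBundle n E N} {z₀ : ℝ × (Fin n → ℝ)}
    {γ : (Fin n → ℝ) → FormBundle n E N}
    (hΦ : ContMDiffAt (𝓘(ℝ, ℝ).prod (formModel n E)) (formModel n E) ∞
      (fun x : ℝ × FormBundle n E N => Φ x.1 x.2) (z₀.1, γ z₀.2))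
    (hγ : ContMDiffAt 𝓘(ℝ, Fin n → ℝ) (formModel n E) ∞ γ z₀.2) :
    ContMDiffAt 𝓘(ℝ, ℝ × (Fin n → ℝ)) (formModel n E) ∞ (fun z => Φ z.1 (γ z.2)) z₀ := by
  have h1 : ContMDiffAt 𝓘(ℝ, ℝ × (Fin n → ℝ)) 𝓘(ℝ, ℝ) ∞ (fun z : ℝ × (Fin n → ℝ) => z.1) z₀ :=
    contDiff_fst.contMDiff.contMDiffAt
  have h2 : ContMDiffAt 𝓘(ℝ, ℝ × (Fin n → ℝ)) 𝓘(ℝ, Fin n → ℝ) ∞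
      (fun z : ℝ × (Fin n → ℝ) => z.2) z₀ := contDiff_snd.contMDiff.contMDiffAt
  exact ContMDiffAt.comp (g := fun x : ℝ × FormBundle n E N => Φ x.1 x.2)
    (f := fun z : ℝ × (Fin n → ℝ) => (z.1, γ z.2)) z₀ hΦ (h1.prodMk (hγ.comp z₀ h2))

/-- The first variation of the action. -/
theorem PatchSystem.hasDerivAt_action {vol : ∀ q : N, Form n E q} (hvol : IsSmoothForm vol)
    {M Γ K : Set (FormBundle n E N)} (hM : IsOpen M) {𝓗 : FormBundle n E N → ℝ}
    (h𝓗 : ContMDiffOn (formModel n E) 𝓘(ℝ, ℝ) ∞ 𝓗 M) (hΓ : Γ ⊆ M) (P : PatchSystem vol Γ K)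
    {Φ : ℝ → FormBundle n E N → FormBundle n E N}
    (hΦ : ContMDiff (𝓘(ℝ, ℝ).prod (formModel n E)) (formModel n E) ∞
      (fun x : ℝ × FormBundle n E N => Φ x.1 x.2)) (hΦ0 : ∀ m, Φ 0 m = m) :
    HasDerivAt (fun σ => P.action 𝓗 (Φ σ)) (∑ i, ∫ x in P.dom i, P.weight i (P.param i x) *
      deriv (fun σ => actionForm vol 𝓗 (Φ σ (P.param i x))
        (partials (fun y => Φ σ (P.param i y)) x)) 0) 0 := by
  refine HasDerivAt.fun_sum fun i _ => ?_
  obtain ⟨C, hCU, hC, hC0⟩ := P.weight_support i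
  have hU := (P.isPatch i).isOpen
  have hγ : ∀ x ∈ P.dom i, ContMDiffAt 𝓘(ℝ, Fin n → ℝ) (formModel n E) ∞ (P.param i) x :=
    fun x hx => (P.isPatch i).smooth.contMDiffAt (hU.mem_nhds hx)
  have hmem : ∀ x ∈ P.dom i, P.param i x ∈ Γ := fun x hx => by
    obtain ⟨V, -, hV⟩ := (P.isPatch i).isOpen_image (P.dom i) subset_rfl hU
    exact (hV ▸ mem_image_of_mem _ hx : P.param i x ∈ Γ ∩ V).1
  refine hasDerivAt_setIntegral_mul hU hC hCU (w := fun x => P.weight i (P.param i x))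
    (a := fun σ x => actionForm vol 𝓗 (Φ σ (P.param i x))
        (partials (fun y => Φ σ (P.param i y)) x)) ?_ ?_ ?_
  · exact fun x hx => ((P.weight_smooth i).continuous.continuousAt.comp
      (hγ x (hCU hx)).continuousAt).continuousWithinAt
  · intro x hx hxC
    refine hC0 _ (hmem x hx) ?_
    rintro ⟨y, hy, hyx⟩
    exact hxC ((P.isPatch i).injOn (hCU hy) hx hyx ▸ hy)
  · intro x hx
    refine contDiffAt_actionForm (μ := fun σ y => Φ σ (P.param i y)) (z₀ := (0, x)) hvol
      (contMDiffAt_comp_patch hΦ.contMDiffAt (hγ x (hCU hx))) ?_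
    change ContMDiffAt _ _ _ 𝓗 (Φ 0 (P.param i x))
    rw [hΦ0]
    exact h𝓗.contMDiffAt (hM.mem_nhds (hΓ (hmem x (hCU hx))))

end ActionForm

theorem hasDerivAt_continuousAt_of_contDiffAt {A : Type*} [NormedAddCommGroup A] [NormedSpace ℝ A]
    {a : ℝ → A → ℝ} {x : A}
    (h : ∀ᶠ y in 𝓝 x, ContDiffAt ℝ ∞ (fun z : ℝ × A => a z.1 z.2) (0, y)) :
    HasDerivAt (fun σ => a σ x) (deriv (fun σ => a σ x) 0) 0 ∧
      ContinuousAt (fun y => deriv (fun σ => a σ y) 0) x := by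
  have h0 : ∀ y, ContDiffAt ℝ ∞ (fun z : ℝ × A => a z.1 z.2) (0, y) → HasDerivAt (fun σ => a σ y)
      (fderiv ℝ (fun z : ℝ × A => a z.1 z.2) (0, y) (1, 0)) 0 := fun y hy => by
    have h3 : HasFDerivAt (fun z : ℝ × A => a z.1 z.2)
      (fderiv ℝ (fun z : ℝ × A => a z.1 z.2) (0, y)) ((0 : ℝ), y) :=
      (hy.differentiableAt (by simp)).hasFDerivAt
    exact h3.comp_hasDerivAt (0 : ℝ) ((hasDerivAt_id (0 : ℝ)).prodMk (hasDerivAt_const 0 y))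
  refine ⟨(h0 x h.self_of_nhds).differentiableAt.hasDerivAt, ?_⟩
  have h1 : ContinuousAt (fun z : ℝ × A => fderiv ℝ (fun z : ℝ × A => a z.1 z.2) z (1, 0))
      (0, x) :=
    (h.self_of_nhds.fderiv_right (m := 0) (by simp)).continuousAt.clm_apply continuousAt_const
  have h2 : ContinuousAt (fun y : A =>
      fderiv ℝ (fun z : ℝ × A => a z.1 z.2) (0, y) (1, 0)) x :=
    ContinuousAt.comp (f := fun y : A => ((0 : ℝ), y)) h1 (by fun_prop)
  refine h2.congr ?_
  filter_upwards [h] with y hy using (h0 y hy).deriv.symm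

open MeasureTheory in
theorem setIntegral_mul_pos {A : Type*} [NormedAddCommGroup A] [MeasurableSpace A] [BorelSpace A]
    {μ : Measure A} [IsFiniteMeasureOnCompacts μ] [μ.IsOpenPosMeasure] {U C : Set A}
    (hU : IsOpen U) (hC : IsCompact C) (hCU : C ⊆ U) {w k : A → ℝ} (hw : ContinuousOn w C)
    (hk : ContinuousOn k C) (hw0 : ∀ x ∈ U, x ∉ C → w x = 0) (hwn : ∀ x ∈ C, 0 ≤ w x)
    (hkn : ∀ x ∈ C, 0 < k x) {x₀ : A} (hx₀ : C ∈ 𝓝 x₀) (hwx : w x₀ ≠ 0) :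
    0 < ∫ x in U, w x * k x ∂μ := by
  have hkI : IntegrableOn (fun x => w x * k x) U μ := by
    refine IntegrableOn.of_forall_sdiff_eq_zero ((hw.mul hk).integrableOn_compact hC)
      hU.measurableSet fun x hx => ?_
    rw [hw0 x hx.1 hx.2, zero_mul]
  have hk0 : 0 ≤ᵐ[μ.restrict U] fun x => w x * k x := by
    refine (ae_restrict_iff' hU.measurableSet).2 (Filter.Eventually.of_forall fun x hx => ?_)
    change 0 ≤ w x * k x
    by_cases hxC : x ∈ C
    · exact mul_nonneg (hwn x hxC) (hkn x hxC).le
    · rw [hw0 x hx hxC, zero_mul]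
  have hx₀C := mem_of_mem_nhds hx₀
  rw [setIntegral_pos_iff_support_of_nonneg_ae hk0 hkI]
  refine Measure.measure_pos_of_mem_nhds μ (x := x₀) (Filter.inter_mem ?_ (hU.mem_nhds (hCU hx₀C)))
  exact (((hw.mul hk) x₀ hx₀C).continuousAt hx₀).eventually_ne
    (mul_ne_zero hwx (hkn x₀ hx₀C).ne')

/-! ### The Euler–Lagrange equations for vertical variations -/

section VerticalVariation

variable {n : ℕ} {E : Type*} [NormedAddCommGroup E] [NormedSpace ℝ E]
  {N : Type*} [TopologicalSpace N] [ChartedSpace E N] [IsManifold 𝓘(ℝ, E) ∞ N]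
  {vol : ∀ q : N, Form n E q} {L : ∀ q : N, MultiVec n E q → ℝ} {M Γ : Set (FormBundle n E N)}
  {𝓗 : FormBundle n E N → ℝ}

/-- The projections of the partial derivatives depend only on the projection of the map. -/
theorem project_partials_of_proj {γ : (Fin n → ℝ) → FormBundle n E N} {x : Fin n → ℝ}
    (hγ : MDifferentiableAt 𝓘(ℝ, Fin n → ℝ) (formModel n E) γ x)
    {P : ∀ y, Form n E (γ y).proj}
    (hP : MDifferentiableAt 𝓘(ℝ, Fin n → ℝ) (formModel n E)
      (fun y => (⟨(γ y).proj, P y⟩ : FormBundle n E N)) x) :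
    project (⟨(γ x).proj, P x⟩ : FormBundle n E N)
      (partials (fun y => (⟨(γ y).proj, P y⟩ : FormBundle n E N)) x) =
      project (γ x) (partials γ x) :=
  (project_partials hP).trans (project_partials hγ).symm

theorem actionForm_of_proj {γ : (Fin n → ℝ) → FormBundle n E N} {x : Fin n → ℝ}
    (hγ : MDifferentiableAt 𝓘(ℝ, Fin n → ℝ) (formModel n E) γ x)
    {P : ∀ y, Form n E (γ y).proj}
    (hP : MDifferentiableAt 𝓘(ℝ, Fin n → ℝ) (formModel n E)
      (fun y => (⟨(γ y).proj, P y⟩ : FormBundle n E N)) x) :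
    actionForm vol 𝓗 (⟨(γ x).proj, P x⟩ : FormBundle n E N)
      (partials (fun y => (⟨(γ y).proj, P y⟩ : FormBundle n E N)) x) =
      P x (project (γ x) (partials γ x)) -
        𝓗 ⟨(γ x).proj, P x⟩ * vol (γ x).proj (project (γ x) (partials γ x)) := by
  rw [actionForm, poincareCartan, volumeForm, project_partials_of_proj hγ hP]

theorem volumeForm_of_proj {γ : (Fin n → ℝ) → FormBundle n E N} {x : Fin n → ℝ}
    (hγ : MDifferentiableAt 𝓘(ℝ, Fin n → ℝ) (formModel n E) γ x)
    {P : ∀ y, Form n E (γ y).proj}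
    (hP : MDifferentiableAt 𝓘(ℝ, Fin n → ℝ) (formModel n E)
      (fun y => (⟨(γ y).proj, P y⟩ : FormBundle n E N)) x) :
    volumeForm vol (⟨(γ x).proj, P x⟩ : FormBundle n E N)
      (partials (fun y => (⟨(γ y).proj, P y⟩ : FormBundle n E N)) x) =
      volumeForm vol (γ x) (partials γ x) := by
  rw [volumeForm, volumeForm, project_partials_of_proj hγ hP]

/-- The vertical translation by a form with constant coordinates. -/
noncomputable def verticalShift (q₀ : N) (η : E [⋀^Fin n]→L[ℝ] ℝ) (σ : ℝ) (m : FormBundle n E N) :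
    FormBundle n E N := ⟨m.proj, m.snd + σ • coordForm q₀ m.proj η⟩

theorem verticalShift_zero (q₀ : N) (η : E [⋀^Fin n]→L[ℝ] ℝ) (m : FormBundle n E N) :
    verticalShift q₀ η 0 m = m := by
  rw [verticalShift, zero_smul, add_zero]

theorem contMDiffAt_verticalShift (q₀ : N) (η : E [⋀^Fin n]→L[ℝ] ℝ) {x₀ : ℝ × FormBundle n E N}
    (hq : x₀.2.proj ∈ (chartAt E q₀).source) :
    ContMDiffAt (𝓘(ℝ, ℝ).prod (formModel n E)) (formModel n E) ∞
      (fun x : ℝ × FormBundle n E N => verticalShift q₀ η x.1 x.2) x₀ := by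
  have hs : ContMDiffAt (𝓘(ℝ, ℝ).prod (formModel n E)) (formModel n E) ∞
    (fun x : ℝ × FormBundle n E N => x.2) x₀ := contMDiffAt_snd
  have hp : ContMDiffAt (𝓘(ℝ, ℝ).prod (formModel n E)) 𝓘(ℝ, E) ∞
    (fun x : ℝ × FormBundle n E N => x.2.proj) x₀ := (contMDiffAt_proj _).comp x₀ hs
  refine (contMDiffAt_formBundle_iff (q₀ := q₀)
    (μ := fun x : ℝ × FormBundle n E N => verticalShift q₀ η x.1 x.2) hq).2 ⟨hp, ?_⟩
  have h1 : ContMDiffAt (𝓘(ℝ, ℝ).prod (formModel n E)) 𝓘(ℝ, E [⋀^Fin n]→L[ℝ] ℝ) ∞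
      (fun x : ℝ × FormBundle n E N => formCoord q₀ x.2 + x.1 • η) x₀ :=
    ((contMDiffAt_formCoord hq).comp x₀ hs).add (contMDiffAt_fst.smul contMDiffAt_const)
  refine h1.congr_of_eventuallyEq ?_
  filter_upwards [hp.continuousAt.eventually ((chartAt E q₀).open_source.mem_nhds hq)] with x hx
  refine (formCoord_add_smul q₀ x.2.proj x.2.snd _ x.1).trans ?_
  rw [formCoord_coordForm hx]

theorem IsPositivePatch.mem {U : Set (Fin n → ℝ)} {γ : (Fin n → ℝ) → FormBundle n E N}
    (h : IsPositivePatch vol Γ U γ) {x : Fin n → ℝ} (hx : x ∈ U) : γ x ∈ Γ := by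
  obtain ⟨V, -, hV⟩ := h.isOpen_image U subset_rfl h.isOpen
  exact (hV ▸ mem_image_of_mem _ hx : γ x ∈ Γ ∩ V).1

theorem IsPositivePatch.contMDiffAt {U : Set (Fin n → ℝ)} {γ : (Fin n → ℝ) → FormBundle n E N}
    (h : IsPositivePatch vol Γ U γ) {x : Fin n → ℝ} (hx : x ∈ U) :
    ContMDiffAt 𝓘(ℝ, Fin n → ℝ) (formModel n E) ∞ γ x :=
  h.smooth.contMDiffAt (h.isOpen.mem_nhds hx)

/-- A vertical shift does not move the base point, so no derivative of `ρ` enters: the density at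
`x` depends on `ρ` only through `ρ (γ x)`. This makes the vertical Euler–Lagrange equation
algebraic. -/
theorem actionForm_verticalShift {U : Set (Fin n → ℝ)} {γ : (Fin n → ℝ) → FormBundle n E N}
    (h : IsPositivePatch vol Γ U γ) {x : Fin n → ℝ} (hx : x ∈ U) {q₀ : N}
    (hq : (γ x).proj ∈ (chartAt E q₀).source) (η : E [⋀^Fin n]→L[ℝ] ℝ)
    {ρ : FormBundle n E N → ℝ} (hρ : ContMDiff (formModel n E) 𝓘(ℝ, ℝ) ∞ ρ) (σ : ℝ) :
    actionForm vol 𝓗 (verticalShift q₀ η (σ * ρ (γ x)) (γ x))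
      (partials (fun y => verticalShift q₀ η (σ * ρ (γ y)) (γ y)) x) =
      (γ x).snd (project (γ x) (partials γ x)) +
        (σ * ρ (γ x)) * coordForm q₀ (γ x).proj η (project (γ x) (partials γ x)) -
        𝓗 (verticalShift q₀ η (σ * ρ (γ x)) (γ x)) *
          vol (γ x).proj (project (γ x) (partials γ x)) := by
  have hγ := h.contMDiffAt hx
  have h1 : ContMDiffAt 𝓘(ℝ, Fin n → ℝ) (formModel n E) ∞
      (fun y => verticalShift q₀ η (σ * ρ (γ y)) (γ y)) x := by
    refine ContMDiffAt.comp (g := fun x : ℝ × FormBundle n E N => verticalShift q₀ η x.1 x.2)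
      (f := fun y => (σ * ρ (γ y), γ y)) x (contMDiffAt_verticalShift q₀ η hq) ?_
    exact (contMDiffAt_const.mul (hρ.contMDiffAt.comp x hγ)).prodMk hγ
  exact actionForm_of_proj (vol := vol) (𝓗 := 𝓗) (hγ.mdifferentiableAt (by simp))
    (P := fun y => (γ y).snd + (σ * ρ (γ y)) • coordForm q₀ (γ y).proj η)
    (h1.mdifferentiableAt (by simp))

variable [FiniteDimensional ℝ E] [T2Space N] [SecondCountableTopology N]

theorem exists_bump {K O : Set (FormBundle n E N)} (hK : IsClosed K) (hO : IsOpen O) (hKO : K ⊆ O) :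
    ∃ ρ : FormBundle n E N → ℝ, ContMDiff (formModel n E) 𝓘(ℝ, ℝ) ∞ ρ ∧
      (∀ᶠ m in 𝓝ˢ K, ρ m = 1) ∧ (∀ m ∉ O, ρ m = 0) ∧ ∀ m, ρ m ∈ Icc (0 : ℝ) 1 := by
  have : LocallyCompactSpace (FormBundle n E N) :=
    Manifold.locallyCompact_of_finiteDimensional (formModel n E)
  obtain ⟨f, hf1, hf0, hf⟩ := exists_contMDiffMap_one_nhds_of_subset_interior (n := (⊤ : ℕ∞))
    (formModel n E) hK (t := O) (by rwa [hO.interior_eq])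
  exact ⟨f, f.contMDiff, hf1, hf0, hf⟩

omit [T2Space N] [SecondCountableTopology N] in
theorem contDiffAt_actionForm_verticalShift (hvol : IsSmoothForm vol) (hM : IsOpen M)
    (h𝓗 : ContMDiffOn (formModel n E) 𝓘(ℝ, ℝ) ∞ 𝓗 M) (hΓM : Γ ⊆ M) {U : Set (Fin n → ℝ)}
    {γ : (Fin n → ℝ) → FormBundle n E N} (hγ : IsPositivePatch vol Γ U γ) {x : Fin n → ℝ}
    (hx : x ∈ U) {q₀ : N} (hq : (γ x).proj ∈ (chartAt E q₀).source) (η : E [⋀^Fin n]→L[ℝ] ℝ) :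
    ContDiffAt ℝ ∞ (fun z : ℝ × (Fin n → ℝ) => actionForm vol 𝓗 (verticalShift q₀ η z.1 (γ z.2))
      (partials (fun y => verticalShift q₀ η z.1 (γ y)) z.2)) (0, x) := by
  have h1 := contMDiffAt_comp_patch (Φ := verticalShift q₀ η) (z₀ := (0, x)) (γ := γ)
    (contMDiffAt_verticalShift q₀ η (x₀ := (0, γ x)) hq) (hγ.contMDiffAt hx)
  refine contDiffAt_actionForm (μ := fun σ y => verticalShift q₀ η σ (γ y)) hvol h1 ?_
  change ContMDiffAt _ _ _ 𝓗 (verticalShift q₀ η 0 (γ x))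
  rw [verticalShift_zero]
  exact h𝓗.contMDiffAt (hM.mem_nhds (hΓM (hγ.mem hx)))

omit [FiniteDimensional ℝ E] [SecondCountableTopology N] in
theorem isVariation_verticalShift {K : Set (FormBundle n E N)} (hK : IsCompact K) (hKM : K ⊆ M)
    {q₀ : N} (hKq : ∀ m ∈ K, m.proj ∈ (chartAt E q₀).source) (η : E [⋀^Fin n]→L[ℝ] ℝ)
    {ρ : FormBundle n E N → ℝ} (hρ : ContMDiff (formModel n E) 𝓘(ℝ, ℝ) ∞ ρ)
    (hρ0 : ∀ m ∉ K, ρ m = 0) :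
    IsVariation M K fun σ m => verticalShift q₀ η (σ * ρ m) m := by
  have hΦK : ∀ s, ∀ m ∉ K, verticalShift q₀ η (s * ρ m) m = m := fun s m hm => by
    rw [hρ0 m hm, mul_zero, verticalShift_zero]
  refine ⟨hK, hKM, fun x => ?_, fun m => ?_, hΦK⟩
  · by_cases hx : x.2 ∈ K
    · have h1 : ContMDiffAt (𝓘(ℝ, ℝ).prod (formModel n E)) (𝓘(ℝ, ℝ).prod (formModel n E)) ∞
          (fun x : ℝ × FormBundle n E N => (x.1 * ρ x.2, x.2)) x :=
        (contMDiffAt_fst.mul (hρ.contMDiffAt.comp x contMDiffAt_snd)).prodMk contMDiffAt_snd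
      exact ContMDiffAt.comp (g := fun x : ℝ × FormBundle n E N => verticalShift q₀ η x.1 x.2)
        (f := fun x : ℝ × FormBundle n E N => (x.1 * ρ x.2, x.2)) x
        (contMDiffAt_verticalShift q₀ η (hKq _ hx)) h1
    · refine (contMDiffAt_snd (I := 𝓘(ℝ, ℝ)) (J := formModel n E)).congr_of_eventuallyEq ?_
      filter_upwards [(hK.isClosed.isOpen_compl.preimage continuous_snd).mem_nhds hx] with y hy
      exact hΦK y.1 y.2 hy
  · rw [zero_mul, verticalShift_zero]

/-- The Euler-Lagrange equations for vertical variations. -/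
theorem deriv_actionForm_verticalShift_eq_zero (hvol : IsSmoothForm vol) (hM : IsOpen M)
    (h𝓗 : ContMDiffOn (formModel n E) 𝓘(ℝ, ℝ) ∞ 𝓗 M) (hΓM : Γ ⊆ M)
    (hΓ : IsCriticalPoint vol 𝓗 M Γ) {U : Set (Fin n → ℝ)} {γ : (Fin n → ℝ) → FormBundle n E N}
    (hγ : IsPositivePatch vol Γ U γ) {x₀ : Fin n → ℝ} (hx₀ : x₀ ∈ U) (η : E [⋀^Fin n]→L[ℝ] ℝ) :
    deriv (fun σ => actionForm vol 𝓗 (verticalShift (γ x₀).proj η σ (γ x₀))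
      (partials (fun y => verticalShift (γ x₀).proj η σ (γ y)) x₀)) 0 = 0 := by
  have : LocallyCompactSpace (FormBundle n E N) :=
    Manifold.locallyCompact_of_finiteDimensional (formModel n E)
  obtain ⟨q₀, hq₀⟩ : ∃ q₀, q₀ = (γ x₀).proj := ⟨_, rfl⟩
  rw [← hq₀]
  let Q : Set (FormBundle n E N) := {m | m.proj ∈ (chartAt E q₀).source}
  have hQ : IsOpen Q := (chartAt E q₀).open_source.preimage
    (contMDiff_proj (n := ∞) (IB := 𝓘(ℝ, E)) (fun q : N => Form n E q)).continuous
  obtain ⟨a, ha⟩ : ∃ a : ℝ → (Fin n → ℝ) → ℝ, a = fun σ x =>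
    actionForm vol 𝓗 (verticalShift q₀ η σ (γ x))
      (partials (fun y => verticalShift q₀ η σ (γ y)) x) := ⟨_, rfl⟩
  have haC : ∀ x ∈ U, γ x ∈ Q → ContDiffAt ℝ ∞ (fun z : ℝ × (Fin n → ℝ) => a z.1 z.2) (0, x) :=
    fun x hx hxQ => by
      rw [ha]
      exact contDiffAt_actionForm_verticalShift hvol hM h𝓗 hΓM hγ hx hxQ η
  have haΦ : ∀ x ∈ U, γ x ∈ Q → ∀ ρ : FormBundle n E N → ℝ,
      ContMDiff (formModel n E) 𝓘(ℝ, ℝ) ∞ ρ → ∀ σ,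
      actionForm vol 𝓗 (verticalShift q₀ η (σ * ρ (γ x)) (γ x))
        (partials (fun y => verticalShift q₀ η (σ * ρ (γ y)) (γ y)) x) = a (σ * ρ (γ x)) x := by
    intro x hx hxQ ρ hρ σ
    rw [ha]
    exact (actionForm_verticalShift hγ hx hxQ η hρ σ).trans (actionForm_verticalShift hγ hx hxQ η
      (ρ := fun _ => ρ (γ x)) contMDiff_const σ).symm
  suffices h : deriv (fun σ => a σ x₀) 0 = 0 by rw [ha] at h; exact h
  clear ha
  by_contra hb
  have hγc : ∀ x ∈ U, ContinuousAt γ x := fun x hx => (hγ.contMDiffAt hx).continuousAt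
  have hab : ∀ x ∈ U, γ x ∈ Q → HasDerivAt (fun σ => a σ x) (deriv (fun σ => a σ x) 0) 0 ∧
      ContinuousAt (fun y => deriv (fun σ => a σ y) 0) x := fun x hx hxQ => by
    refine hasDerivAt_continuousAt_of_contDiffAt ?_
    filter_upwards [hγ.isOpen.mem_nhds hx, hγc x hx (hQ.mem_nhds hxQ)] with y hy hyQ
    exact haC y hy hyQ
  have hx₀Q : γ x₀ ∈ Q := by
    change (γ x₀).proj ∈ (chartAt E q₀).source
    rw [← hq₀]
    exact mem_chart_source E _
  -- The fundamental lemma of the calculus of variations: if the derivative at `x₀` were not zero,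
  -- it would keep its sign nearby. Multiplication by its value at `x₀` treats both signs at once.
  have hS : {x | x ∈ U ∧ γ x ∈ Q ∧
      0 < deriv (fun σ => a σ x) 0 * deriv (fun σ => a σ x₀) 0} ∈ 𝓝 x₀ := by
    have h1 : ∀ᶠ x in 𝓝 x₀, 0 < deriv (fun σ => a σ x) 0 * deriv (fun σ => a σ x₀) 0 :=
      (((hab x₀ hx₀ hx₀Q).2).mul continuousAt_const).eventually
        (lt_mem_nhds (mul_self_pos.2 hb))
    filter_upwards [hγ.isOpen.mem_nhds hx₀, hγc x₀ hx₀ (hQ.mem_nhds hx₀Q), h1] with x h h' h''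
      using ⟨h, h', h''⟩
  obtain ⟨C, hC, hCS, hCc⟩ := local_compact_nhds hS
  have hCU : C ⊆ U := fun x hx => (hCS hx).1
  obtain ⟨V, hV, hγV⟩ := hγ.isOpen_image (interior C) (interior_subset.trans hCU) isOpen_interior
  have hVC : ∀ m ∈ Γ, m ∈ V → m ∈ γ '' interior C := fun m hm hmV => hγV ▸ ⟨hm, hmV⟩
  have hx₀V : γ x₀ ∈ V :=
    (hγV ▸ mem_image_of_mem γ (mem_interior_iff_mem_nhds.2 hC) : γ x₀ ∈ Γ ∩ V).2
  let O : Set (FormBundle n E N) := V ∩ M ∩ Q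
  have hO : IsOpen O := (hV.inter hM).inter hQ
  obtain ⟨K, hK, hKx, hKO⟩ := exists_compact_subset hO
    (show γ x₀ ∈ O from ⟨⟨hx₀V, hΓM (hγ.mem hx₀)⟩, hx₀Q⟩)
  obtain ⟨ρ, hρ, hρ1, hρ0, hρI⟩ := exists_bump (isClosed_singleton (x := γ x₀)) isOpen_interior
    (singleton_subset_iff.2 hKx)
  obtain ⟨χ, hχ, hχ1, hχ0, hχI⟩ := exists_bump hK.isClosed hO hKO
  have hχ1 : ∀ m ∈ K, χ m = 1 := fun m hm => (Filter.Eventually.self_of_nhdsSet hχ1) m hm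
  have hρ1 : ρ (γ x₀) = 1 := (Filter.Eventually.self_of_nhdsSet hρ1) _ (mem_singleton _)
  have hρ0 : ∀ m ∉ K, ρ m = 0 := fun m hm => hρ0 m fun h => hm (interior_subset h)
  have hΦ := isVariation_verticalShift (M := M) (q₀ := q₀) hK (fun m hm => (hKO hm).1.2)
    (fun m hm => (hKO hm).2) η hρ hρ0
  -- One patch suffices: `χ` is `1` on the support `K` of the variation and vanishes off the open
  -- set `O`, and the part of `Γ` in `O` is covered by `γ '' C`.
  let P : PatchSystem vol Γ K :=
    { num := 1
      dom := fun _ => U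
      param := fun _ => γ
      isPatch := fun _ => hγ
      weight := fun _ => χ
      weight_smooth := fun _ => hχ
      weight_support := fun _ => ⟨C, hCU, hCc, fun m hm hmC => hχ0 m fun hmO =>
        hmC (image_mono interior_subset (hVC m hm hmO.1.1))⟩
      sum_weight := fun m hm => by simpa using hχ1 m hm.2 }
  have h0 := (hΓ K _ hΦ P).unique (P.hasDerivAt_action hvol hM h𝓗 hΓM hΦ.smooth hΦ.zero)
  have h0' : 0 = ∫ x in U, χ (γ x) * deriv (fun σ => actionForm vol 𝓗
      (verticalShift q₀ η (σ * ρ (γ x)) (γ x))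
      (partials (fun y => verticalShift q₀ η (σ * ρ (γ y)) (γ y)) x)) 0 :=
    h0.trans (Fin.sum_univ_one _)
  have hzero : ∀ x ∈ U, x ∉ C → χ (γ x) = 0 := fun x hx hxC => by
    refine hχ0 _ fun hm => ?_
    obtain ⟨y, hy, hyx⟩ := hVC _ (hγ.mem hx) hm.1.1
    exact hxC (hγ.injOn (hCU (interior_subset hy)) hx hyx ▸ interior_subset hy)
  have hpos := setIntegral_mul_pos (μ := MeasureTheory.volume) hγ.isOpen hCc hCU
    (w := fun x => χ (γ x) * ρ (γ x))
    (k := fun x => deriv (fun σ => a σ x) 0 * deriv (fun σ => a σ x₀) 0)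
    (fun x hx => ((hχ.continuous.continuousAt.comp (hγc x (hCU hx))).mul
      (hρ.continuous.continuousAt.comp (hγc x (hCU hx)))).continuousWithinAt)
    (fun x hx => ((hab x (hCU hx) (hCS hx).2.1).2.mul continuousAt_const).continuousWithinAt)
    (fun x hx hxC => by rw [hzero x hx hxC, zero_mul])
    (fun x hx => mul_nonneg (hχI _).1 (hρI _).1) (fun x hx => (hCS hx).2.2) hC
    (by rw [hχ1 _ (interior_subset hKx), hρ1]; simp)
  -- Up to the constant factor from `x₀`, the positive integral is the first variation of the
  -- action, which vanishes because `Γ` is critical.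
  refine hpos.ne' ?_
  simp only [← mul_assoc]
  rw [MeasureTheory.integral_mul_const, mul_eq_zero]
  left
  refine Eq.trans ?_ h0'.symm
  refine MeasureTheory.setIntegral_congr_fun hγ.isOpen.measurableSet fun x hx => ?_
  change χ (γ x) * ρ (γ x) * deriv (fun σ => a σ x) 0 = _
  by_cases hxC : x ∈ C
  · have hxQ : γ x ∈ Q := (hCS hxC).2.1
    have h4 : HasDerivAt (fun σ : ℝ => σ * ρ (γ x)) (ρ (γ x)) 0 := hasDerivAt_mul_const _
    have h5 : HasDerivAt (fun σ => a σ x) (deriv (fun σ => a σ x) 0) (0 * ρ (γ x)) := by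
      rw [zero_mul]; exact (hab x hx hxQ).1
    have h6 := (h5.comp (0 : ℝ) h4).deriv
    simp only [haΦ x hx hxQ ρ hρ]
    refine Eq.trans ?_ (congrArg (fun r => χ (γ x) * r) h6).symm
    ring
  · simp only [hzero x hx hxC, zero_mul]

/-- On a Hamiltonian curve, the tangent planes project to multiples of the Legendre image. -/
theorem IsLegendreImage.wedge_partials_eq (h𝓗 : IsLegendreImage vol L M 𝓗) (hn : 1 ≤ n)
    (hL : IsSmoothLagrangian vol L) (hvol : IsSmoothForm vol) (hM : IsOpen M) (hΓM : Γ ⊆ M)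
    (hΓ : IsCriticalPoint vol 𝓗 M Γ) {U : Set (Fin n → ℝ)} {γ : (Fin n → ℝ) → FormBundle n E N}
    (hγ : IsPositivePatch vol Γ U γ) {x : Fin n → ℝ} (hx : x ∈ U) {z : MultiVec n E (γ x).proj}
    (hz : z ∈ legendreZ vol L (γ x).proj (γ x).snd) :
    wedge (project (γ x) (partials γ x)) = volumeForm vol (γ x) (partials γ x) • z := by
  let X : Fin n → E := project (γ x) (partials γ x)
  let p : E [⋀^Fin n]→L[ℝ] ℝ := (γ x).snd
  let z' : (E [⋀^Fin n]→L[ℝ] ℝ) →L[ℝ] ℝ := z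
  let h : (E [⋀^Fin n]→L[ℝ] ℝ) → ℝ := fun p => 𝓗 (fibreIncl n E (γ x).proj p)
  have hMx : fibreIncl n E (γ x).proj p ∈ M := hΓM (hγ.mem hx)
  suffices hkey : ∀ η : E [⋀^Fin n]→L[ℝ] ℝ,
      η X = volumeForm vol (γ x) (partials γ x) * z' η from ContinuousLinearMap.ext hkey
  intro η
  have h0 := deriv_actionForm_verticalShift_eq_zero hvol hM h𝓗.smooth hΓM hΓ hγ hx η
  have h1 : ∀ σ, actionForm vol 𝓗 (verticalShift (γ x).proj η σ (γ x))
      (partials (fun y => verticalShift (γ x).proj η σ (γ y)) x) =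
      p X + σ * η X - h (p + σ • η) * volumeForm vol (γ x) (partials γ x) := fun σ => by
    have h2 := actionForm_verticalShift (vol := vol) (𝓗 := 𝓗) hγ hx (mem_chart_source E _) η
      (ρ := fun _ => 1) contMDiff_const σ
    beta_reduce at h2
    rw [mul_one, coordForm_self] at h2
    have h2' : verticalShift (γ x).proj η σ (γ x) = fibreIncl n E (γ x).proj (p + σ • η) :=
      congrArg (fun f : Form n E (γ x).proj => (⟨(γ x).proj, (γ x).snd + σ • f⟩ : FormBundle n E N))
        (coordForm_self _ _)
    refine h2.trans ?_
    exact congrArg (fun r => p X + σ * η X - r * volumeForm vol (γ x) (partials γ x))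
      (congrArg 𝓗 h2')
  simp only [h1] at h0
  have h3 : HasDerivAt (fun σ : ℝ => p + σ • η) η 0 := by
    simpa using ((hasDerivAt_id (0 : ℝ)).smul_const η).const_add p
  have h4 : HasFDerivAt h (fderiv ℝ h p) (p + (0 : ℝ) • η) := by
    rw [zero_smul, add_zero]
    exact (((contDiffOn_fibreIncl h𝓗.smooth _).contDiffAt
      ((isOpen_fibreIncl_preimage hM _).mem_nhds hMx)).differentiableAt (by simp)).hasFDerivAt
  have h5 := h4.comp_hasDerivAt (0 : ℝ) h3
  have h6 : fderiv ℝ h p = z' := h𝓗.fderiv_eq hn hL hM hMx hz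
  rw [h6] at h5
  -- The derivative at `σ = 0` of the density is `η X - ⟨z, η⟩ ω(X)`. Its vanishing for every `η` is
  -- the asserted equality of multivectors.
  have h7 := ((((hasDerivAt_mul_const (η X)).const_add (p X)).sub (h5.mul_const
      (volumeForm vol (γ x) (partials γ x)))).deriv).symm.trans h0
  linarith

end VerticalVariation

/-! ### Images of submanifolds and parametrizations under conormal shifts -/

section Patches

variable {n : ℕ} {E : Type*} [NormedAddCommGroup E] [NormedSpace ℝ E]
  {N : Type*} [TopologicalSpace N] [ChartedSpace E N] [IsManifold 𝓘(ℝ, E) ∞ N]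
  {vol : ∀ q : N, Form n E q} {L : ∀ q : N, MultiVec n E q → ℝ} {M Γ : Set (FormBundle n E N)}
  {D D' : Set (FormBundle n E N)} {g g' : ∀ m : FormBundle n E N, Form n E m.proj}
  {U : Set (Fin n → ℝ)} {γ : (Fin n → ℝ) → FormBundle n E N}

theorem IsPositivePatch.mono (h : IsPositivePatch vol Γ U γ) {U' : Set (Fin n → ℝ)}
    (hU' : IsOpen U') (hUU : U' ⊆ U) : IsPositivePatch vol Γ U' γ :=
  ⟨hU', h.smooth.mono hUU, h.injOn.mono hUU, fun V hV => h.isOpen_image V (hV.trans hUU),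
    fun x hx => h.pos x (hUU hx)⟩

theorem IsPositivePatch.of_inter (h : IsPositivePatch vol (Γ ∩ D) U γ) (hD : IsOpen D) :
    IsPositivePatch vol Γ U γ := by
  refine ⟨h.isOpen, h.smooth, h.injOn, fun U' hUU hU' => ?_, h.pos⟩
  obtain ⟨V, hV, hγ⟩ := h.isOpen_image U' hUU hU'
  exact ⟨D ∩ V, hD.inter hV, by rw [hγ, inter_assoc]⟩

theorem IsPositivePatch.isOpen_preimage (h : IsPositivePatch vol Γ U γ) (hD : IsOpen D) :
    IsOpen (U ∩ γ ⁻¹' D) :=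
  h.smooth.continuousOn.isOpen_inter_preimage h.isOpen hD

theorem IsConormalShift.contMDiffAt (h : IsConormalShift vol L M D g) {m : FormBundle n E N}
    (hm : m ∈ D) : ContMDiffAt (formModel n E) (formModel n E) ∞ (fibreMap g) m :=
  h.smooth.contMDiffAt (h.isOpen.mem_nhds hm)

theorem IsConormalShiftPair.inter_preimage (h : IsConormalShiftPair vol L M D D' g g')
    (V : Set (FormBundle n E N)) : fibreMap g '' (Γ ∩ D) ∩ (D' ∩ fibreMap g' ⁻¹' V) =
      fibreMap g '' (Γ ∩ D ∩ V) := by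
  ext m
  constructor
  · rintro ⟨⟨x, hx, rfl⟩, -, hV⟩
    rw [mem_preimage, h.leftInv x hx.2] at hV
    exact ⟨x, ⟨hx, hV⟩, rfl⟩
  · rintro ⟨x, ⟨hx, hV⟩, rfl⟩
    refine ⟨⟨x, hx, rfl⟩, h.mapsTo hx.2, ?_⟩
    rwa [mem_preimage, h.leftInv x hx.2]

theorem IsConormalShiftPair.image_image_inter (h : IsConormalShiftPair vol L M D D' g g') :
    fibreMap g' '' (fibreMap g '' (Γ ∩ D) ∩ D') = Γ ∩ D := by
  have h1 := h.inter_preimage (Γ := Γ) univ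
  rw [preimage_univ, inter_univ, inter_univ] at h1
  rw [h1, Set.image_image]
  ext m
  constructor
  · rintro ⟨x, hx, rfl⟩
    beta_reduce
    rwa [h.leftInv x hx.2]
  · exact fun hm => ⟨m, hm, h.leftInv m hm.2⟩

/-- Conormal shifts map parametrizations to parametrizations. -/
theorem IsConormalShiftPair.isPositivePatch (h : IsConormalShiftPair vol L M D D' g g')
    (hγ : IsPositivePatch vol Γ U γ) (hD : ∀ x ∈ U, γ x ∈ D) :
    IsPositivePatch vol (fibreMap g '' (Γ ∩ D)) U (fun x => fibreMap g (γ x)) := by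
  have hs : ∀ x ∈ U, ContMDiffAt 𝓘(ℝ, Fin n → ℝ) (formModel n E) ∞ (fun x => fibreMap g (γ x)) x :=
    fun x hx => (h.left.contMDiffAt (hD x hx)).comp x (hγ.contMDiffAt hx)
  refine ⟨hγ.isOpen, fun x hx => (hs x hx).contMDiffWithinAt, fun x hx y hy hxy => ?_,
    fun U' hUU hU' => ?_, fun x hx => ?_⟩
  · refine hγ.injOn hx hy ?_
    have h1 := congrArg (fibreMap g') hxy
    beta_reduce at h1
    rwa [h.leftInv _ (hD x hx), h.leftInv _ (hD y hy)] at h1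
  · obtain ⟨V, hV, h1⟩ := hγ.isOpen_image U' hUU hU'
    refine ⟨D' ∩ fibreMap g' ⁻¹' V, h.right.smooth.continuousOn.isOpen_inter_preimage
      h.right.isOpen hV, ?_⟩
    rw [h.inter_preimage, ← Set.image_image (fibreMap g) γ, h1]
    congr 1
    ext m
    constructor
    · intro hm
      obtain ⟨x, hx, rfl⟩ : m ∈ γ '' U' := h1 ▸ hm
      exact ⟨⟨hm.1, hD x (hUU hx)⟩, hm.2⟩
    · exact fun hm => ⟨hm.1.1, hm.2⟩
  · refine (hγ.pos x hx).trans_eq (Eq.symm ?_)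
    exact volumeForm_of_proj ((hγ.contMDiffAt hx).mdifferentiableAt (by simp))
      (P := fun y => g (γ y)) ((hs x hx).mdifferentiableAt (by simp))

theorem IsConormalShiftPair.isPositivePatch_of_image (h : IsConormalShiftPair vol L M D D' g g')
    (hγ : IsPositivePatch vol (fibreMap g '' (Γ ∩ D)) U γ) :
    IsPositivePatch vol Γ U (fun x => fibreMap g' (γ x)) := by
  have h1 := h.symm.isPositivePatch hγ fun x hx => by
    obtain ⟨m, hm, h2⟩ := hγ.mem hx
    rw [← h2]
    exact h.mapsTo hm.2
  rw [h.image_image_inter] at h1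
  exact h1.of_inter h.left.isOpen

theorem IsConormalShiftPair.isPositiveSubmanifold (h : IsConormalShiftPair vol L M D D' g g')
    (hΓ : IsPositiveSubmanifold vol M Γ) :
    IsPositiveSubmanifold vol M (fibreMap g '' (Γ ∩ D)) := by
  refine ⟨?_, ?_⟩
  · rintro _ ⟨m, hm, rfl⟩
    exact h.left.mapsTo hm.2
  · rintro _ ⟨m, hm, rfl⟩
    obtain ⟨U, γ, hγ, x, hx, rfl⟩ := hΓ.2 m hm.1
    exact ⟨_, _, h.isPositivePatch (hγ.mono (hγ.isOpen_preimage h.left.isOpen) inter_subset_left)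
      fun y hy => hy.2, x, ⟨hx, hm.2⟩, rfl⟩

end Patches

/-! ### Pairing varying multivectors with varying conormal forms -/

section PointwiseVariation

variable {n : ℕ} {E : Type*} [NormedAddCommGroup E] [NormedSpace ℝ E] [FiniteDimensional ℝ E]
  {N : Type*} [TopologicalSpace N] [ChartedSpace E N]

omit [FiniteDimensional ℝ E] in
-- In the product rule, `a'(0) (η 0) = 0` by assumption, and `a(0) (η'(0)) = r • c(0) (η'(0))`. The
-- latter vanishes too, since differentiating `c t (η t) = 0` gives `c(0) (η'(0)) = -c'(0) (η 0) =
-- 0`. In this way nothing has to be known about `η'(0)` itself.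
theorem hasDerivAt_apply_of_eventually_eq_zero {F : Type*} [NormedAddCommGroup F]
    [NormedSpace ℝ F] {η : ℝ → F} (hη : DifferentiableAt ℝ η 0) {a c : ℝ → F →L[ℝ] ℝ}
    (ha : DifferentiableAt ℝ a 0) (hc : DifferentiableAt ℝ c 0)
    (ha0 : HasDerivAt (fun t => a t (η 0)) 0 0) (hc0 : HasDerivAt (fun t => c t (η 0)) 0 0) {r : ℝ}
    (hac : a 0 = r • c 0) (hcη : ∀ᶠ t in 𝓝 0, c t (η t) = 0) :
    HasDerivAt (fun t => a t (η t)) 0 0 := by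
  have h1 := (hasDerivAt_clm_apply_const ha.hasDerivAt (η 0)).unique ha0
  have h2 := (hasDerivAt_clm_apply_const hc.hasDerivAt (η 0)).unique hc0
  have h3 := hc.hasDerivAt.clm_apply hη.hasDerivAt
  have h4 : HasDerivAt (fun t => c t (η t)) 0 0 :=
    (hasDerivAt_const (0 : ℝ) (0 : ℝ)).congr_of_eventuallyEq hcη
  have h5 := h3.unique h4
  rw [h2, zero_add] at h5
  have h6 := ha.hasDerivAt.clm_apply hη.hasDerivAt
  rwa [h1, hac, smul_apply, h5, smul_zero, zero_add] at h6

/-- This is `hasDerivAt_pairing_conormal` for germs. The definition of the tangent cone asks for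
curves defined for all times, so the germ is composed with a bounded reparametrization of derivative
one at `0`. -/
theorem hasDerivAt_apply_conormal_const {q : N} {z : (E [⋀^Fin n]→L[ℝ] ℝ) →L[ℝ] ℝ}
    {η : E [⋀^Fin n]→L[ℝ] ℝ} (hη : η ∈ conormal (q := q) z)
    {c : ℝ → (E [⋀^Fin n]→L[ℝ] ℝ) →L[ℝ] ℝ} (hc : ∀ᶠ t in 𝓝 0, ContDiffAt ℝ ∞ c t)
    (hd : ∀ᶠ t in 𝓝 0, ∃ v : Fin n → E, altEval v = c t) (h0 : c 0 = z) :
    HasDerivAt (fun t => c t η) 0 0 := by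
  obtain ⟨δ, hδ, h1⟩ := Metric.eventually_nhds_iff_ball.1 (hc.and hd)
  obtain ⟨τ, hτ, hτ0, hτ1, hτδ⟩ := exists_bounded_reparam hδ
  have hτb : ∀ t, τ t ∈ Metric.ball (0 : ℝ) δ := fun t => by
    rw [mem_ball_zero_iff]; exact hτδ t
  have h2 : ∀ p, ContDiff ℝ ∞ fun t => c (τ t) p := fun p => contDiff_iff_contDiffAt.2 fun t =>
    ((h1 _ (hτb t)).1.comp t hτ.contDiffAt).clm_apply contDiffAt_const
  have h3 := hasDerivAt_pairing_conormal hη (c := fun t => c (τ t)) h2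
    (fun t => (h1 _ (hτb t)).2) (congrArg c hτ0 |>.trans h0)
  have h4 : HasDerivAt (fun t => c t η) (deriv (fun t => c t η) 0) (τ 0) := by
    rw [hτ0]
    exact ((hc.self_of_nhds.clm_apply contDiffAt_const).differentiableAt (by simp)).hasDerivAt
  have h5 := (h4.comp 0 hτ1).unique h3
  rw [mul_one] at h5
  rw [hτ0, h5] at h4
  exact h4

/-- The first order variation of the pairing of a decomposable multivector with a conormal form. -/
theorem hasDerivAt_apply_conormal (hn : 1 ≤ n) {q : N} {z : (E [⋀^Fin n]→L[ℝ] ℝ) →L[ℝ] ℝ}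
    {η : ℝ → E [⋀^Fin n]→L[ℝ] ℝ} (hη0 : η 0 ∈ conormal (q := q) z) (hη : ContDiffAt ℝ ∞ η 0)
    {f : ℝ → Fin n → E} (hf : ∀ᶠ t in 𝓝 0, ContDiffAt ℝ ∞ f t) {r : ℝ} (hr : r ≠ 0)
    (hf0 : altEval (f 0) = r • z) {c : ℝ → (E [⋀^Fin n]→L[ℝ] ℝ) →L[ℝ] ℝ}
    (hc : ∀ᶠ t in 𝓝 0, ContDiffAt ℝ ∞ c t)
    (hd : ∀ᶠ t in 𝓝 0, ∃ v : Fin n → E, altEval v = c t) (h0 : c 0 = z)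
    (hcη : ∀ᶠ t in 𝓝 0, c t (η t) = 0) : HasDerivAt (fun t => η t (f t)) 0 0 := by
  have h1 : ∀ᶠ t in 𝓝 (0 : ℝ), ContDiffAt ℝ ∞ (fun t => altEval (n := n) (f t)) t := by
    filter_upwards [hf] with t ht
    exact (contDiff_altEval (n := n) (E := E)).contDiffAt.comp t ht
  -- After division by `r` the frame gives a curve of decomposable multivectors through `z`, and `η
  -- 0` annihilates its velocity.
  have h2 : HasDerivAt (fun t => (r⁻¹ • altEval (f t)) (η 0)) 0 0 := by
    refine hasDerivAt_apply_conormal_const (c := fun t => r⁻¹ • altEval (f t)) hη0 ?_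
      (Filter.Eventually.of_forall fun t => smul_altEval hn _ _) ?_
    · filter_upwards [h1] with t ht
      exact contDiffAt_clm_of_apply fun p =>
        contDiffAt_const.mul (ht.clm_apply contDiffAt_const)
    · exact (congrArg (fun a => r⁻¹ • a) hf0).trans (inv_smul_smul₀ hr z)
  have h3 := h2.const_mul r
  refine hasDerivAt_apply_of_eventually_eq_zero (a := fun t => altEval (f t)) (c := c) (r := r)
    (hη.differentiableAt (by simp)) (h1.self_of_nhds.differentiableAt (by simp))
    (hc.self_of_nhds.differentiableAt (by simp)) ?_
    (hasDerivAt_apply_conormal_const hη0 hc hd h0) (h0.symm ▸ hf0) hcη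
  rw [mul_zero] at h3
  refine h3.congr_of_eventuallyEq (Filter.Eventually.of_forall fun t => ?_)
  exact (mul_inv_cancel_left₀ hr _).symm

variable [IsManifold 𝓘(ℝ, E) ∞ N]
  {vol : ∀ q : N, Form n E q} {L : ∀ q : N, MultiVec n E q → ℝ} {M : Set (FormBundle n E N)}
  {𝓗 : FormBundle n E N → ℝ}

omit [FiniteDimensional ℝ E] in
theorem IsLegendreImage.contDiffAt_comp_extChartAt_symm (h𝓗 : IsLegendreImage vol L M 𝓗)
    (hM : IsOpen M) (m₀ : FormBundle n E N) {m : FormBundle n E N} (hm : m ∈ M)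
    (hq : m.proj ∈ (chartAt E m₀.proj).source) :
    ContDiffAt ℝ ∞ (fun y => 𝓗 ((extChartAt (formModel n E) m₀).symm y))
      (extChartAt (formModel n E) m₀ m) := by
  have hm' : m ∈ (extChartAt (formModel n E) m₀).source := mem_chartAt_formBundle_source_iff.2 hq
  have h1 : ContMDiffAt 𝓘(ℝ, E × (E [⋀^Fin n]→L[ℝ] ℝ)) (formModel n E) ∞
      (extChartAt (formModel n E) m₀).symm (extChartAt (formModel n E) m₀ m) :=
    (contMDiffOn_extChartAt_symm m₀).contMDiffAt
      ((isOpen_extChartAt_target m₀).mem_nhds ((extChartAt (formModel n E) m₀).map_source hm'))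
  refine ContMDiffAt.contDiffAt (ContMDiffAt.comp (g := 𝓗) _ ?_ h1)
  rw [(extChartAt (formModel n E) m₀).left_inv hm']
  exact h𝓗.smooth.contMDiffAt (hM.mem_nhds hm)

/-- In coordinates, the vertical derivative of the Hamiltonian function is the Legendre image. -/
theorem IsLegendreImage.fderiv_comp_extChartAt_symm (h𝓗 : IsLegendreImage vol L M 𝓗) (hn : 1 ≤ n)
    (hL : IsSmoothLagrangian vol L) (hM : IsOpen M) (m₀ : FormBundle n E N) {q : N}
    {p : E [⋀^Fin n]→L[ℝ] ℝ} (hp : fibreIncl n E q p ∈ M) (hq : q ∈ (chartAt E m₀.proj).source)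
    {z : (E [⋀^Fin n]→L[ℝ] ℝ) →L[ℝ] ℝ} (hz : z ∈ legendreZ vol L q p)
    (η : E [⋀^Fin n]→L[ℝ] ℝ) :
    fderiv ℝ (fun y => 𝓗 ((extChartAt (formModel n E) m₀).symm y))
      (extChartAt (formModel n E) m₀ (fibreIncl n E q p))
      (0, formCoord m₀.proj (fibreIncl n E q η)) = z η := by
  have hm' : fibreIncl n E q p ∈ (extChartAt (formModel n E) m₀).source :=
    mem_chartAt_formBundle_source_iff.2 hq
  have hm'' : fibreIncl n E q p ∈ (chartAt (ModelProd E (E [⋀^Fin n]→L[ℝ] ℝ)) m₀).source := by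
    rwa [extChartAt_source] at hm'
  have h1 := (h𝓗.contDiffAt_comp_extChartAt_symm hM m₀ hp hq).differentiableAt (by simp)
  have h2 := mfderiv_comp (I := formModel n E) (I' := 𝓘(ℝ, E × (E [⋀^Fin n]→L[ℝ] ℝ)))
    (I'' := 𝓘(ℝ, ℝ)) (g := fun y => 𝓗 ((extChartAt (formModel n E) m₀).symm y))
    (fibreIncl n E q p) h1.mdifferentiableAt (mdifferentiableAt_extChartAt (I := formModel n E) hm'')
  have h3 : (fun y => 𝓗 ((extChartAt (formModel n E) m₀).symm y)) ∘
      extChartAt (formModel n E) m₀ =ᶠ[𝓝 (fibreIncl n E q p)] 𝓗 := by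
    filter_upwards [(isOpen_extChartAt_source m₀).mem_nhds hm'] with m hm
    exact congrArg 𝓗 ((extChartAt (formModel n E) m₀).left_inv hm)
  rw [h3.mfderiv_eq, mfderiv_eq_fderiv] at h2
  rw [← h𝓗.mfderiv_verticalLift hn hL hM hp hz η, h2]
  exact (congrArg (fderiv ℝ (fun y => 𝓗 ((extChartAt (formModel n E) m₀).symm y))
    (extChartAt (formModel n E) m₀ (fibreIncl n E q p)))
    (mfderiv_extChartAt_verticalLift m₀ hq p η)).symm

end PointwiseVariation

/-! ### The first variation of the action density under a conormal shift -/

section PointwiseTransfer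

variable {n : ℕ} {E : Type*} [NormedAddCommGroup E] [NormedSpace ℝ E] [FiniteDimensional ℝ E]
  {N : Type*} [TopologicalSpace N] [ChartedSpace E N] [IsManifold 𝓘(ℝ, E) ∞ N]
  {vol : ∀ q : N, Form n E q} {L : ∀ q : N, MultiVec n E q → ℝ}
  {M D Γ : Set (FormBundle n E N)} {𝓗 : FormBundle n E N → ℝ}
  {g : ∀ m : FormBundle n E N, Form n E m.proj}

/-- The Legendre image along a smooth curve, in coordinates. -/
theorem IsLegendreImage.exists_curve (h𝓗 : IsLegendreImage vol L M 𝓗) (hn : 1 ≤ n)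
    (hL : IsSmoothLagrangian vol L) (hM : IsOpen M) {m : ℝ → FormBundle n E N} (hm0 : m 0 ∈ M)
    (hm : ∀ᶠ t in 𝓝 0, ContMDiffAt 𝓘(ℝ, ℝ) (formModel n E) ∞ m t) :
    ∃ c : ℝ → (E [⋀^Fin n]→L[ℝ] ℝ) →L[ℝ] ℝ, (∀ᶠ t in 𝓝 0, ContDiffAt ℝ ∞ c t) ∧
      (∀ᶠ t in 𝓝 0, ∃ v : Fin n → E, altEval v = c t) ∧
      ∀ᶠ t in 𝓝 0, ∀ z ∈ legendreZ vol L (m t).proj (m t).snd, ∀ η : Form n E (m t).proj,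
        c t (formCoord (m 0).proj ⟨(m t).proj, η⟩) = pairing z η := by
  obtain ⟨m₀, hm₀⟩ : ∃ m₀, m₀ = m 0 := ⟨_, rfl⟩
  rw [← hm₀]
  have hcont := hm.self_of_nhds.continuousAt
  have hev : ∀ᶠ t in 𝓝 0, ContMDiffAt 𝓘(ℝ, ℝ) (formModel n E) ∞ m t ∧ m t ∈ M ∧
      (m t).proj ∈ (chartAt E m₀.proj).source := by
    have hQ : IsOpen {m : FormBundle n E N | m.proj ∈ (chartAt E m₀.proj).source} :=
      (chartAt E m₀.proj).open_source.preimage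
        (contMDiff_proj (n := ∞) (IB := 𝓘(ℝ, E)) (fun q : N => Form n E q)).continuous
    refine hm.and ((hcont.eventually (hM.mem_nhds hm0)).and (hcont.eventually (hQ.mem_nhds ?_)))
    rw [← hm₀]
    exact mem_chart_source E _
  let h : E × (E [⋀^Fin n]→L[ℝ] ℝ) → ℝ := fun y => 𝓗 ((extChartAt (formModel n E) m₀).symm y)
  -- The Legendre image along `m` is the vertical differential of `𝓗` in the chart. Its smoothness
  -- thus comes from that of `𝓗`, and no regularity of the Legendre map is required.
  let c : ℝ → (E [⋀^Fin n]→L[ℝ] ℝ) →L[ℝ] ℝ := fun t =>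
    (fderiv ℝ h (extChartAt (formModel n E) m₀ (m t))).comp
      (ContinuousLinearMap.inr ℝ E (E [⋀^Fin n]→L[ℝ] ℝ))
  have hval : ∀ t, m t ∈ M → (m t).proj ∈ (chartAt E m₀.proj).source →
      ∀ z ∈ legendreZ vol L (m t).proj (m t).snd, ∀ η : Form n E (m t).proj,
        c t (formCoord m₀.proj ⟨(m t).proj, η⟩) = pairing z η := fun t htM htq z hz η =>
    h𝓗.fderiv_comp_extChartAt_symm hn hL hM m₀ (p := (m t).snd) htM htq hz η
  refine ⟨c, ?_, ?_, ?_⟩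
  · filter_upwards [hev] with t ⟨ht, htM, htq⟩
    refine contDiffAt_clm_of_apply fun p => ?_
    have h1 : ContDiffAt ℝ ∞ (fun t => extChartAt (formModel n E) m₀ (m t)) t := by
      refine ContMDiffAt.contDiffAt (ContMDiffAt.comp t (contMDiffAt_extChartAt' ?_) ht)
      have := mem_chartAt_formBundle_source_iff.2 htq
      rwa [extChartAt_source] at this
    have h2 := ((h𝓗.contDiffAt_comp_extChartAt_symm hM m₀ htM htq).fderiv_right (m := ∞)
      (by simp)).comp t h1
    exact h2.clm_apply contDiffAt_const
  · filter_upwards [hev] with t ⟨ht, htM, htq⟩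
    obtain ⟨z, hz, -⟩ := h𝓗.existsUnique _ htM
    obtain ⟨v, hv⟩ := hz.1.1
    refine ⟨fun i => tangentCoord m₀.proj (m t).proj (v i), ContinuousLinearMap.ext fun p => ?_⟩
    have h1 := hval t htM htq z hz (coordForm m₀.proj (m t).proj p)
    rw [formCoord_coordForm htq, ← hv] at h1
    exact h1.symm
  · filter_upwards [hev] with t ⟨ht, htM, htq⟩ using hval t htM htq

/-- The displacement `η t` of the momentum is conormal at the Legendre image of `m t` for every
small `t`, so the smooth curve `c` of Legendre images satisfies `c t (η t) = 0`. At `t = 0` the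
frame `f` spans a multiple of that image, as `hasDerivAt_apply_conormal` requires. -/
theorem IsConormalShift.hasDerivAt_formCoord_sub_apply (h : IsConormalShift vol L M D g)
    (h𝓗 : IsLegendreImage vol L M 𝓗) (hn : 1 ≤ n) (hL : IsSmoothLagrangian vol L) (hM : IsOpen M)
    {m : ℝ → FormBundle n E N} (hm0 : m 0 ∈ D)
    (hm : ∀ᶠ t in 𝓝 0, ContMDiffAt 𝓘(ℝ, ℝ) (formModel n E) ∞ m t)
    {f : ℝ → Fin n → E} (hf : ∀ᶠ t in 𝓝 0, ContDiffAt ℝ ∞ f t) {r : ℝ} (hr : r ≠ 0)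
    {z : MultiVec n E (m 0).proj} (hz : z ∈ legendreZ vol L (m 0).proj (m 0).snd)
    (hf0 : (altEval (f 0) : (E [⋀^Fin n]→L[ℝ] ℝ) →L[ℝ] ℝ) = r • z) :
    HasDerivAt (fun t => (formCoord (m 0).proj (fibreMap g (m t)) -
      formCoord (m 0).proj (m t)) (f t)) 0 0 := by
  obtain ⟨c, hc, hd, hcz⟩ := h𝓗.exists_curve hn hL hM (h.subset hm0) hm
  have hcont := hm.self_of_nhds.continuousAt
  have hsub : ∀ t, formCoord (m 0).proj (fibreMap g (m t)) - formCoord (m 0).proj (m t) =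
      formCoord (m 0).proj (⟨(m t).proj, g (m t) - (m t).snd⟩ : FormBundle n E N) := fun t =>
    (formCoord_sub _ _ _ _).symm
  obtain ⟨z₁, hz₁, hzη⟩ := h.conormal _ hm0
  obtain rfl : z₁ = z := (h𝓗.existsUnique _ (h.subset hm0)).unique hz₁ hz
  refine hasDerivAt_apply_conormal (q := (m 0).proj) hn ?_ ?_ hf hr hf0 hc hd ?_ ?_
  · rw [hsub]
    have h1 : formCoord (m 0).proj (⟨(m 0).proj, g (m 0) - (m 0).snd⟩ : FormBundle n E N) =
      g (m 0) - (m 0).snd := formCoord_self _ _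
    rw [h1]
    exact hzη
  · have hq : (m 0).proj ∈ (chartAt E (m 0).proj).source := mem_chart_source E _
    have h1 := ((contMDiffAt_formCoord hq).comp (0 : ℝ) hm.self_of_nhds).contDiffAt
    have h2 := ((contMDiffAt_formCoord (m := fibreMap g (m 0)) hq).comp (0 : ℝ)
      ((h.smooth.contMDiffAt (h.isOpen.mem_nhds hm0)).comp (0 : ℝ) hm.self_of_nhds)).contDiffAt
    exact h2.sub h1
  · refine ContinuousLinearMap.ext fun p => ?_
    have h1 := hcz.self_of_nhds z₁ hz p
    have h2 : formCoord (m 0).proj (⟨(m 0).proj, p⟩ : FormBundle n E N) = p := formCoord_self _ _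
    exact (congrArg (c 0) h2).symm.trans h1
  · filter_upwards [hcz, hcont.eventually (h.isOpen.mem_nhds hm0)] with t ht htD
    rw [hsub]
    obtain ⟨z', hz', hη'⟩ := h.conormal _ htD
    exact (ht z' hz' _).trans (pairing_conormal_self hn hz'.1.1 hη')

/-- Conormal shifts do not change the first variation of the action at points where the projection
of the tangent plane is the Legendre image. -/
theorem IsConormalShift.deriv_actionForm_eq (h : IsConormalShift vol L M D g)
    (h𝓗 : IsLegendreImage vol L M 𝓗) (hn : 1 ≤ n) (hL : IsSmoothLagrangian vol L) (hM : IsOpen M)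
    (hvol : IsSmoothForm vol) {μ : ℝ → (Fin n → ℝ) → FormBundle n E N} {x : Fin n → ℝ}
    (hμ : ∀ᶠ t in 𝓝 (0 : ℝ), ContMDiffAt 𝓘(ℝ, ℝ × (Fin n → ℝ)) (formModel n E) ∞
      (fun z => μ z.1 z.2) (t, x)) (hμ0 : μ 0 x ∈ D) {r : ℝ} (hr : r ≠ 0)
    {z : MultiVec n E (μ 0 x).proj} (hz : z ∈ legendreZ vol L (μ 0 x).proj (μ 0 x).snd)
    (hw : wedge (project (μ 0 x) (partials (μ 0) x)) = r • z) :
    deriv (fun t => actionForm vol 𝓗 (fibreMap g (μ t x))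
      (partials (fun y => fibreMap g (μ t y)) x)) 0 =
      deriv (fun t => actionForm vol 𝓗 (μ t x) (partials (μ t) x)) 0 := by
  have hι : ∀ t : ℝ, ContDiffAt ℝ ∞ (fun t : ℝ => (t, x)) t := fun t =>
    contDiffAt_id.prodMk contDiffAt_const
  have hm : ∀ᶠ t in 𝓝 (0 : ℝ), ContMDiffAt 𝓘(ℝ, ℝ) (formModel n E) ∞ (fun t => μ t x) t := by
    filter_upwards [hμ] with t ht
    exact ContMDiffAt.comp (g := fun z : ℝ × (Fin n → ℝ) => μ z.1 z.2) t ht (hι t).contMDiffAt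
  obtain ⟨q₀, hq₀⟩ : ∃ q₀, q₀ = (μ 0 x).proj := ⟨_, rfl⟩
  have hQ : IsOpen {m : FormBundle n E N | m.proj ∈ (chartAt E q₀).source} :=
    (chartAt E q₀).open_source.preimage
      (contMDiff_proj (n := ∞) (IB := 𝓘(ℝ, E)) (fun q : N => Form n E q)).continuous
  have hμQ : (μ 0 x).proj ∈ (chartAt E q₀).source := by
    rw [← hq₀]
    exact mem_chart_source E q₀
  have hcont := hm.self_of_nhds.continuousAt
  have hev := hμ.and ((hcont.eventually (h.isOpen.mem_nhds hμ0)).and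
    (hcont.eventually (hQ.mem_nhds hμQ)))
  have hf : ∀ᶠ t in 𝓝 (0 : ℝ), ContDiffAt ℝ ∞ (fun t => frameCoord q₀ μ (t, x)) t := by
    filter_upwards [hev] with t ⟨ht, _, htQ⟩
    exact (contDiffAt_frameCoord ht htQ).comp t (hι t)
  have hX : ∀ t, ContMDiffAt 𝓘(ℝ, ℝ × (Fin n → ℝ)) (formModel n E) ∞ (fun z => μ z.1 z.2) (t, x) →
      (μ t x).proj ∈ (chartAt E q₀).source → ∀ p : Form n E (μ t x).proj,
      p (project (μ t x) (partials (μ t) x)) =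
        formCoord q₀ ⟨(μ t x).proj, p⟩ (frameCoord q₀ μ (t, x)) := fun t ht htQ p =>
    apply_project_partials (ht.of_le (by simp)) htQ p
  have hder : HasDerivAt (fun t => (formCoord q₀ (fibreMap g (μ t x)) -
      formCoord q₀ (μ t x)) (frameCoord q₀ μ (t, x))) 0 0 := by
    have h1 := h.hasDerivAt_formCoord_sub_apply h𝓗 hn hL hM (m := fun t => μ t x) hμ0 hm hf hr
      hz ?_
    · rw [← hq₀] at h1
      exact h1
    · refine ContinuousLinearMap.ext fun p => ?_
      have h2 := hX 0 hμ.self_of_nhds hμQ p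
      have h3 : formCoord q₀ (⟨(μ 0 x).proj, p⟩ : FormBundle n E N) = p := by
        rw [← hq₀]; exact formCoord_self _ _
      rw [h3] at h2
      exact h2.symm.trans (congrArg (fun w : MultiVec n E (μ 0 x).proj => w p) hw)
  have hact : DifferentiableAt ℝ (fun t => actionForm vol 𝓗 (μ t x) (partials (μ t) x)) 0 := by
    have h1 := contDiffAt_actionForm hvol hμ.self_of_nhds
      (h𝓗.smooth.contMDiffAt (hM.mem_nhds (h.subset hμ0)))
    exact (ContDiffAt.comp (f := fun t : ℝ => (t, x)) (0 : ℝ) h1 (hι 0)).differentiableAt (by simp)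
  -- The shift preserves `𝓗` and the base point, so the two densities differ only by the
  -- displacement of the momentum evaluated on the projected frame, whose derivative at `0` is zero
  -- by `hder`.
  have hsum := hact.hasDerivAt.add hder
  rw [add_zero] at hsum
  refine (hsum.congr_of_eventuallyEq ?_).deriv
  filter_upwards [hev] with t ⟨ht, htD, htQ⟩
  have h1 : ContMDiffAt 𝓘(ℝ, Fin n → ℝ) (formModel n E) ∞ (μ t) x :=
    ContMDiffAt.comp (g := fun z : ℝ × (Fin n → ℝ) => μ z.1 z.2) x ht
      (contDiffAt_const.prodMk contDiffAt_id).contMDiffAt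
  have h2 : ContMDiffAt 𝓘(ℝ, Fin n → ℝ) (formModel n E) ∞ (fun y => fibreMap g (μ t y)) x :=
    (h.smooth.contMDiffAt (h.isOpen.mem_nhds htD)).comp x h1
  have h3 : actionForm vol 𝓗 (fibreMap g (μ t x)) (partials (fun y => fibreMap g (μ t y)) x) =
      g (μ t x) (project (μ t x) (partials (μ t) x)) -
        𝓗 (fibreMap g (μ t x)) * volumeForm vol (μ t x) (partials (μ t) x) :=
    actionForm_of_proj (h1.mdifferentiableAt (by simp)) (P := fun y => g (μ t y))
      (h2.mdifferentiableAt (by simp))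
  have h4 : (g (μ t x) (project (μ t x) (partials (μ t) x)) : ℝ) =
      formCoord q₀ (fibreMap g (μ t x)) (frameCoord q₀ μ (t, x)) := hX t ht htQ _
  have h5 : poincareCartan (μ t x) (partials (μ t) x) =
      formCoord q₀ (μ t x) (frameCoord q₀ μ (t, x)) := hX t ht htQ _
  change _ = actionForm vol 𝓗 (μ t x) (partials (μ t) x) +
    (formCoord q₀ (fibreMap g (μ t x)) (frameCoord q₀ μ (t, x)) -
      formCoord q₀ (μ t x) (frameCoord q₀ μ (t, x)))
  rw [h3, h4, h.hamiltonian_eq h𝓗 hn htD, actionForm, h5]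
  ring

end PointwiseTransfer

/-! ### Conjugation of variations and patch systems by a conormal shift -/

section Transfer

variable {n : ℕ} {E : Type*} [NormedAddCommGroup E] [NormedSpace ℝ E]
  {N : Type*} [TopologicalSpace N] [ChartedSpace E N] [IsManifold 𝓘(ℝ, E) ∞ N]
  {vol : ∀ q : N, Form n E q} {L : ∀ q : N, MultiVec n E q → ℝ}
  {M D D' Γ K : Set (FormBundle n E N)} {𝓗 : FormBundle n E N → ℝ}
  {g g' : ∀ m : FormBundle n E N, Form n E m.proj}

theorem actionForm_congr_of_eventuallyEq {μ ν : (Fin n → ℝ) → FormBundle n E N} {x : Fin n → ℝ}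
    (h : μ =ᶠ[𝓝 x] ν) :
    actionForm vol 𝓗 (μ x) (partials μ x) = actionForm vol 𝓗 (ν x) (partials ν x) := by
  have h1 : ∀ (m m' : FormBundle n E N) (X : Fin n → E × (E [⋀^Fin n]→L[ℝ] ℝ)), m = m' →
      actionForm vol 𝓗 m X = actionForm vol 𝓗 m' X := by
    rintro m _ X rfl
    rfl
  have h2 : (partials μ x : Fin n → E × (E [⋀^Fin n]→L[ℝ] ℝ)) = partials ν x := by
    funext i
    exact congrArg (fun B : (Fin n → ℝ) →L[ℝ] E × (E [⋀^Fin n]→L[ℝ] ℝ) => B (Pi.single i 1))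
      (h.mfderiv_eq (I := 𝓘(ℝ, Fin n → ℝ)) (I' := formModel n E))
  exact (h1 _ _ _ h.self_of_nhds).trans (congrArg (actionForm vol 𝓗 (ν x)) h2)

/-- The map `φ'⁻¹ ∘ f ∘ φ` on `D`, extended by the identity, where `φ` has the fibre component `g`
and `φ'⁻¹` has the fibre component `g'`. -/
noncomputable def conjugate (D : Set (FormBundle n E N))
    (g g' : ∀ m : FormBundle n E N, Form n E m.proj) (f : FormBundle n E N → FormBundle n E N)
    (m : FormBundle n E N) : FormBundle n E N :=
  open Classical in if m ∈ D then fibreMap g' (f (fibreMap g m)) else m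

omit [IsManifold 𝓘(ℝ, E) ∞ N] in
theorem conjugate_of_mem {f : FormBundle n E N → FormBundle n E N} {m : FormBundle n E N}
    (hm : m ∈ D) : conjugate D g g' f m = fibreMap g' (f (fibreMap g m)) := if_pos hm

omit [IsManifold 𝓘(ℝ, E) ∞ N] in
theorem conjugate_of_notMem {f : FormBundle n E N → FormBundle n E N} {m : FormBundle n E N}
    (hm : m ∉ D) : conjugate D g g' f m = m := if_neg hm

theorem IsConormalShiftPair.mem_image_of_mem (h : IsConormalShiftPair vol L M D D' g g')
    {m : FormBundle n E N} (hm : m ∈ D) (hK : fibreMap g m ∈ K) : m ∈ fibreMap g' '' K :=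
  ⟨fibreMap g m, hK, h.leftInv m hm⟩

theorem IsConormalShiftPair.isCompact_image (h : IsConormalShiftPair vol L M D D' g g')
    (hK : IsCompact K) (hKD : K ⊆ D') : IsCompact (fibreMap g' '' K) :=
  hK.image_of_continuousOn (h.right.smooth.continuousOn.mono hKD)

/-- The conjugate is the identity off the compact, hence closed, image of `K`, which lies in `D`;
therefore the extension by the identity is smooth. The assumption that `Φ s` preserves `D'` is
needed for the inverse shift to be applicable after `Φ s`. -/
theorem IsConormalShiftPair.isVariation_conjugate [T2Space N]
    (h : IsConormalShiftPair vol L M D D' g g')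
    {Φ : ℝ → FormBundle n E N → FormBundle n E N} (hΦ : IsVariation D' K Φ)
    (hD' : ∀ s, MapsTo (Φ s) D' D') :
    IsVariation M (fibreMap g' '' K) fun s => conjugate D g g' (Φ s) := by
  have hc : IsCompact (fibreMap g' '' K) := h.isCompact_image hΦ.isCompact hΦ.subset
  have hself : ∀ s, ∀ m ∉ fibreMap g' '' K, conjugate D g g' (Φ s) m = m := fun s m hm => by
    by_cases hmD : m ∈ D
    · rw [conjugate_of_mem hmD, hΦ.eq_self s _ fun hK => hm (h.mem_image_of_mem hmD hK),
        h.leftInv m hmD]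
    · exact conjugate_of_notMem hmD
  refine ⟨hc, ?_, ?_, fun m => ?_, hself⟩
  · rintro _ ⟨m, hm, rfl⟩
    exact h.left.subset (h.mapsTo' (hΦ.subset hm))
  · rintro ⟨s, m⟩
    by_cases hm : m ∈ D
    · have h1 : ContMDiffAt (𝓘(ℝ, ℝ).prod (formModel n E)) (formModel n E) ∞
          (fun x : ℝ × FormBundle n E N => fibreMap g x.2) (s, m) :=
        ContMDiffAt.comp (s, m) (h.left.contMDiffAt (m := ((s, m) : ℝ × FormBundle n E N).2) hm)
          contMDiffAt_snd
      have h2 : ContMDiffAt (𝓘(ℝ, ℝ).prod (formModel n E)) (formModel n E) ∞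
          (fun x : ℝ × FormBundle n E N => Φ x.1 (fibreMap g x.2)) (s, m) :=
        ContMDiffAt.comp (g := fun x : ℝ × FormBundle n E N => Φ x.1 x.2)
          (f := fun x : ℝ × FormBundle n E N => (x.1, fibreMap g x.2)) (s, m)
          hΦ.smooth.contMDiffAt (contMDiffAt_fst.prodMk h1)
      have h3 : ContMDiffAt (𝓘(ℝ, ℝ).prod (formModel n E)) (formModel n E) ∞
          (fun x : ℝ × FormBundle n E N => fibreMap g' (Φ x.1 (fibreMap g x.2))) (s, m) :=
        ContMDiffAt.comp (g := fibreMap g') (s, m)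
          (h.right.contMDiffAt (m := Φ s (fibreMap g m)) (hD' s (h.mapsTo hm))) h2
      refine h3.congr_of_eventuallyEq ?_
      filter_upwards [(h.left.isOpen.preimage continuous_snd).mem_nhds hm] with x hx
      exact conjugate_of_mem hx
    · have hmK : m ∉ fibreMap g' '' K := by
        rintro ⟨m', hm', rfl⟩
        exact hm (h.mapsTo' (hΦ.subset hm'))
      refine (contMDiffAt_snd (I := 𝓘(ℝ, ℝ)) (J := formModel n E)).congr_of_eventuallyEq ?_
      filter_upwards [(hc.isClosed.isOpen_compl.preimage continuous_snd).mem_nhds hmK] with x hx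
      exact hself x.1 x.2 hx
  · by_cases hmD : m ∈ D
    · rw [conjugate_of_mem hmD, hΦ.zero, h.leftInv m hmD]
    · exact conjugate_of_notMem hmD

theorem IsConormalShiftPair.contMDiff_indicator [T2Space N]
    (h : IsConormalShiftPair vol L M D D' g g') (hK : IsCompact K) (hKD : K ⊆ D')
    {f : FormBundle n E N → ℝ} (hf : ContMDiff (formModel n E) 𝓘(ℝ, ℝ) ∞ f)
    (hf0 : ∀ m ∉ K, f m = 0) :
    ContMDiff (formModel n E) 𝓘(ℝ, ℝ) ∞ (D.indicator fun m => f (fibreMap g m)) := by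
  intro m
  by_cases hm : m ∈ D
  · refine ((hf _).comp m (h.left.contMDiffAt hm)).congr_of_eventuallyEq ?_
    filter_upwards [h.left.isOpen.mem_nhds hm] with m' hm' using indicator_of_mem hm' _
  · have hmK : m ∉ fibreMap g' '' K := by
      rintro ⟨m', hm', rfl⟩
      exact hm (h.mapsTo' (hKD hm'))
    refine (contMDiffAt_const (c := (0 : ℝ))).congr_of_eventuallyEq ?_
    filter_upwards [(h.isCompact_image hK hKD).isClosed.isOpen_compl.mem_nhds hmK] with m' hm'
    by_cases hmD : m' ∈ D
    · rw [indicator_of_mem hmD, hf0 _ fun h1 => hm' (h.mem_image_of_mem hmD h1)]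
    · exact indicator_of_notMem hmD _

/-- The patch system that corresponds to a patch system of the image under a conormal shift. -/
noncomputable def IsConormalShiftPair.pullbackPatchSystem [T2Space N]
    (h : IsConormalShiftPair vol L M D D' g g') (P : PatchSystem vol (fibreMap g '' (Γ ∩ D)) K)
    {K₂ : Set (FormBundle n E N)} (hK₂ : IsCompact K₂) (hKD : K₂ ⊆ D')
    {ρ : FormBundle n E N → ℝ} (hρ : ContMDiff (formModel n E) 𝓘(ℝ, ℝ) ∞ ρ)
    (hρ0 : ∀ m ∉ K₂, ρ m = 0)
    (hρ1 : ∀ i, ∀ m ∈ fibreMap g '' (Γ ∩ D), P.weight i m ≠ 0 → ρ m = 1) :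
    PatchSystem vol Γ (fibreMap g' '' (K ∩ K₂)) where
  num := P.num
  dom := P.dom
  param i x := fibreMap g' (P.param i x)
  isPatch i := h.isPositivePatch_of_image (P.isPatch i)
  weight i := D.indicator fun m => ρ (fibreMap g m) * P.weight i (fibreMap g m)
  weight_smooth i := h.contMDiff_indicator (f := fun m => ρ m * P.weight i m) hK₂ hKD
    (hρ.mul (P.weight_smooth i)) fun m hm => by rw [hρ0 m hm, zero_mul]
  weight_support i := by
    obtain ⟨C, hCU, hC, hC0⟩ := P.weight_support i
    refine ⟨C, hCU, hC, fun m hm hmC => ?_⟩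
    by_cases hmD : m ∈ D
    · rw [indicator_of_mem hmD, hC0 _ (Set.mem_image_of_mem _ ⟨hm, hmD⟩), mul_zero]
      rintro ⟨x, hx, hxm⟩
      refine hmC ⟨x, hx, ?_⟩
      beta_reduce
      rw [hxm, h.leftInv m hmD]
    · exact indicator_of_notMem hmD _
  sum_weight := by
    rintro _ ⟨hm, m, hmK, rfl⟩
    have hmD' := hKD hmK.2
    have h1 := h.mapsTo' hmD'
    have hmΓ : m ∈ fibreMap g '' (Γ ∩ D) := ⟨fibreMap g' m, ⟨hm, h1⟩, h.rightInv m hmD'⟩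
    simp only [indicator_of_mem h1, h.rightInv m hmD']
    rw [← P.sum_weight m ⟨hmΓ, hmK.1⟩]
    refine Finset.sum_congr rfl fun i _ => ?_
    by_cases h0 : P.weight i m = 0
    · rw [h0, mul_zero]
    · rw [hρ1 i m hmΓ h0, one_mul]

variable [FiniteDimensional ℝ E] [T2Space N] [SecondCountableTopology N]

/-- The relation holds on the critical `Γ`, for the patch pulled back by the inverse shift. The
shift changes neither the projected frames nor the Legendre images, so the relation carries over to
the image of `Γ`. -/
theorem IsConormalShiftPair.exists_wedge_partials_eq
    (h : IsConormalShiftPair vol L M D D' g g') (h𝓗 : IsLegendreImage vol L M 𝓗) (hn : 1 ≤ n)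
    (hL : IsSmoothLagrangian vol L) (hvol : IsSmoothForm vol) (hM : IsOpen M) (hΓM : Γ ⊆ M)
    (hΓ : IsCriticalPoint vol 𝓗 M Γ) {U : Set (Fin n → ℝ)} {γ : (Fin n → ℝ) → FormBundle n E N}
    (hγ : IsPositivePatch vol (fibreMap g '' (Γ ∩ D)) U γ) {x : Fin n → ℝ} (hx : x ∈ U) :
    ∃ r : ℝ, r ≠ 0 ∧ ∃ z ∈ legendreZ vol L (γ x).proj (γ x).snd,
      wedge (project (γ x) (partials γ x)) = r • z := by
  have hγ' := h.isPositivePatch_of_image hγ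
  have hxD : γ x ∈ D' := by
    obtain ⟨m, hm, h2⟩ := hγ.mem hx
    rw [← h2]
    exact h.mapsTo hm.2
  obtain ⟨z, hz, hz', -⟩ := h.right.legendreZ_mem hxD
  have h1 := h𝓗.wedge_partials_eq hn hL hvol hM hΓM hΓ hγ' hx (z := z) hz'
  have h2 := project_partials_of_proj ((hγ.contMDiffAt hx).mdifferentiableAt (by simp))
    (P := fun y => g' (γ y)) ((hγ'.contMDiffAt hx).mdifferentiableAt (by simp))
  exact ⟨_, (hγ'.pos x hx).ne', z, hz, (congrArg wedge h2).symm.trans h1⟩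

end Transfer

/-! ### Conormal shifts preserve Hamiltonian curves -/

section Critical

variable {n : ℕ} {E : Type*} [NormedAddCommGroup E] [NormedSpace ℝ E] [FiniteDimensional ℝ E]
  {N : Type*} [TopologicalSpace N] [T2Space N] [SecondCountableTopology N] [ChartedSpace E N]
  [IsManifold 𝓘(ℝ, E) ∞ N]
  {vol : ∀ q : N, Form n E q} {L : ∀ q : N, MultiVec n E q → ℝ}
  {M D D' Γ K T : Set (FormBundle n E N)} {𝓗 : FormBundle n E N → ℝ}
  {g g' : ∀ m : FormBundle n E N, Form n E m.proj}

/-- A variation can be cut off to a neighbourhood of a compact set, and then slowed down so that it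
preserves this neighbourhood. -/
theorem IsVariation.exists_cutoff {Φ : ℝ → FormBundle n E N → FormBundle n E N}
    (hΦ : IsVariation M K Φ) (hT : IsCompact T) (hD : IsOpen D) (hTD : T ⊆ D) :
    ∃ (K₂ : Set (FormBundle n E N)) (ρ : FormBundle n E N → ℝ) (τ : ℝ → ℝ),
      IsCompact K₂ ∧ K₂ ⊆ D ∧ ContMDiff (formModel n E) 𝓘(ℝ, ℝ) ∞ ρ ∧ (∀ m ∉ K₂, ρ m = 0) ∧
      (∀ m ∈ T, ∀ᶠ m' in 𝓝 m, ρ m' = 1) ∧ τ 0 = 0 ∧ HasDerivAt τ 1 0 ∧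
      IsVariation D (K ∩ K₂) (fun s m => Φ (τ s * ρ m) m) ∧
      ∀ s, MapsTo (fun m => Φ (τ s * ρ m) m) D D := by
  have : LocallyCompactSpace (FormBundle n E N) :=
    Manifold.locallyCompact_of_finiteDimensional (formModel n E)
  obtain ⟨K₂, hK₂, hTK, hKD⟩ := exists_compact_between hT hD hTD
  obtain ⟨ρ, hρ, hρ1, hρ0, hρI⟩ := exists_bump hT.isClosed isOpen_interior hTK
  have hρ0 : ∀ m ∉ K₂, ρ m = 0 := fun m hm => hρ0 m fun h => hm (interior_subset h)
  have hO : IsOpen ((fun x : ℝ × FormBundle n E N => Φ x.1 x.2) ⁻¹' D) :=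
    hD.preimage hΦ.smooth.continuous
  -- By the tube lemma `Φ s` maps the compact set `K₂` into `D` for `|s| < δ`. Since `|τ| < δ` and
  -- `0 ≤ ρ ≤ 1`, the slowed variation uses only such parameters on `K₂`, and it is the identity off
  -- `K₂`.
  obtain ⟨u, v, hu, -, h0u, hKv, huv⟩ := generalized_tube_lemma (isCompact_singleton (x := (0 : ℝ)))
    hK₂ hO (by
      rintro ⟨s, m⟩ ⟨hs, hm⟩
      obtain rfl : s = 0 := hs
      change Φ 0 m ∈ D
      rw [hΦ.zero]
      exact hKD hm)
  obtain ⟨δ, hδ, hδu⟩ := Metric.isOpen_iff.1 hu 0 (h0u (mem_singleton 0))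
  obtain ⟨τ, hτ, hτ0, hτ1, hτδ⟩ := exists_bounded_reparam hδ
  have hself : ∀ s, ∀ m ∉ K₂, Φ (τ s * ρ m) m = m := fun s m hm => by
    rw [hρ0 m hm, mul_zero, hΦ.zero]
  refine ⟨K₂, ρ, τ, hK₂, hKD, hρ, hρ0, fun m hm => hρ1.filter_mono (nhds_le_nhdsSet hm), hτ0, hτ1,
    ⟨hΦ.isCompact.inter hK₂, inter_subset_right.trans hKD, ?_, fun m => ?_, fun s m hm => ?_⟩,
    fun s m hm => ?_⟩
  · have h1 : ContMDiff (𝓘(ℝ, ℝ).prod (formModel n E)) (𝓘(ℝ, ℝ).prod (formModel n E)) ∞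
        (fun x : ℝ × FormBundle n E N => (τ x.1 * ρ x.2, x.2)) :=
      ((hτ.contMDiff.comp contMDiff_fst).mul (hρ.comp contMDiff_snd)).prodMk contMDiff_snd
    exact hΦ.smooth.comp h1
  · rw [hτ0, zero_mul, hΦ.zero]
  · by_cases hmK : m ∈ K
    · exact hself s m fun h => hm ⟨hmK, h⟩
    · exact hΦ.eq_self _ m hmK
  · by_cases hmK : m ∈ K₂
    · refine huv (a := (τ s * ρ m, m)) ⟨hδu ?_, hKv hmK⟩
      rw [mem_ball_zero_iff, norm_mul]
      refine lt_of_le_of_lt (mul_le_of_le_one_right (norm_nonneg _) ?_) (hτδ s)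
      rw [Real.norm_of_nonneg (hρI m).1]
      exact (hρI m).2
    · change Φ (τ s * ρ m) m ∈ D
      rwa [hself s m hmK]

omit [T2Space N] [SecondCountableTopology N] in
-- Near `γ x` the cutoff `ρ` is `1`, so along the pulled back patch the conjugate is the inverse
-- shift applied to `Φ (τ s)`. The derivative of `τ` at `0` is `1`, so slowing down does not affect
-- the first variation, and the inverse shift does not either by
-- `IsConormalShift.deriv_actionForm_eq`.
theorem IsConormalShiftPair.deriv_actionForm_conjugate
    (h : IsConormalShiftPair vol L M D D' g g') (h𝓗 : IsLegendreImage vol L M 𝓗) (hn : 1 ≤ n)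
    (hL : IsSmoothLagrangian vol L) (hvol : IsSmoothForm vol) (hM : IsOpen M)
    {γ : (Fin n → ℝ) → FormBundle n E N} {x : Fin n → ℝ}
    (hγ : ContMDiffAt 𝓘(ℝ, Fin n → ℝ) (formModel n E) ∞ γ x) (hx : γ x ∈ D')
    (hw : ∃ r : ℝ, r ≠ 0 ∧ ∃ z ∈ legendreZ vol L (γ x).proj (γ x).snd,
      wedge (project (γ x) (partials γ x)) = r • z)
    {Φ : ℝ → FormBundle n E N → FormBundle n E N}
    (hΦ : ContMDiff (𝓘(ℝ, ℝ).prod (formModel n E)) (formModel n E) ∞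
      (fun x : ℝ × FormBundle n E N => Φ x.1 x.2)) (hΦ0 : ∀ m, Φ 0 m = m)
    {ρ : FormBundle n E N → ℝ} (hρ : ∀ᶠ m in 𝓝 (γ x), ρ m = 1) {τ : ℝ → ℝ} (hτ0 : τ 0 = 0)
    (hτ : HasDerivAt τ 1 0) :
    deriv (fun s => actionForm vol 𝓗
      (conjugate D g g' (fun m => Φ (τ s * ρ m) m) (fibreMap g' (γ x)))
      (partials (fun y => conjugate D g g' (fun m => Φ (τ s * ρ m) m) (fibreMap g' (γ y))) x)) 0 =
      deriv (fun s => actionForm vol 𝓗 (Φ s (γ x)) (partials (fun y => Φ s (γ y)) x)) 0 := by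
  let b : ℝ → ℝ := fun s => actionForm vol 𝓗 (fibreMap g' (Φ s (γ x)))
    (partials (fun y => fibreMap g' (Φ s (γ y))) x)
  have h1 : ∀ s, actionForm vol 𝓗
      (conjugate D g g' (fun m => Φ (τ s * ρ m) m) (fibreMap g' (γ x)))
      (partials (fun y => conjugate D g g' (fun m => Φ (τ s * ρ m) m) (fibreMap g' (γ y))) x) =
      b (τ s) := fun s => by
    refine actionForm_congr_of_eventuallyEq
      (μ := fun y => conjugate D g g' (fun m => Φ (τ s * ρ m) m) (fibreMap g' (γ y)))
      (ν := fun y => fibreMap g' (Φ (τ s) (γ y))) ?_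
    filter_upwards [hγ.continuousAt.eventually hρ,
      hγ.continuousAt.eventually (h.right.isOpen.mem_nhds hx)] with y hy hyD
    rw [conjugate_of_mem (h.mapsTo' hyD), h.rightInv _ hyD, hy, mul_one]
  have hμ : ∀ s, ContMDiffAt 𝓘(ℝ, ℝ × (Fin n → ℝ)) (formModel n E) ∞
      (fun z : ℝ × (Fin n → ℝ) => Φ z.1 (γ z.2)) (s, x) := fun s =>
    contMDiffAt_comp_patch hΦ.contMDiffAt hγ
  have hx0 : Φ 0 (γ x) ∈ D' := by rwa [hΦ0]
  have hw0 : ∀ μ : (Fin n → ℝ) → FormBundle n E N, μ = γ → ∃ r : ℝ, r ≠ 0 ∧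
      ∃ z ∈ legendreZ vol L (μ x).proj (μ x).snd,
        wedge (project (μ x) (partials μ x)) = r • z := by
    rintro _ rfl
    exact hw
  obtain ⟨r, hr, z, hz, hwz⟩ := hw0 (fun y => Φ 0 (γ y)) (funext fun y => hΦ0 _)
  have hb : DifferentiableAt ℝ b 0 := by
    have h2 : ContMDiffAt 𝓘(ℝ, ℝ × (Fin n → ℝ)) (formModel n E) ∞
        (fun z : ℝ × (Fin n → ℝ) => fibreMap g' (Φ z.1 (γ z.2))) (0, x) :=
      ContMDiffAt.comp (g := fibreMap g') ((0 : ℝ), x)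
        (h.right.contMDiffAt (m := Φ ((0 : ℝ), x).1 (γ ((0 : ℝ), x).2)) hx0) (hμ 0)
    have h3 := contDiffAt_actionForm (μ := fun s y => fibreMap g' (Φ s (γ y))) (z₀ := (0, x)) hvol
      h2 (h𝓗.smooth.contMDiffAt (hM.mem_nhds (h.right.mapsTo hx0)))
    have h4 : ContDiffAt ℝ ∞ (fun s : ℝ => (s, x)) 0 := contDiffAt_id.prodMk contDiffAt_const
    exact (ContDiffAt.comp (f := fun s : ℝ => (s, x)) (0 : ℝ) h3 h4).differentiableAt (by simp)
  have hb' : HasDerivAt b (deriv b 0) (τ 0) := by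
    rw [hτ0]
    exact hb.hasDerivAt
  have h5 := (hb'.comp (0 : ℝ) hτ).deriv
  rw [mul_one] at h5
  simp only [h1]
  exact h5.trans (h.right.deriv_actionForm_eq h𝓗 hn hL hM hvol (μ := fun s y => Φ s (γ y))
    (Filter.Eventually.of_forall hμ) hx0 hr hz hwz)

/-- The image of a critical point of the action under a conormal shift is a critical point. -/
theorem IsConormalShiftPair.isCriticalPoint (h : IsConormalShiftPair vol L M D D' g g')
    (h𝓗 : IsLegendreImage vol L M 𝓗) (hn : 1 ≤ n) (hL : IsSmoothLagrangian vol L)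
    (hvol : IsSmoothForm vol) (hM : IsOpen M) (hΓM : Γ ⊆ M) (hΓ : IsCriticalPoint vol 𝓗 M Γ) :
    IsCriticalPoint vol 𝓗 M (fibreMap g '' (Γ ∩ D)) := by
  intro K Φ hΦ P
  have hΓD' : fibreMap g '' (Γ ∩ D) ⊆ D' := by
    rintro _ ⟨m, hm, rfl⟩
    exact h.mapsTo hm.2
  have hder := P.hasDerivAt_action hvol hM h𝓗.smooth (hΓD'.trans h.right.subset) hΦ.smooth hΦ.zero
  choose C hCU hC hC0 using P.weight_support
  have hT : IsCompact (⋃ i, P.param i '' C i) := isCompact_iUnion fun i =>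
    (hC i).image_of_continuousOn ((P.isPatch i).smooth.continuousOn.mono (hCU i))
  have hTD : ⋃ i, P.param i '' C i ⊆ D' := iUnion_subset fun i => by
    rintro _ ⟨x, hx, rfl⟩
    exact hΓD' ((P.isPatch i).mem (hCU i hx))
  -- The given variation may be supported partly outside `D'`, where the inverse shift is
  -- meaningless. It is therefore replaced by one that preserves `D'`; near the compact set that
  -- carries the weights the two agree up to the change of time `τ`.
  obtain ⟨K₂, ρ, τ, hK₂, hKD, hρ, hρ0, hρ1, hτ0, hτ, hΨ, hΨD⟩ :=
    hΦ.exists_cutoff hT h.right.isOpen hTD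
  have hΨM := h.isVariation_conjugate hΨ hΨD
  let P₀ := h.pullbackPatchSystem P hK₂ hKD hρ hρ0 fun i m hm hw =>
    (hρ1 m (mem_iUnion_of_mem i (by
      by_contra hmC
      exact hw (hC0 i m hm hmC)))).self_of_nhds
  have h0 := (hΓ _ _ hΨM P₀).unique (P₀.hasDerivAt_action hvol hM h𝓗.smooth hΓM hΨM.smooth
    hΨM.zero)
  -- The first variation of `Γ` under the conjugated family vanishes, and the integrands are
  -- compared patch by patch: on `C i` by the pointwise transfer, off `C i` because the weight is
  -- zero.
  refine hder.congr_deriv (Eq.symm (h0.trans ?_))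
  refine Finset.sum_congr rfl fun i _ =>
    MeasureTheory.setIntegral_congr_fun (P.isPatch i).isOpen.measurableSet fun x hx => ?_
  change D.indicator (fun m => ρ (fibreMap g m) * P.weight i (fibreMap g m))
      (fibreMap g' (P.param i x)) * deriv (fun s => actionForm vol 𝓗
        (conjugate D g g' (fun m => Φ (τ s * ρ m) m) (fibreMap g' (P.param i x)))
        (partials (fun y => conjugate D g g' (fun m => Φ (τ s * ρ m) m)
          (fibreMap g' (P.param i y))) x)) 0 =
    P.weight i (P.param i x) * deriv (fun s => actionForm vol 𝓗 (Φ s (P.param i x))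
      (partials (fun y => Φ s (P.param i y)) x)) 0
  have hxD : P.param i x ∈ D' := hΓD' ((P.isPatch i).mem hx)
  rw [indicator_of_mem (h.mapsTo' hxD), h.rightInv _ hxD]
  by_cases hxC : x ∈ C i
  · have hρx := hρ1 _ (mem_iUnion_of_mem i (Set.mem_image_of_mem (P.param i) hxC))
    rw [hρx.self_of_nhds, one_mul, h.deriv_actionForm_conjugate h𝓗 hn hL hvol hM
      ((P.isPatch i).contMDiffAt hx) hxD
      (h.exists_wedge_partials_eq h𝓗 hn hL hvol hM hΓM hΓ (P.isPatch i) hx) hΦ.smooth hΦ.zero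
      hρx hτ0 hτ]
  · have h1 : P.weight i (P.param i x) = 0 := by
      refine hC0 i _ ((P.isPatch i).mem hx) ?_
      rintro ⟨y, hy, hyx⟩
      exact hxC ((P.isPatch i).injOn (hCU i hy) hx hyx ▸ hy)
    rw [h1, mul_zero, zero_mul, zero_mul]

/-- The image of a Hamiltonian curve under a conormal shift is a Hamiltonian curve. -/
theorem IsConormalShiftPair.isHamiltonianCurve (h : IsConormalShiftPair vol L M D D' g g')
    (h𝓗 : IsLegendreImage vol L M 𝓗) (hn : 1 ≤ n) (hL : IsSmoothLagrangian vol L)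
    (hvol : IsSmoothForm vol) (hM : IsOpen M) (hΓ : IsHamiltonianCurve vol 𝓗 M Γ) :
    IsHamiltonianCurve vol 𝓗 M (fibreMap g '' (Γ ∩ D)) := by
  refine ⟨h.isPositiveSubmanifold hΓ.submanifold,
    h.isCriticalPoint h𝓗 hn hL hvol hM hΓ.submanifold.1 hΓ.critical, ?_⟩
  obtain ⟨e, he⟩ := hΓ.level
  refine ⟨e, ?_⟩
  rintro _ ⟨m, hm, rfl⟩
  rw [h.left.hamiltonian_eq h𝓗 hn hm.2, he m hm.1]

end Critical

end LepageDedecker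

/-! ### The main theorem -/

theorem mainTheorem4 {n k : ℕ} (hn : 1 ≤ n) (hk : 1 ≤ k)
    {E : Type*} [NormedAddCommGroup E] [NormedSpace ℝ E] [FiniteDimensional ℝ E]
    (hE : Module.finrank ℝ E = n + k)
    {N : Type*} [TopologicalSpace N] [T2Space N] [SecondCountableTopology N]
    [ChartedSpace E N] [IsManifold 𝓘(ℝ, E) ∞ N]
    (vol : ∀ q : N, LepageDedecker.Form n E q) (hvol : LepageDedecker.IsSmoothForm vol)
    (hvol_closed : LepageDedecker.IsClosedForm vol) (hvol_ne : ∀ q, vol q ≠ 0)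
    (L : ∀ q : N, LepageDedecker.MultiVec n E q → ℝ) (hL : LepageDedecker.IsSmoothLagrangian vol L)
    (M : Set (LepageDedecker.FormBundle n E N)) (hM : IsOpen M)
    (𝓗 : LepageDedecker.FormBundle n E N → ℝ) (h𝓗 : LepageDedecker.IsLegendreImage vol L M 𝓗) :
    (∀ m ∈ M, ∀ v ∈ LepageDedecker.pseudofiberDirection vol L m,
      mfderiv (LepageDedecker.formModel n E) 𝓘(ℝ, ℝ) 𝓗 m v = 0) ∧
    ∀ Γ, LepageDedecker.IsHamiltonianCurve vol 𝓗 M Γ →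
      ∀ ξ : ∀ m : LepageDedecker.FormBundle n E N,
        TangentSpace (LepageDedecker.formModel n E) m,
      ContMDiffOn (LepageDedecker.formModel n E) (LepageDedecker.formModel n E).tangent ∞
        (fun m => (⟨m, ξ m⟩ : TangentBundle (LepageDedecker.formModel n E)
          (LepageDedecker.FormBundle n E N))) M →
      (∀ m ∈ M, ξ m ∈ LepageDedecker.pseudofiberDirection vol L m) →
      ∃ ε > 0, ∀ s : ℝ, |s| < ε →
        LepageDedecker.IsHamiltonianCurve vol 𝓗 M (LepageDedecker.flowImage M ξ s Γ) := by
  -- The value `ε = 1` is arbitrary: `flowImage` drops the points whose integral curves do not last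
  -- until time `s`, and for every `s` the remaining part is the image of an open part of `Γ` under
  -- a conormal shift.
  refine ⟨fun m hm v hv => ?_, fun Γ hΓ ξ hξs hξ => ⟨1, one_pos, fun s _ => ?_⟩⟩
  · obtain ⟨z, hz, η, hη, rfl⟩ := hv
    exact (h𝓗.mfderiv_verticalLift hn hL hM (p := m.snd) hm hz η).trans
      (LepageDedecker.pairing_conormal_self hn hz.1.1 hη)
  · obtain ⟨D, D', g, g', hp, hflow⟩ :=
      LepageDedecker.exists_isConormalShiftPair h𝓗 hn hL hM hξs hξ s
    rw [hflow]
    exact hp.isHamiltonianCurve h𝓗 hn hL hvol hM hΓ
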